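/- Let $n\ge 2$, let $M$ be an $n$-dimensional $C^\infty$ Riemannian manifold with metric $\langle\,,\rangle_M$, and endow $M\times\mathbb R$ with the product metric $\langle\,,\rangle=\langle\,,\rangle_M+dt^2$ and its Levi-Civita connection $\overline\nabla$. Let $\partial_t$ be the gradient of the projection $\pi_{\mathbb R}:M\times\mathbb R\to\mathbb R$. Let $\Sigma$ be an (immersed) $n$-dimensional smooth hypersurface of $M\times\mathbb R$ with a smooth unit normal field $N$. Its shape operator is $AX=-\overline\nabla_XN$, its height function is $\xi=\pi_{\mathbb R}|_\Sigma$, its angle function is $\theta=\langle N,\partial_t\rangle$, and $\nabla\xi$ is the gradient of $\xi$ with respect to the induced metric on $\Sigma$. The field $\nabla\xi$ is a principal direction of $\Sigma$ if at every point $\nabla\xi\neq0$ and $A\nabla\xi=\lambda\nabla\xi$ for some real $\lambda$, the corresponding principal curvature. The horizontal sections of $\Sigma$ are the sets $\Sigma_t=\{x\in\Sigma : \xi(x)=t\}$. Let $\Sigma_0$ be a smooth $(n-1)$-manifold, $f:\Sigma_0\to M$ a smooth immersion with a smooth unit normal field $\eta$, and $I\ni0$ an open interval such that for all $p\in\Sigma_0$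 the geodesic $\gamma_p(s)=\exp_M(f(p),s\eta(p))$ is defined for $s\in I$ and such that the maps $f_s:\Sigma_0\to M$, $f_s(p)=\gamma_p(s)$, are immersions for all $s\in I$ (the parallel hypersurfaces of $f$). Let $a:I\to\mathbb R$ be smooth with $a'>0$. The hypersurface $\Sigma$ is an $(f_s,a)$-graph if it is parametrized (up to a diffeomorphism $\Sigma_0\times I\to\Sigma$) by $(p,s)\mapsto(f_s(p),a(s))$, $p\in\Sigma_0$, $s\in I$. If $\Sigma$ is an $(f_s,a)$-graph, then: (i) $\theta$ and $\nabla\xi$ never vanish on $\Sigma$; (ii) $\nabla\xi$ is a principal direction of $\Sigma$; (iii) if $\Sigma$ is connected, or if $N$ is the upward unit normal field ($\theta>0$), then $\theta$ and the principal curvature of $\Sigma$ in the direction $\nabla\xi$ are constant along each horizontal section $\Sigma_t$. Conversely, if $\Sigma$ is a hypersurface whose angle function $\theta$ never vanishes and which has $\nabla\xi$ as a principal direction, then $\Sigma$ is locally an $(f_s,a)$-graph: every point of $\Sigma$ has an open neighbourhood in $\Sigma$ which is an $(f_s,a)$-graph for some $\Sigma_0$, $f$, $\eta$, $I$, $a$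 as above, where moreover $(p,s)\mapsto f_s(p)$ can be taken to be a diffeomorphism of $\Sigma_0\times I$ onto an open subset of $M$. -/

import Mathlib

open Bundle Set Manifold
open scoped ContDiff Topology

noncomputable section

namespace ParallelGraph

/-! ### Riemannian notions on a general manifold

A metric is given by its values `h x : T_x X → T_x X → ℝ`. In the theorem it is a smooth Riemannian
metric on `M`, the product metric on `M × ℝ`, or the metric induced on a hypersurface. -/

/-- The vector representing the functional `ℓ` with respect to the inner product `b`. It is unique
(and exists, in finite dimension) when `b` is an inner product and `ℓ` is linear. -/
def sharp {V : Type*} [Zero V] (b : V → V → ℝ) (ℓ : V → ℝ) : V :=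
  open scoped Classical in
  if hz : ∃ z, ∀ w, b z w = ℓ w then hz.choose else 0

section General

variable {E : Type*} [NormedAddCommGroup E] [NormedSpace ℝ E]
  {H : Type*} [TopologicalSpace H] {I : ModelWithCorners ℝ E H}
  {X : Type*} [TopologicalSpace X] [ChartedSpace H X]
  {E' : Type*} [NormedAddCommGroup E'] [NormedSpace ℝ E']
  {H' : Type*} [TopologicalSpace H'] {J : ModelWithCorners ℝ E' H'}
  {S : Type*} [TopologicalSpace S] [ChartedSpace H' S]

/-- The gradient at `x` of a real function with respect to the metric `h`. -/
def grad (h : ∀ x : X, TangentSpace I x → TangentSpace I x → ℝ) (ζ : X → ℝ) (x : X) :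
    TangentSpace I x :=
  sharp (h x) (fun w ↦ mvfderiv I ζ x w)

/-- The metric induced by a map `F : S → X`. -/
def inducedMetric (J : ModelWithCorners ℝ E' H')
    (h : ∀ x : X, TangentSpace I x → TangentSpace I x → ℝ) (F : S → X)
    (x : S) (v w : TangentSpace J x) : ℝ :=
  h (F x) (mfderiv J I F x v) (mfderiv J I F x w)

/-- The differential at `x` of the preferred chart around `x₀`: the coordinates of a tangent
vector. -/
def toCoord (I : ModelWithCorners ℝ E H) (x₀ x : X) : TangentSpace I x →L[ℝ] E :=
  mvfderiv I (extChartAt I x₀) x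

/-- The tangent vector at `x` with given coordinates in the preferred chart around `x₀`. -/
def ofCoord (I : ModelWithCorners ℝ E H) (x₀ x : X) : E →L[ℝ] TangentSpace I x :=
  (toCoord I x₀ x).inverse

/-- The metric in the preferred chart around `x₀`, at the point of coordinates `y`. -/
def coordMetric (h : ∀ x : X, TangentSpace I x → TangentSpace I x → ℝ) (x₀ : X) (y u v : E) : ℝ :=
  h ((extChartAt I x₀).symm y) (ofCoord I x₀ _ u) (ofCoord I x₀ _ v)

/-- The Christoffel symbols `Γ_y(u, v)` of the Levi-Civita connection of `h` in the preferred chart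
around `x₀`: the vector `Γ` such that, for all `w`,
`⟨Γ, w⟩ = (∂_u ⟨v, w⟩ + ∂_v ⟨u, w⟩ - ∂_w ⟨u, v⟩) / 2`. -/
def christoffel (h : ∀ x : X, TangentSpace I x → TangentSpace I x → ℝ) (x₀ : X) (y u v : E) : E :=
  sharp (coordMetric h x₀ y) fun w ↦
    (fderiv ℝ (fun z ↦ coordMetric h x₀ z v w) y u
      + fderiv ℝ (fun z ↦ coordMetric h x₀ z u w) y v
      - fderiv ℝ (fun z ↦ coordMetric h x₀ z u v) y w) / 2

/-- The Levi-Civita covariant derivative `∇_v V` at `x` of a vector field `V` along the map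
`F : S → X`, in the direction `v ∈ T_x S`; it is computed in the chart around `F x`, as
`d V (v) + Γ (d F (v), V)`. -/
def covDeriv (J : ModelWithCorners ℝ E' H')
    (h : ∀ x : X, TangentSpace I x → TangentSpace I x → ℝ) (F : S → X)
    (V : ∀ x : S, TangentSpace I (F x)) (x : S) (v : TangentSpace J x) : TangentSpace I (F x) :=
  ofCoord I (F x) (F x)
    (mvfderiv J (fun y ↦ toCoord I (F x) (F y) (V y)) x v
      + christoffel h (F x) (extChartAt I (F x) (F x))
          (toCoord I (F x) (F x) (mfderiv J I F x v)) (toCoord I (F x) (F x) (V x)))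

/-- The curve `γ` is a geodesic on the open set `T` of parameters: `∇_{γ'} γ' = 0`. -/
def IsGeodesicOn (h : ∀ x : X, TangentSpace I x → TangentSpace I x → ℝ) (γ : ℝ → X) (T : Set ℝ) :
    Prop :=
  ContMDiffOn 𝓘(ℝ, ℝ) I ∞ γ T ∧
    ∀ s ∈ T, covDeriv 𝓘(ℝ, ℝ) h γ (fun r ↦ mfderiv 𝓘(ℝ, ℝ) I γ r (1 : ℝ)) s (1 : ℝ) = 0

/-- `F` is a smooth immersion. -/
structure IsImmersed (J : ModelWithCorners ℝ E' H') (I : ModelWithCorners ℝ E H) (F : S → X) :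
    Prop where
  smooth : ContMDiff J I ∞ F
  injective : ∀ x, Function.Injective (mfderiv J I F x)

/-- `N` is a smooth unit normal field along `F`. -/
structure IsUnitNormal [IsManifold I 1 X] (J : ModelWithCorners ℝ E' H')
    (h : ∀ x : X, TangentSpace I x → TangentSpace I x → ℝ) (F : S → X)
    (N : ∀ x : S, TangentSpace I (F x)) : Prop where
  smooth : ContMDiff J I.tangent ∞ (fun x ↦ (⟨F x, N x⟩ : TangentBundle I X))
  unit : ∀ x, h (F x) (N x) (N x) = 1
  normal : ∀ (x : S) (v : TangentSpace J x), h (F x) (N x) (mfderiv J I F x v) = 0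

end General

/-! ### Hypersurfaces of `M × ℝ` -/

section Product

variable {n : ℕ} {M : Type*} [TopologicalSpace M] [ChartedSpace (EuclideanSpace ℝ (Fin n)) M]
  [IsManifold (𝓡 n) ∞ M]
  {E' : Type*} [NormedAddCommGroup E'] [NormedSpace ℝ E']
  {H' : Type*} [TopologicalSpace H'] {J : ModelWithCorners ℝ E' H'}
  {S : Type*} [TopologicalSpace S] [ChartedSpace H' S]
  {P : Type*} [TopologicalSpace P] [ChartedSpace (EuclideanSpace ℝ (Fin (n - 1))) P]

/-- The values of a smooth Riemannian metric on `M`. -/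
def metric (g : ContMDiffRiemannianMetric (𝓡 n) ∞ (EuclideanSpace ℝ (Fin n))
      (fun x : M ↦ TangentSpace (𝓡 n) x)) (x : M) (u v : TangentSpace (𝓡 n) x) : ℝ :=
  g.inner x u v

/-- The product metric `⟨ , ⟩_M + dt²` on `M × ℝ`. -/
def prodMetric (g : ContMDiffRiemannianMetric (𝓡 n) ∞ (EuclideanSpace ℝ (Fin n))
      (fun x : M ↦ TangentSpace (𝓡 n) x)) (q : M × ℝ)
    (u v : TangentSpace ((𝓡 n).prod 𝓘(ℝ, ℝ)) q) : ℝ :=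
  g.inner q.1 (mfderiv ((𝓡 n).prod 𝓘(ℝ, ℝ)) (𝓡 n) Prod.fst q u)
      (mfderiv ((𝓡 n).prod 𝓘(ℝ, ℝ)) (𝓡 n) Prod.fst q v)
    + mvfderiv ((𝓡 n).prod 𝓘(ℝ, ℝ)) (Prod.snd : M × ℝ → ℝ) q u
      * mvfderiv ((𝓡 n).prod 𝓘(ℝ, ℝ)) (Prod.snd : M × ℝ → ℝ) q v

/-- The vertical field `∂_t`: the gradient of the projection `M × ℝ → ℝ`. -/
def dt (g : ContMDiffRiemannianMetric (𝓡 n) ∞ (EuclideanSpace ℝ (Fin n))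
      (fun x : M ↦ TangentSpace (𝓡 n) x)) (q : M × ℝ) : TangentSpace ((𝓡 n).prod 𝓘(ℝ, ℝ)) q :=
  grad (prodMetric g) Prod.snd q

/-- The height function `ξ`. -/
def height (F : S → M × ℝ) (x : S) : ℝ := (F x).2

/-- The gradient `∇ξ` of the height function, for the metric induced on the hypersurface. -/
def gradHeight (J : ModelWithCorners ℝ E' H')
    (g : ContMDiffRiemannianMetric (𝓡 n) ∞ (EuclideanSpace ℝ (Fin n))
      (fun x : M ↦ TangentSpace (𝓡 n) x)) (F : S → M × ℝ) (x : S) : TangentSpace J x :=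
  grad (inducedMetric J (prodMetric g) F) (height F) x

/-- The angle function `θ = ⟨N, ∂_t⟩`. -/
def angle (g : ContMDiffRiemannianMetric (𝓡 n) ∞ (EuclideanSpace ℝ (Fin n))
      (fun x : M ↦ TangentSpace (𝓡 n) x)) (F : S → M × ℝ)
    (N : ∀ x : S, TangentSpace ((𝓡 n).prod 𝓘(ℝ, ℝ)) (F x)) (x : S) : ℝ :=
  prodMetric g (F x) (N x) (dt g (F x))

/-- The shape operator `A v = -∇_v N`, as a vector of the ambient tangent space at `F x`. -/
def shapeOperator (J : ModelWithCorners ℝ E' H')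
    (g : ContMDiffRiemannianMetric (𝓡 n) ∞ (EuclideanSpace ℝ (Fin n))
      (fun x : M ↦ TangentSpace (𝓡 n) x)) (F : S → M × ℝ)
    (N : ∀ x : S, TangentSpace ((𝓡 n).prod 𝓘(ℝ, ℝ)) (F x)) (x : S) (v : TangentSpace J x) :
    TangentSpace ((𝓡 n).prod 𝓘(ℝ, ℝ)) (F x) :=
  -covDeriv J (prodMetric g) F N x v

/-- `v ∈ T_x S` is a principal direction with principal curvature `κ`: `v ≠ 0` and `A v = κ v`. -/
def HasPrincipalCurvature
    (g : ContMDiffRiemannianMetric (𝓡 n) ∞ (EuclideanSpace ℝ (Fin n))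
      (fun x : M ↦ TangentSpace (𝓡 n) x)) (F : S → M × ℝ)
    (N : ∀ x : S, TangentSpace ((𝓡 n).prod 𝓘(ℝ, ℝ)) (F x)) (x : S) (v : TangentSpace J x)
    (κ : ℝ) : Prop :=
  v ≠ 0 ∧ shapeOperator J g F N x v = κ • mfderiv J ((𝓡 n).prod 𝓘(ℝ, ℝ)) F x v

/-- `v ∈ T_x S` is a principal direction. -/
def IsPrincipalDirection
    (g : ContMDiffRiemannianMetric (𝓡 n) ∞ (EuclideanSpace ℝ (Fin n))
      (fun x : M ↦ TangentSpace (𝓡 n) x)) (F : S → M × ℝ)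
    (N : ∀ x : S, TangentSpace ((𝓡 n).prod 𝓘(ℝ, ℝ)) (F x)) (x : S) (v : TangentSpace J x) : Prop :=
  ∃ κ : ℝ, HasPrincipalCurvature g F N x v κ

/-! ### Parallel families and `(f_s, a)`-graphs -/

/-- `f s : P → M`, for `s` in the open interval `T ∋ 0`, is the family of immersions parallel to
`f 0`, in the direction of the unit normal field `η` of `f 0`: the curve `s ↦ f s p` is the geodesic
`s ↦ exp (f 0 p, s η p)`, and the hypersurfaces `f s` have no focal points, that is, they are
immersions. -/
structure IsParallelFamily
    (g : ContMDiffRiemannianMetric (𝓡 n) ∞ (EuclideanSpace ℝ (Fin n))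
      (fun x : M ↦ TangentSpace (𝓡 n) x)) (T : Set ℝ) (f : ℝ → P → M)
    (η : ∀ p : P, TangentSpace (𝓡 n) (f 0 p)) : Prop where
  isOpen : IsOpen T
  ordConnected : T.OrdConnected
  zero_mem : (0 : ℝ) ∈ T
  smooth : ContMDiffOn ((𝓡 (n - 1)).prod 𝓘(ℝ, ℝ)) (𝓡 n) ∞ (fun q : P × ℝ ↦ f q.2 q.1) (univ ×ˢ T)
  unitNormal : IsUnitNormal (𝓡 (n - 1)) (metric g) (f 0) η
  geodesic : ∀ p, IsGeodesicOn (metric g) (fun s ↦ f s p) T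
  velocity : ∀ p, mfderiv 𝓘(ℝ, ℝ) (𝓡 n) (fun s ↦ f s p) 0 (1 : ℝ) = η p
  immersion : ∀ s ∈ T, IsImmersed (𝓡 (n - 1)) (𝓡 n) (f s)

/-- The map `(p, s) ↦ f s p = exp (f 0 p, s η p)`, which is the normal exponential map in the
trivialization of the normal bundle by `η`, is a diffeomorphism of `P × T` onto its (open) image. -/
def IsNormalDiffeo (T : Set ℝ) (f : ℝ → P → M) : Prop :=
  ∃ Φ : PartialDiffeomorph ((𝓡 (n - 1)).prod 𝓘(ℝ, ℝ)) (𝓡 n) (P × ℝ) M ∞,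
    Φ.source = univ ×ˢ T ∧ ∀ p, ∀ s ∈ T, Φ (p, s) = f s p

/-- The part `W` of the hypersurface `F : S → M × ℝ` is the `(f_s, a)`-graph of the family `f` and
the function `a`: it is parametrized diffeomorphically by `P × T`, as `(p, s) ↦ (f s p, a s)`. -/
structure IsGraphOn (J : ModelWithCorners ℝ E' H')
    (g : ContMDiffRiemannianMetric (𝓡 n) ∞ (EuclideanSpace ℝ (Fin n))
      (fun x : M ↦ TangentSpace (𝓡 n) x)) (T : Set ℝ) (f : ℝ → P → M)
    (η : ∀ p : P, TangentSpace (𝓡 n) (f 0 p)) (a : ℝ → ℝ) (F : S → M × ℝ) (W : Set S) :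
    Prop where
  parallel : IsParallelFamily g T f η
  smooth : ContDiffOn ℝ ∞ a T
  deriv_pos : ∀ s ∈ T, 0 < deriv a s
  param : ∃ Ψ : PartialDiffeomorph ((𝓡 (n - 1)).prod 𝓘(ℝ, ℝ)) J (P × ℝ) S ∞,
    Ψ.source = univ ×ˢ T ∧ Ψ.target = W ∧ ∀ p, ∀ s ∈ T, F (Ψ (p, s)) = (f s p, a s)

/-- `F` is locally an `(f_s, a)`-graph: each point has an open neighbourhood which is such a graph,
over a family whose normal exponential map is a diffeomorphism onto its image. -/
def IsLocallyGraph (J : ModelWithCorners ℝ E' H')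
    (g : ContMDiffRiemannianMetric (𝓡 n) ∞ (EuclideanSpace ℝ (Fin n))
      (fun x : M ↦ TangentSpace (𝓡 n) x)) (F : S → M × ℝ) : Prop :=
  ∀ x : S, ∃ W : Set S, IsOpen W ∧ x ∈ W ∧
    ∃ (P : Type) (_ : TopologicalSpace P) (_ : ChartedSpace (EuclideanSpace ℝ (Fin (n - 1))) P),
      IsManifold (𝓡 (n - 1)) ∞ P ∧ T2Space P ∧ SecondCountableTopology P ∧
      ∃ (T : Set ℝ) (f : ℝ → P → M) (η : ∀ p : P, TangentSpace (𝓡 n) (f 0 p)) (a : ℝ → ℝ),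
        IsGraphOn J g T f η a F W ∧ IsNormalDiffeo (n := n) T f

end Product

end ParallelGraph

end

noncomputable section

namespace ParallelGraph

/-! ### The inverse function theorem, with a smooth inverse on an open set -/

section InverseFunction

variable {E : Type*} [NormedAddCommGroup E] [NormedSpace ℝ E] [CompleteSpace E]
  {F : Type*} [NormedAddCommGroup F] [NormedSpace ℝ F]

/-! Write N = (N₁, θ) for the splitting of the normal into its parts along M and along ℝ. The
product connection splits too (`christoffel_prod`), and ∇ξ = ∂_t − θN, so ∇ξ projects to −θN₁ and
has height derivative 1 − θ². Everything is then read off on M, with N₁ as a field along the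
projection of the hypersurface.

For a graph, the Gauss lemma (`hasDerivAt_gauss`) makes the geodesics s ↦ f_s(p) of unit speed
orthogonal to all the hypersurfaces f_s. Orthogonality of N to the slices, on which the height is
constant, and to the curves s ↦ (f_s(p), a(s)) gives N₁ = −a'θ γ', whence θ²(1 + a'²) = 1 and ∇ξ =
a'θ² ∂_s. Since ∇_{γ'}γ' = 0, differentiating N along γ only differentiates the coefficients, and
the relation (a'θ)² + θ² = 1 shows that the result is a multiple of (γ', a'): the principal
curvature is −θ'/a'. Now θ² depends on s alone and s is determined by the height, so once the sign
of θ is fixed both θ and the curvature depend on the height alone.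

Conversely, normalize ∇ξ so that its projection to M has unit length. Along an integral curve the
projected velocity is a multiple of N₁, and principality of ∇ξ makes ∇N₁ a multiple of N₁ as well.
The acceleration is therefore parallel to the velocity, but orthogonal to it by unit speed, hence
zero: the projections are geodesics (`IsHeightPrincipal.isGeodesicOn`). Flow a level set of ξ along
this field. The Gauss lemma propagates the orthogonality of the geodesics to the slices, and that
orthogonality says exactly that ξ is constant on each slice (`IsFlowParam.mvfderiv_height_slice`).
Hence the flow box is a graph, with a(s) the height at time s.

Smoothness of the flow in its initial condition is obtained from the inverse function theorem in the
Banach space of continuous curves (`exists_contDiffOn_flow`). -/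

theorem exists_openPartialHomeomorph_contDiffOn_symm {f : E → F} {U : Set E} (hU : IsOpen U)
    (hf : ContDiffOn ℝ ∞ f U) {a : E} (ha : a ∈ U) (f' : E ≃L[ℝ] F)
    (hf' : HasFDerivAt f (f' : E →L[ℝ] F) a) :
    ∃ e : OpenPartialHomeomorph E F, a ∈ e.source ∧ e.source ⊆ U ∧ (∀ x, e x = f x) ∧
      ContDiffOn ℝ ∞ e.symm e.target := by
  have hfa : ContDiffAt ℝ ∞ f a := hf.contDiffAt (hU.mem_nhds ha)
  set e₀ := hfa.toOpenPartialHomeomorph f hf' (by simp) with he₀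
  have hcont : ContinuousOn (fderiv ℝ f) U := hf.continuousOn_fderiv_of_isOpen hU (by simp)
  -- The local inverse is smooth at the image of any point with invertible derivative. Invertible
  -- operators form an open set, so restricting the source to such points makes the inverse smooth
  -- on the whole target.
  have hV : IsOpen (U ∩ fderiv ℝ f ⁻¹' range ((↑) : (E ≃L[ℝ] F) → E →L[ℝ] F)) :=
    hcont.isOpen_inter_preimage hU ContinuousLinearEquiv.isOpen
  refine ⟨e₀.restrOpen _ hV, ⟨hfa.mem_toOpenPartialHomeomorph_source hf' (by simp), ha, f', ?_⟩,
    fun x hx ↦ hx.2.1, fun x ↦ rfl, fun y hy ↦ ?_⟩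
  · exact hf'.fderiv.symm
  · obtain ⟨-, hxU, f'', hf''⟩ := (e₀.restrOpen _ hV).map_target hy
    have hat := hf.contDiffAt (hU.mem_nhds hxU)
    have hd := (hat.differentiableAt (by simp)).hasFDerivAt
    rw [← hf''] at hd
    exact ((e₀.restrOpen _ hV).contDiffAt_symm hy hd hat).contDiffWithinAt

end InverseFunction

/-! ### Smooth dependence of the flow of a vector field on the initial condition -/

section Flow

open unitInterval

set_option synthInstance.maxHeartbeats 400000
set_option maxHeartbeats 1000000

/-- Postcomposition is continuous for the compact-open topology, which is that of the sup norm as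
the unit interval is compact. This gives uniformity in t without local compactness of E. -/
theorem exists_forall_norm_comp_add_sub_lt {E G : Type*} [NormedAddCommGroup E]
    [NormedAddCommGroup G] (D : C(E, G)) (γ : C(I, E)) {c : ℝ} (hc : 0 < c) :
    ∃ δ > 0, ∀ h : C(I, E), ‖h‖ < δ → ∀ t, ‖D (γ t + h t) - D (γ t)‖ < c := by
  have hcont : Continuous fun h : C(I, E) ↦ D.comp (γ + h) :=
    (ContinuousMap.continuous_postcomp D).comp (by fun_prop)
  obtain ⟨δ, hδ, hball⟩ := Metric.continuous_iff.1 hcont 0 c hc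
  refine ⟨δ, hδ, fun h hh t ↦ ?_⟩
  have := (ContinuousMap.dist_lt_iff hc).1 (hball h (by simpa using hh)) t
  rw [dist_eq_norm] at this
  simpa using this

universe u

variable {E : Type u} [NormedAddCommGroup E] [NormedSpace ℝ E]
  {F : Type u} [NormedAddCommGroup F] [NormedSpace ℝ F]
  {G : Type u} [NormedAddCommGroup G] [NormedSpace ℝ G]

/-- A bounded bilinear map, applied pointwise to continuous curves. -/
def bilinCurve (B : G →L[ℝ] E →L[ℝ] F) : C(I, G) →L[ℝ] C(I, E) →L[ℝ] C(I, F) :=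
  LinearMap.mkContinuous₂
    (LinearMap.mk₂ ℝ (fun (A : C(I, G)) (h : C(I, E)) ↦
        (⟨fun t ↦ B (A t) (h t), by fun_prop⟩ : C(I, F)))
      (fun _ _ _ ↦ by ext; simp) (fun _ _ _ ↦ by ext; simp) (fun _ _ _ ↦ by ext; simp)
      (fun _ _ _ ↦ by ext; simp)) ‖B‖
    (fun A h ↦ by
      rw [ContinuousMap.norm_le _ (by positivity)]
      intro t
      exact B.le_of_opNorm₂_le_of_le le_rfl (A.norm_coe_le_norm t) (h.norm_coe_le_norm t))

@[simp] theorem bilinCurve_apply (B : G →L[ℝ] E →L[ℝ] F) (A : C(I, G)) (h : C(I, E)) (t : I) :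
    bilinCurve B A h t = B (A t) (h t) := rfl

theorem _root_.ContDiff.bilinCurve {X : Type*} [NormedAddCommGroup X] [NormedSpace ℝ X]
    {n : WithTop ℕ∞} (B : G →L[ℝ] E →L[ℝ] F) {f : X → C(I, G)} (hf : ContDiff ℝ n f) :
    ContDiff ℝ n fun x ↦ ParallelGraph.bilinCurve B (f x) :=
  ContDiff.comp (g := ParallelGraph.bilinCurve B) (ContinuousLinearMap.contDiff (𝕜 := ℝ)
    (E := C(I, G)) (F := C(I, E) →L[ℝ] C(I, F)) (ParallelGraph.bilinCurve B)) hf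

/-- Pointwise, the mean value inequality on the segment from γ(t) to γ(t) + h(t) bounds the
remainder by the oscillation of Dv there, which is small uniformly in t. -/
theorem hasFDerivAt_comp_curve {v : E → F} (hv : ContDiff ℝ 1 v) (γ : C(I, E)) :
    HasFDerivAt (fun γ : C(I, E) ↦ (⟨v, hv.continuous⟩ : C(E, F)).comp γ)
      (bilinCurve (.id ℝ (E →L[ℝ] F))
        ((⟨fderiv ℝ v, hv.continuous_fderiv one_ne_zero⟩ : C(E, E →L[ℝ] F)).comp γ))
      γ := by
  set D : C(E, E →L[ℝ] F) := ⟨fderiv ℝ v, hv.continuous_fderiv one_ne_zero⟩ with hD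
  rw [hasFDerivAt_iff_isLittleO_nhds_zero, Asymptotics.isLittleO_iff]
  intro c hc
  obtain ⟨δ, hδ, hball⟩ := exists_forall_norm_comp_add_sub_lt D γ hc
  filter_upwards [Metric.ball_mem_nhds (0 : C(I, E)) hδ] with h hh
  rw [ContinuousMap.norm_le _ (by positivity)]
  intro t
  have hseg : ∀ z ∈ segment ℝ (γ t) (γ t + h t), ‖fderiv ℝ v z - fderiv ℝ v (γ t)‖ ≤ c := by
    intro z hz
    rw [segment_eq_image'] at hz
    obtain ⟨r, hr, rfl⟩ := hz
    have hrh : ‖r • h‖ < δ := by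
      rw [norm_smul, Real.norm_of_nonneg hr.1]
      have := mem_ball_zero_iff.1 hh
      nlinarith [hr.2, norm_nonneg h]
    simpa [hD] using (hball _ hrh t).le
  have := (convex_segment (γ t) (γ t + h t)).norm_image_sub_le_of_norm_fderiv_le' (𝕜 := ℝ)
    (fun z _ ↦ (hv.differentiable one_ne_zero) z) hseg (left_mem_segment ℝ _ _)
    (right_mem_segment ℝ _ _)
  simp only [add_sub_cancel_left] at this
  refine le_trans ?_ (this.trans (mul_le_mul_of_nonneg_left (h.norm_coe_le_norm t) hc.le))
  simp [hD]

/-- The derivative of v ∘ · is again a composition operator, that of Dv, followed by a bounded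
linear map; hence the induction on the order. It replaces F by E →L F, which is why all the spaces
share one universe. -/
theorem contDiff_comp_curve {v : E → F} (hv : ContDiff ℝ ∞ v) :
    ContDiff ℝ ∞ (fun γ : C(I, E) ↦ (⟨v, hv.continuous⟩ : C(E, F)).comp γ) := by
  rw [contDiff_infty]
  intro n
  induction n generalizing F with
  | zero =>
    exact contDiff_zero.2 (ContinuousMap.continuous_postcomp _)
  | succ n ih =>
    have hD : ContDiff ℝ ∞ (fderiv ℝ v) := hv.fderiv_right (by simp)
    rw [Nat.cast_add, Nat.cast_one]
    refine contDiff_succ_iff_hasFDerivAt.2 ⟨_, ?_, hasFDerivAt_comp_curve (hv.of_le (by simp))⟩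
    exact (ih hD).bilinCurve _

/-- The primitive, vanishing at `0`, of a continuous curve defined on the unit interval. -/
def primitiveCurve [CompleteSpace E] : C(I, E) →L[ℝ] C(I, E) :=
  LinearMap.mkContinuous
    { toFun := fun γ ↦ ⟨fun t ↦ ∫ r in (0 : ℝ)..t, IccExtend zero_le_one γ r, by
        have hc : Continuous (IccExtend (zero_le_one' ℝ) γ) := γ.continuous.Icc_extend'
        exact (intervalIntegral.continuous_primitive (fun a b ↦ hc.intervalIntegrable a b) 0).comp
          continuous_subtype_val⟩
      map_add' := fun γ γ' ↦ by
        ext t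
        have hc : ∀ γ : C(I, E), Continuous (IccExtend (zero_le_one' ℝ) γ) :=
          fun γ ↦ γ.continuous.Icc_extend'
        exact intervalIntegral.integral_add ((hc γ).intervalIntegrable _ _)
          ((hc γ').intervalIntegrable _ _)
      map_smul' := fun c γ ↦ by
        ext t
        exact intervalIntegral.integral_smul c _ } 1
    (fun γ ↦ by
      rw [one_mul, ContinuousMap.norm_le _ (by positivity)]
      intro t
      refine (intervalIntegral.norm_integral_le_of_norm_le_const
        (C := ‖γ‖) fun r _ ↦ γ.norm_coe_le_norm _).trans ?_
      have h1 : |(t : ℝ) - 0| ≤ 1 := by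
        rw [sub_zero, abs_of_nonneg t.2.1]; exact t.2.2
      nlinarith [norm_nonneg γ])

theorem primitiveCurve_apply [CompleteSpace E] (γ : C(I, E)) (t : I) :
    primitiveCurve γ t = ∫ r in (0 : ℝ)..t, IccExtend zero_le_one γ r := rfl

/-- The constant curves. -/
def constCurve : E →L[ℝ] C(I, E) :=
  LinearMap.mkContinuous
    { toFun := fun x ↦ ContinuousMap.const I x
      map_add' := fun _ _ ↦ rfl
      map_smul' := fun _ _ ↦ rfl } 1
    (fun x ↦ by
      rw [one_mul, ContinuousMap.norm_le _ (by positivity)]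
      exact fun _ ↦ le_rfl)

@[simp] theorem constCurve_apply (x : E) (t : I) : constCurve x t = x := rfl

/-- The integral equation of the rescaled integral curves of `v`: its zeros `((s, x), γ)` are such
that `γ` is the solution of `γ' = s v(γ)` with `γ(0) = x`. -/
def integralEquation [CompleteSpace E] {v : E → E} (hv : Continuous v)
    (q : (ℝ × E) × C(I, E)) : (ℝ × E) × C(I, E) :=
  (q.1, q.2 - constCurve q.1.2 - q.1.1 • primitiveCurve ((⟨v, hv⟩ : C(E, E)).comp q.2))

theorem contDiff_integralEquation [CompleteSpace E] {v : E → E} (hv : ContDiff ℝ ∞ v) :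
    ContDiff ℝ ∞ (integralEquation hv.continuous) := by
  have h1 : ContDiff ℝ ∞ fun q : (ℝ × E) × C(I, E) ↦ constCurve q.1.2 :=
    (constCurve (E := E)).contDiff.comp (contDiff_snd.comp contDiff_fst)
  have h2 : ContDiff ℝ ∞ fun q : (ℝ × E) × C(I, E) ↦
      primitiveCurve ((⟨v, hv.continuous⟩ : C(E, E)).comp q.2) :=
    primitiveCurve.contDiff.comp ((contDiff_comp_curve hv).comp contDiff_snd)
  have h3 : ContDiff ℝ ∞ fun q : (ℝ × E) × C(I, E) ↦ q.1.1 := contDiff_fst.comp contDiff_fst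
  exact contDiff_fst.prodMk ((contDiff_snd.sub h1).sub (h3.smul h2))

/-- At s = 0 the factor s kills the derivative of the integral term in γ, so the differential is
triangular with identities on the diagonal, hence invertible. -/
theorem hasFDerivAt_integralEquation [CompleteSpace E] {v : E → E} (hv : ContDiff ℝ ∞ v) (x₀ : E) :
    ∃ L : ((ℝ × E) × C(I, E)) ≃L[ℝ] ((ℝ × E) × C(I, E)),
      HasFDerivAt (integralEquation hv.continuous)
        (L : ((ℝ × E) × C(I, E)) →L[ℝ] ((ℝ × E) × C(I, E))) ((0, x₀), constCurve x₀) := by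
  set w := primitiveCurve ((⟨v, hv.continuous⟩ : C(E, E)).comp (constCurve x₀)) with hw
  refine ⟨ContinuousLinearEquiv.skewProd (.refl ℝ _) (.refl ℝ _)
    (-(constCurve.comp (.snd ℝ ℝ E)) - (ContinuousLinearMap.fst ℝ ℝ E).smulRight w), ?_⟩
  have h1 : HasFDerivAt (fun q : (ℝ × E) × C(I, E) ↦ constCurve q.1.2)
      (constCurve.comp ((ContinuousLinearMap.snd ℝ ℝ E).comp (.fst ℝ (ℝ × E) C(I, E))))
      ((0, x₀), constCurve x₀) :=
    (constCurve.comp ((ContinuousLinearMap.snd ℝ ℝ E).comp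
      (.fst ℝ (ℝ × E) C(I, E)))).hasFDerivAt
  have h2 : ContDiff ℝ ∞ fun q : (ℝ × E) × C(I, E) ↦
      primitiveCurve ((⟨v, hv.continuous⟩ : C(E, E)).comp q.2) :=
    primitiveCurve.contDiff.comp ((contDiff_comp_curve hv).comp contDiff_snd)
  have h3 : HasFDerivAt (fun q : (ℝ × E) × C(I, E) ↦ q.1.1)
      ((ContinuousLinearMap.fst ℝ ℝ E).comp (.fst ℝ (ℝ × E) C(I, E)))
      ((0, x₀), constCurve x₀) :=
    ((ContinuousLinearMap.fst ℝ ℝ E).comp (.fst ℝ (ℝ × E) C(I, E))).hasFDerivAt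
  have h4 := h3.smul (h2.differentiable (by simp) ((0, x₀), constCurve x₀)).hasFDerivAt
  have h5 := (hasFDerivAt_fst (𝕜 := ℝ) (p := (((0 : ℝ), x₀), constCurve x₀))).prodMk
    ((hasFDerivAt_snd.sub h1).sub h4)
  refine h5.congr_fderiv ?_
  ext q <;> simp [ContinuousLinearEquiv.skewProd, hw]

/-- The local flow of a smooth vector field exists and is smooth. -/
theorem exists_contDiffOn_flow [CompleteSpace E] {v : E → E} (hv : ContDiff ℝ ∞ v) (x₀ : E) :
    ∃ Φ : ℝ × E → E, ∃ δ > 0, ContDiffOn ℝ ∞ Φ (Ioo (-δ) δ ×ˢ Metric.ball x₀ δ) ∧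
      (∀ x ∈ Metric.ball x₀ δ, Φ (0, x) = x) ∧
      ∀ s ∈ Ioo (-δ) δ, ∀ x ∈ Metric.ball x₀ δ,
        HasDerivAt (fun r ↦ Φ (r, x)) (v (Φ (s, x))) s := by
  obtain ⟨L, hL⟩ := hasFDerivAt_integralEquation hv x₀
  obtain ⟨e, hmem, -, he, hsymm⟩ := exists_openPartialHomeomorph_contDiffOn_symm isOpen_univ
    (contDiff_integralEquation hv).contDiffOn (mem_univ _) L hL
  have hbase : e ((0, x₀), constCurve x₀) = ((0, x₀), 0) := by
    rw [he]; simp [integralEquation]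
  have htgt : ((0, x₀), 0) ∈ e.target := hbase ▸ e.map_source hmem
  obtain ⟨ε, hε, hεs⟩ := Metric.isOpen_iff.1 e.open_source _ hmem
  -- The implicit function: γ (s, x) is the zero of the integral equation with parameters (s, x)
  -- given by the local inverse.
  set γ : ℝ × E → C(I, E) := fun p ↦ (e.symm (p, 0)).2 with hγ
  have hcont : ContinuousAt γ (0, x₀) := by
    refine continuousAt_snd.comp (ContinuousAt.comp (f := fun p : ℝ × E ↦ (p, (0 : C(I, E))))
      (e.symm.continuousAt htgt) (by fun_prop))
  have hγ0 : γ (0, x₀) = constCurve x₀ := by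
    simp only [hγ, ← hbase, e.left_inv hmem]
  have hev : ∀ᶠ p in 𝓝 ((0 : ℝ), x₀), (p, (0 : C(I, E))) ∈ e.target ∧
      dist (γ p) (constCurve x₀) < ε := by
    refine Filter.Eventually.and ?_ ?_
    · exact (ContinuousAt.prodMk continuousAt_id continuousAt_const).eventually
        (e.open_target.mem_nhds htgt)
    · rw [← hγ0]
      exact hcont.eventually (Metric.ball_mem_nhds _ hε)
  obtain ⟨δ', hδ', hball⟩ := Metric.eventually_nhds_iff.1 hev
  set δ := min δ' ε with hδdef
  have hδ : 0 < δ := lt_min hδ' hε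
  have hbox : ∀ s ∈ Ioo (-δ) δ, ∀ x ∈ Metric.ball x₀ δ,
      ((s, x), (0 : C(I, E))) ∈ e.target ∧ dist (γ (s, x)) (constCurve x₀) < ε := by
    intro s hs x hx
    refine hball ?_
    rw [Prod.dist_eq, max_lt_iff]
    refine ⟨?_, (Metric.mem_ball.1 hx).trans_le (min_le_left _ _)⟩
    rw [Real.dist_0_eq_abs]
    exact (abs_lt.2 hs).trans_le (min_le_left _ _)
  have heq : ∀ s ∈ Ioo (-δ) δ, ∀ x ∈ Metric.ball x₀ δ, γ (s, x) = constCurve x +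
      s • primitiveCurve ((⟨v, hv.continuous⟩ : C(E, E)).comp (γ (s, x))) := by
    intro s hs x hx
    have h1 := e.right_inv (hbox s hs x hx).1
    rw [he, integralEquation, Prod.mk.injEq] at h1
    have h2 := h1.2
    rw [h1.1] at h2
    rw [sub_sub, sub_eq_zero] at h2
    exact h2
  -- Uniqueness among curves close to the constant one is the injectivity of `e` on its source; no
  -- Grönwall estimate is needed.
  have huniq : ∀ s ∈ Ioo (-δ) δ, ∀ x ∈ Metric.ball x₀ δ, ∀ β : C(I, E),
      dist β (constCurve x₀) < ε → β = constCurve x +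
        s • primitiveCurve ((⟨v, hv.continuous⟩ : C(E, E)).comp β) → β = γ (s, x) := by
    intro s hs x hx β hβ h
    have h1 : ((s, x), β) ∈ e.source := by
      refine hεs ?_
      rw [Metric.mem_ball, Prod.dist_eq, max_lt_iff, Prod.dist_eq, max_lt_iff]
      refine ⟨⟨?_, (Metric.mem_ball.1 hx).trans_le (min_le_right _ _)⟩, hβ⟩
      rw [Real.dist_0_eq_abs]
      exact (abs_lt.2 hs).trans_le (min_le_right _ _)
    have h2 : e ((s, x), β) = ((s, x), 0) := by
      rw [he, integralEquation]
      simp only [Prod.mk.injEq, true_and]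
      rw [sub_sub, sub_eq_zero]
      exact h
    rw [hγ]
    simp only
    rw [← h2, e.left_inv h1]
  -- The curve r ↦ γ(s, x)(τr) solves the equation with parameter sτ, so uniqueness identifies it.
  -- Evaluation at time 1 thus loses no information, and the rescaling can be undone.
  have hscale : ∀ s ∈ Ioo (-δ) δ, ∀ x ∈ Metric.ball x₀ δ, ∀ τ : I,
      γ (s * τ, x) 1 = γ (s, x) τ := by
    intro s hs x hx τ
    set β : C(I, E) := (γ (s, x)).comp ⟨fun r ↦ τ * r, by fun_prop⟩ with hβ
    have hs' : s * τ ∈ Ioo (-δ) δ := by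
      rw [mem_Ioo, ← abs_lt, abs_mul, abs_of_nonneg τ.2.1]
      exact (mul_le_of_le_one_right (abs_nonneg s) τ.2.2).trans_lt (abs_lt.2 hs)
    have h1 : β = γ (s * τ, x) := by
      refine huniq _ hs' x hx β ?_ ?_
      · refine lt_of_le_of_lt ?_ (hbox s hs x hx).2
        rw [ContinuousMap.dist_le dist_nonneg]
        exact fun r ↦ ContinuousMap.dist_apply_le_dist (f := γ (s, x)) (g := constCurve x₀) (τ * r)
      · ext r
        have h2 := congrArg (fun η : C(I, E) ↦ η (τ * r)) (heq s hs x hx)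
        simp only [ContinuousMap.add_apply, constCurve_apply, ContinuousMap.smul_apply] at h2
        simp only [ContinuousMap.add_apply, constCurve_apply, ContinuousMap.smul_apply]
        refine h2.trans ?_
        rw [mul_smul]
        congr 2
        rw [primitiveCurve_apply, primitiveCurve_apply]
        have h3 : (∫ q in (0 : ℝ)..r, IccExtend zero_le_one
            (((⟨v, hv.continuous⟩ : C(E, E)).comp β)) q) = ∫ q in (0 : ℝ)..r, IccExtend zero_le_one
            (((⟨v, hv.continuous⟩ : C(E, E)).comp (γ (s, x)))) (τ * q) := by
          refine intervalIntegral.integral_congr fun q hq ↦ ?_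
          rw [uIcc_of_le r.2.1] at hq
          have hq' : q ∈ Icc (0 : ℝ) 1 := ⟨hq.1, hq.2.trans r.2.2⟩
          have hτq : (τ : ℝ) * q ∈ Icc (0 : ℝ) 1 := (τ * ⟨q, hq'⟩ : I).2
          rw [IccExtend_of_mem _ _ hq', IccExtend_of_mem _ _ hτq]
          rfl
        rw [h3, intervalIntegral.smul_integral_comp_mul_left]
        simp
    rw [← h1]
    simp [hβ]
  set Φ : ℝ × E → E := fun p ↦ γ p 1 with hΦ
  have hsmooth : ContDiffOn ℝ ∞ Φ (Ioo (-δ) δ ×ˢ Metric.ball x₀ δ) := by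
    have h1 : ContDiffOn ℝ ∞ γ (Ioo (-δ) δ ×ˢ Metric.ball x₀ δ) :=
      contDiff_snd.comp_contDiffOn (hsymm.comp
        (contDiff_id.prodMk contDiff_const).contDiffOn (fun p hp ↦ (hbox p.1 hp.1 p.2 hp.2).1))
    exact (ContinuousMap.evalCLM ℝ (1 : I)).contDiff.comp_contDiffOn h1
  have hintegral : ∀ s ∈ Ioo (-δ) δ, ∀ x ∈ Metric.ball x₀ δ,
      Φ (s, x) = x + ∫ q in (0 : ℝ)..s, v (Φ (q, x)) := by
    intro s hs x hx
    have h2 := congrArg (fun η : C(I, E) ↦ η 1) (heq s hs x hx)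
    simp only [ContinuousMap.add_apply, constCurve_apply, ContinuousMap.smul_apply,
      primitiveCurve_apply] at h2
    refine h2.trans ?_
    have h3 : (∫ q in (0 : ℝ)..(1 : I), IccExtend zero_le_one
        (((⟨v, hv.continuous⟩ : C(E, E)).comp (γ (s, x)))) q) =
        ∫ q in (0 : ℝ)..1, v (Φ (s * q, x)) := by
      refine intervalIntegral.integral_congr fun q hq ↦ ?_
      rw [uIcc_of_le (by simp)] at hq
      rw [IccExtend_of_mem _ _ hq]
      simp only [hΦ, ContinuousMap.comp_apply, ContinuousMap.coe_mk]
      rw [← hscale s hs x hx ⟨q, hq⟩]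
    rw [h3, intervalIntegral.smul_integral_comp_mul_left (fun q ↦ v (Φ (q, x)))]
    simp
  refine ⟨Φ, δ, hδ, hsmooth, fun x hx ↦ ?_, fun s hs x hx ↦ ?_⟩
  · rw [hintegral 0 ⟨by linarith, hδ⟩ x hx]; simp
  · have hc : ContinuousOn (fun q ↦ v (Φ (q, x))) (Ioo (-δ) δ) :=
      hv.continuous.comp_continuousOn (hsmooth.continuousOn.comp
        (Continuous.continuousOn (by fun_prop)) (fun q hq ↦ ⟨hq, hx⟩))
    have hnhds : Ioo (-δ) δ ∈ 𝓝 s := Ioo_mem_nhds hs.1 hs.2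
    have hsub : uIcc 0 s ⊆ Ioo (-δ) δ :=
      ordConnected_Ioo.uIcc_subset ⟨by linarith, hδ⟩ hs
    have h1 : HasDerivAt (fun r ↦ x + ∫ q in (0 : ℝ)..r, v (Φ (q, x))) (v (Φ (s, x))) s := by
      refine HasDerivAt.const_add x ?_
      exact intervalIntegral.integral_hasDerivAt_right (hc.mono hsub).intervalIntegrable
        (hc.stronglyMeasurableAtFilter isOpen_Ioo s hs) (hc.continuousAt hnhds)
    refine h1.congr_of_eventuallyEq ?_
    filter_upwards [hnhds] with r hr using hintegral r hr x hx

/-- The local flow, inside a given open set, of a vector field that is smooth on this set. -/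
theorem exists_contDiffOn_flow_of_contDiffOn [FiniteDimensional ℝ E] {v : E → E} {U : Set E}
    (hU : IsOpen U) (hv : ContDiffOn ℝ ∞ v U) {x₀ : E} (hx₀ : x₀ ∈ U) :
    ∃ Φ : ℝ × E → E, ∃ δ > 0, ContDiffOn ℝ ∞ Φ (Ioo (-δ) δ ×ˢ Metric.ball x₀ δ) ∧
      (∀ x ∈ Metric.ball x₀ δ, Φ (0, x) = x) ∧
      ∀ s ∈ Ioo (-δ) δ, ∀ x ∈ Metric.ball x₀ δ, Φ (s, x) ∈ U ∧
        HasDerivAt (fun r ↦ Φ (r, x)) (v (Φ (s, x))) s := by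
  have : CompleteSpace E := FiniteDimensional.complete ℝ E
  obtain ⟨r, hr, hrU⟩ := Metric.isOpen_iff.1 hU _ hx₀
  -- Cutting off with a bump function supported in U makes the field globally smooth. Where the flow
  -- stays in the inner ball of radius r / 4, the bump is 1 and the field is the original one.
  let χ : ContDiffBump x₀ :=
    { rIn := r / 4, rOut := r / 2, rIn_pos := by positivity, rIn_lt_rOut := by linarith }
  have hχU : tsupport χ ⊆ U := by
    rw [χ.tsupport_eq]
    exact (Metric.closedBall_subset_ball (by simp only [χ]; linarith)).trans hrU
  have hχ : ContDiff ℝ ∞ χ := χ.contDiff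
  have hsmooth : ContDiff ℝ ∞ (fun x ↦ χ x • v x) := by
    refine contDiff_iff_contDiffAt.2 fun x ↦ ?_
    by_cases hx : x ∈ tsupport χ
    · exact hχ.contDiffAt.smul (hv.contDiffAt (hU.mem_nhds (hχU hx)))
    · have : (fun y ↦ χ y • v y) =ᶠ[𝓝 x] fun _ ↦ 0 := by
        filter_upwards [(isClosed_tsupport χ).isOpen_compl.mem_nhds hx] with y hy
        rw [image_eq_zero_of_notMem_tsupport hy, zero_smul]
      exact contDiffAt_const.congr_of_eventuallyEq this
  obtain ⟨Φ, δ, hδ, hΦ, hΦ0, hΦd⟩ := exists_contDiffOn_flow hsmooth x₀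
  have hopen : IsOpen (Ioo (-δ) δ ×ˢ Metric.ball x₀ δ) := isOpen_Ioo.prod Metric.isOpen_ball
  have hcont : ContinuousAt Φ (0, x₀) := hΦ.continuousOn.continuousAt
    (hopen.mem_nhds ⟨⟨by linarith, hδ⟩, Metric.mem_ball_self hδ⟩)
  have hnhds : Φ ⁻¹' Metric.ball x₀ (r / 4) ∈ 𝓝 ((0 : ℝ), x₀) := by
    refine hcont.preimage_mem_nhds ?_
    rw [hΦ0 _ (Metric.mem_ball_self hδ)]
    exact Metric.ball_mem_nhds _ (by positivity)
  obtain ⟨δ', hδ', hball⟩ := Metric.mem_nhds_iff.1 hnhds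
  have hmin : 0 < min δ δ' := lt_min hδ hδ'
  have hIoo : Ioo (-min δ δ') (min δ δ') ⊆ Ioo (-δ) δ :=
    Ioo_subset_Ioo (neg_le_neg (min_le_left _ _)) (min_le_left _ _)
  have hbb : Metric.ball x₀ (min δ δ') ⊆ Metric.ball x₀ δ :=
    Metric.ball_subset_ball (min_le_left _ _)
  refine ⟨Φ, min δ δ', hmin, hΦ.mono (prod_mono hIoo hbb), fun x hx ↦ hΦ0 x (hbb hx),
    fun s hs x hx ↦ ?_⟩
  have hmem : Φ (s, x) ∈ Metric.ball x₀ (r / 4) := by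
    refine hball ?_
    rw [Metric.mem_ball, Prod.dist_eq, max_lt_iff, Real.dist_0_eq_abs]
    exact ⟨(abs_lt.2 hs).trans_le (min_le_right _ _),
      (Metric.mem_ball.1 hx).trans_le (min_le_right _ _)⟩
  refine ⟨hrU (Metric.ball_subset_ball (by linarith) hmem), ?_⟩
  have h := hΦd s (hIoo hs) x (hbb hx)
  rwa [χ.one_of_mem_closedBall (Metric.ball_subset_closedBall hmem), one_smul] at h

end Flow

/-! ### Coordinates of tangent vectors -/

section Coordinates

variable {E : Type*} [NormedAddCommGroup E] [NormedSpace ℝ E]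
  {H : Type*} [TopologicalSpace H] {I : ModelWithCorners ℝ E H}
  {X : Type*} [TopologicalSpace X] [ChartedSpace H X]
  {E' : Type*} [NormedAddCommGroup E'] [NormedSpace ℝ E']
  {H' : Type*} [TopologicalSpace H'] {J : ModelWithCorners ℝ E' H'}
  {S : Type*} [TopologicalSpace S] [ChartedSpace H' S]

theorem extChartAt_mem_target (x₀ : X) {x : X} (hx : x ∈ (chartAt H x₀).source) :
    extChartAt I x₀ x ∈ (extChartAt I x₀).target :=
  (extChartAt I x₀).map_source (by rwa [extChartAt_source])

variable [IsManifold I ∞ X]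

theorem isInvertible_toCoord {x₀ x : X} (hx : x ∈ (chartAt H x₀).source) :
    (toCoord I x₀ x).IsInvertible := by
  exact isInvertible_mfderiv_extChartAt (by rwa [extChartAt_source])

theorem ofCoord_toCoord {x₀ x : X} (hx : x ∈ (chartAt H x₀).source) (v : TangentSpace I x) :
    ofCoord I x₀ x (toCoord I x₀ x v) = v :=
  (isInvertible_toCoord hx).inverse_apply_self v

theorem toCoord_ofCoord {x₀ x : X} (hx : x ∈ (chartAt H x₀).source) (u : E) :
    toCoord I x₀ x (ofCoord I x₀ x u) = u :=
  (isInvertible_toCoord hx).self_apply_inverse u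

/-- The bridge between smoothness in the tangent bundle, defined by trivializations, and the
coordinates in which the covariant derivative is computed. -/
theorem trivializationAt_eq_toCoord {x₀ x : X} (hx : x ∈ (chartAt H x₀).source)
    (v : TangentSpace I x) :
    trivializationAt E (TangentSpace I) x₀ ⟨x, v⟩ = (x, toCoord I x₀ x v) := by
  refine Prod.ext (TangentBundle.trivializationAt_fst x₀ _) ?_
  have h := congrArg (fun L ↦ L v)
    (TangentBundle.continuousLinearMapAt_trivializationAt (𝕜 := ℝ) (I := I) hx)
  refine Eq.trans ?_ h
  exact (Trivialization.continuousLinearMapAt_apply_of_mem ℝ _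
    (by rwa [TangentBundle.trivializationAt_baseSet]) v).symm

theorem contMDiffOn_ofCoord (x₀ : X) (u : E) :
    ContMDiffOn I I.tangent ∞ (fun x ↦ (⟨x, ofCoord I x₀ x u⟩ : TangentBundle I X))
      (chartAt H x₀).source := by
  set e := trivializationAt E (TangentSpace I : X → Type _) x₀ with he
  have hb : e.baseSet = (chartAt H x₀).source := TangentBundle.trivializationAt_baseSet x₀
  have h1 : ContMDiffOn I (I.prod 𝓘(ℝ, E)) ∞ (fun x : X ↦ (x, u)) (chartAt H x₀).source :=
    (contMDiff_id.prodMk contMDiff_const).contMDiffOn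
  have h2 := (e.contMDiffOn_symm (IB := I) (n := ∞)).comp h1
    (fun x hx ↦ by rw [mem_preimage, e.mem_target, hb]; exact hx)
  refine h2.congr fun x hx ↦ ?_
  have h3 : e ⟨x, ofCoord I x₀ x u⟩ = (x, u) := by
    rw [he, trivializationAt_eq_toCoord hx, toCoord_ofCoord hx]
  simp only [Function.comp_apply]
  rw [← h3]
  refine (e.left_inv ?_).symm
  rw [e.mem_source, hb]
  exact hx

theorem toCoord_mfderiv {F : S → X} {y : S} (hF : MDifferentiableAt J I F y) {x₀ : X}
    (hx : F y ∈ (chartAt H x₀).source) (v : TangentSpace J y) :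
    toCoord I x₀ (F y) (mfderiv J I F y v) = mvfderiv J (fun z ↦ extChartAt I x₀ (F z)) y v := by
  exact (mfderiv_comp_apply y (mdifferentiableAt_extChartAt hx) hF v).symm

theorem mvfderiv_real_one {f : ℝ → E} {s : ℝ} :
    mvfderiv 𝓘(ℝ, ℝ) f s (1 : ℝ) = deriv f s := by
  rw [← fderiv_apply_one_eq_deriv]
  exact congrArg (fun L : ℝ →L[ℝ] E ↦ L 1) (mfderiv_eq_fderiv (f := f) (x := s))

end Coordinates

/-! ### The Riemannian metric in coordinates and the Koszul formula. -/

section Metric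

variable {n : ℕ} {M : Type*} [TopologicalSpace M] [ChartedSpace (EuclideanSpace ℝ (Fin n)) M]
  [IsManifold (𝓡 n) ∞ M]
  (g : ContMDiffRiemannianMetric (𝓡 n) ∞ (EuclideanSpace ℝ (Fin n))
      (fun x : M ↦ TangentSpace (𝓡 n) x))

theorem contMDiffAt_inner {E' : Type*} [NormedAddCommGroup E'] [NormedSpace ℝ E']
    {H' : Type*} [TopologicalSpace H'] {J : ModelWithCorners ℝ E' H'}
    {S : Type*} [TopologicalSpace S] [ChartedSpace H' S] {F : S → M}
    {V W : ∀ x : S, TangentSpace (𝓡 n) (F x)} {x : S}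
    (hV : ContMDiffAt J (𝓡 n).tangent ∞ (fun y ↦ (⟨F y, V y⟩ : TangentBundle (𝓡 n) M)) x)
    (hW : ContMDiffAt J (𝓡 n).tangent ∞ (fun y ↦ (⟨F y, W y⟩ : TangentBundle (𝓡 n) M)) x) :
    ContMDiffAt J 𝓘(ℝ, ℝ) ∞ (fun y ↦ g.inner (F y) (V y) (W y)) x := by
  let _ : RiemannianBundle (fun x : M ↦ TangentSpace (𝓡 n) x) := ⟨g.toRiemannianMetric⟩
  exact ContMDiffAt.inner_bundle (IB := 𝓡 n) (E := fun x : M ↦ TangentSpace (𝓡 n) x) (v := V)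
    (w := W) hV hW

/-- The metric in the preferred chart around `x₀`, as a bilinear form depending on the point of
coordinates `y`. -/
def metricCoord (x₀ : M) (y : EuclideanSpace ℝ (Fin n)) :
    EuclideanSpace ℝ (Fin n) →L[ℝ] EuclideanSpace ℝ (Fin n) →L[ℝ] ℝ :=
  (ContinuousLinearMap.precomp ℝ (ofCoord (𝓡 n) x₀ _)).comp
    ((g.inner ((extChartAt (𝓡 n) x₀).symm y)).comp (ofCoord (𝓡 n) x₀ _))

theorem coordMetric_metric (x₀ : M) (y u v : EuclideanSpace ℝ (Fin n)) :
    coordMetric (metric g) x₀ y u v = metricCoord g x₀ y u v := rfl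

theorem contDiffOn_metricCoord (x₀ : M) :
    ContDiffOn ℝ ∞ (metricCoord g x₀) (extChartAt (𝓡 n) x₀).target := by
  refine contDiffOn_clm_apply.2 fun u ↦ contDiffOn_clm_apply.2 fun v ↦ ?_
  have h1 : ContMDiffOn (𝓡 n) 𝓘(ℝ, ℝ) ∞
      (fun x ↦ g.inner x (ofCoord (𝓡 n) x₀ x u) (ofCoord (𝓡 n) x₀ x v))
      (chartAt (EuclideanSpace ℝ (Fin n)) x₀).source := by
    intro x hx
    have hn := (chartAt (EuclideanSpace ℝ (Fin n)) x₀).open_source.mem_nhds hx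
    exact (contMDiffAt_inner g ((contMDiffOn_ofCoord x₀ u).contMDiffAt hn)
      ((contMDiffOn_ofCoord x₀ v).contMDiffAt hn)).contMDiffWithinAt
  have h2 := h1.comp (contMDiffOn_extChartAt_symm x₀) (fun y hy ↦ by
    rw [mem_preimage, ← extChartAt_source (𝓡 n)]
    exact (extChartAt (𝓡 n) x₀).map_target hy)
  exact h2.contDiffOn

theorem differentiableAt_metricCoord {x₀ x : M}
    (hx : x ∈ (chartAt (EuclideanSpace ℝ (Fin n)) x₀).source) :
    DifferentiableAt ℝ (metricCoord g x₀) (extChartAt (𝓡 n) x₀ x) :=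
  ((contDiffOn_metricCoord g x₀).contDiffAt
    ((isOpen_extChartAt_target x₀).mem_nhds (extChartAt_mem_target x₀ hx))).differentiableAt
    (by simp)

theorem metric_eq_metricCoord {x₀ x : M}
    (hx : x ∈ (chartAt (EuclideanSpace ℝ (Fin n)) x₀).source) (u v : TangentSpace (𝓡 n) x) :
    g.inner x u v = metricCoord g x₀ (extChartAt (𝓡 n) x₀ x) (toCoord (𝓡 n) x₀ x u)
      (toCoord (𝓡 n) x₀ x v) := by
  have h : (extChartAt (𝓡 n) x₀).symm (extChartAt (𝓡 n) x₀ x) = x :=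
    (extChartAt (𝓡 n) x₀).left_inv (by rwa [extChartAt_source])
  rw [← coordMetric_metric, coordMetric, metric, h, ofCoord_toCoord hx, ofCoord_toCoord hx]

theorem metricCoord_symm (x₀ : M) (y u v : EuclideanSpace ℝ (Fin n)) :
    metricCoord g x₀ y u v = metricCoord g x₀ y v u := g.symm _ _ _

theorem metricCoord_pos {x₀ : M} {y : EuclideanSpace ℝ (Fin n)}
    (hy : y ∈ (extChartAt (𝓡 n) x₀).target) {u : EuclideanSpace ℝ (Fin n)} (hu : u ≠ 0) :
    0 < metricCoord g x₀ y u u := by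
  refine g.pos _ _ fun h ↦ hu ?_
  have hx : (extChartAt (𝓡 n) x₀).symm y ∈ (chartAt (EuclideanSpace ℝ (Fin n)) x₀).source := by
    rw [← extChartAt_source (𝓡 n)]
    exact (extChartAt (𝓡 n) x₀).map_target hy
  have h' : ofCoord (𝓡 n) x₀ _ u = 0 := h
  rw [← toCoord_ofCoord (I := 𝓡 n) hx u, h', map_zero]

/-- The representing vector comes from a choice, so it can be identified only through nondegeneracy,
here asked for in its weakest form, without any linearity. -/
theorem sharp_eq {V : Type*} [AddCommGroup V] {b : V → V → ℝ} {ℓ : V → ℝ} {z : V}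
    (hb : ∀ z z', (∀ w, b z w = b z' w) → z = z') (hz : ∀ w, b z w = ℓ w) : sharp b ℓ = z := by
  have h : ∃ z, ∀ w, b z w = ℓ w := ⟨z, hz⟩
  rw [sharp, dif_pos h]
  exact hb _ _ fun w ↦ (h.choose_spec w).trans (hz w).symm

/-- Definiteness makes v ↦ b v injective into the dual, and equality of dimensions makes it
surjective. -/
theorem apply_sharp {V : Type*} [NormedAddCommGroup V] [NormedSpace ℝ V] [FiniteDimensional ℝ V]
    (b : V →L[ℝ] V →L[ℝ] ℝ) (hb : ∀ v, v ≠ 0 → 0 < b v v) (ℓ : V →L[ℝ] ℝ) (w : V) :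
    b (sharp (fun u v ↦ b u v) ℓ) w = ℓ w := by
  have h : ∃ z, ∀ w, b z w = ℓ w := by
    let B : V →ₗ[ℝ] V →ₗ[ℝ] ℝ := LinearMap.mk₂ ℝ (fun u v ↦ b u v) (by simp) (by simp) (by simp)
      (by simp)
    have hinj : Function.Injective B := by
      rw [injective_iff_map_eq_zero]
      intro v hv
      by_contra hne
      exact (hb v hne).ne' (congrArg (fun L : V →ₗ[ℝ] ℝ ↦ L v) hv)
    have hsurj := (LinearMap.injective_iff_surjective_of_finrank_eq_finrank
      (Subspace.dual_finrank_eq (K := ℝ) (V := V)).symm).1 hinj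
    obtain ⟨z, hz⟩ := hsurj (ℓ : V →ₗ[ℝ] ℝ)
    exact ⟨z, fun w ↦ congrArg (fun L : V →ₗ[ℝ] ℝ ↦ L w) hz⟩
  rw [sharp, dif_pos h]
  exact h.choose_spec w

/-- The Koszul formula which defines the Christoffel symbols. -/
theorem metricCoord_christoffel {x₀ x : M}
    (hx : x ∈ (chartAt (EuclideanSpace ℝ (Fin n)) x₀).source) (u v w : EuclideanSpace ℝ (Fin n)) :
    metricCoord g x₀ (extChartAt (𝓡 n) x₀ x)
        (christoffel (metric g) x₀ (extChartAt (𝓡 n) x₀ x) u v) w =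
      (fderiv ℝ (metricCoord g x₀) (extChartAt (𝓡 n) x₀ x) u v w
        + fderiv ℝ (metricCoord g x₀) (extChartAt (𝓡 n) x₀ x) v u w
        - fderiv ℝ (metricCoord g x₀) (extChartAt (𝓡 n) x₀ x) w u v) / 2 := by
  set y := extChartAt (𝓡 n) x₀ x with hy
  have hd : DifferentiableAt ℝ (metricCoord g x₀) y := differentiableAt_metricCoord g hx
  have hf : ∀ u v w, fderiv ℝ (fun z ↦ coordMetric (metric g) x₀ z u v) y w =
      fderiv ℝ (metricCoord g x₀) y w u v := by
    intro u v w
    have h1 : HasFDerivAt (fun z ↦ metricCoord g x₀ z u v)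
        (((fderiv ℝ (metricCoord g x₀) y).flip u).flip v) y := by
      have h2 := (hd.hasFDerivAt.clm_apply (hasFDerivAt_const u y)).clm_apply
        (hasFDerivAt_const v y)
      refine h2.congr_fderiv ?_
      ext z
      simp
    exact congrArg (fun L ↦ L w) h1.fderiv
  -- The right-hand side of the Koszul formula as a continuous linear functional of w, so that a
  -- representing vector exists.
  let ℓ : EuclideanSpace ℝ (Fin n) →L[ℝ] ℝ := (1 / 2 : ℝ) •
    (fderiv ℝ (metricCoord g x₀) y u v + fderiv ℝ (metricCoord g x₀) y v u
      - ((fderiv ℝ (metricCoord g x₀) y).flip u).flip v)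
  have h := apply_sharp (metricCoord g x₀ y)
    (fun v hv ↦ metricCoord_pos g (extChartAt_mem_target x₀ hx) hv) ℓ w
  have hℓ : (fun w ↦ (fderiv ℝ (fun z ↦ coordMetric (metric g) x₀ z v w) y u
      + fderiv ℝ (fun z ↦ coordMetric (metric g) x₀ z u w) y v
      - fderiv ℝ (fun z ↦ coordMetric (metric g) x₀ z u v) y w) / 2) = ℓ := by
    funext w
    simp only [hf, ℓ, _root_.smul_apply, _root_.sub_apply,
      _root_.add_apply, ContinuousLinearMap.flip_apply, smul_eq_mul]
    ring
  have h3 : christoffel (metric g) x₀ y u v = sharp (fun u v ↦ metricCoord g x₀ y u v) ℓ := by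
    rw [← hℓ]; rfl
  rw [h3, h]
  simp only [ℓ, _root_.smul_apply, _root_.sub_apply,
      _root_.add_apply, ContinuousLinearMap.flip_apply, smul_eq_mul]
  ring

end Metric

/-! ### The covariant derivative -/

section CovDeriv

variable {E : Type*} [NormedAddCommGroup E] [NormedSpace ℝ E]
  {H : Type*} [TopologicalSpace H] {I : ModelWithCorners ℝ E H}
  {X : Type*} [TopologicalSpace X] [ChartedSpace H X]
  {E' : Type*} [NormedAddCommGroup E'] [NormedSpace ℝ E']
  {H' : Type*} [TopologicalSpace H'] {J : ModelWithCorners ℝ E' H'}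
  {S : Type*} [TopologicalSpace S] [ChartedSpace H' S]
  {h : ∀ x : X, TangentSpace I x → TangentSpace I x → ℝ}

theorem covDeriv_congr {F : S → X} {V W : ∀ x : S, TangentSpace I (F x)} {x : S}
    (hVW : ∀ᶠ y in 𝓝 x, V y = W y) (v : TangentSpace J x) :
    covDeriv J h F V x v = covDeriv J h F W x v := by
  have h1 : (fun y ↦ toCoord I (F x) (F y) (V y)) =ᶠ[𝓝 x]
      fun y ↦ toCoord I (F x) (F y) (W y) := by
    filter_upwards [hVW] with y hy
    rw [hy]
  have h2 : mvfderiv J (fun y ↦ toCoord I (F x) (F y) (V y)) x =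
      mvfderiv J (fun y ↦ toCoord I (F x) (F y) (W y)) x := h1.mfderiv_eq
  rw [covDeriv, covDeriv, h2, hVW.self_of_nhds]

/-- Both terms of the coordinate expression obey the chain rule. This moves between derivatives on
the hypersurface and derivatives along curves in it. -/
theorem covDeriv_comp {F : S → X} {V : ∀ x : S, TangentSpace I (F x)} {c : ℝ → S} {s : ℝ}
    (hc : MDifferentiableAt 𝓘(ℝ, ℝ) J c s) (hF : MDifferentiableAt J I F (c s))
    (hV : MDifferentiableAt J 𝓘(ℝ, E) (fun y ↦ toCoord I (F (c s)) (F y) (V y)) (c s))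
    (v : TangentSpace 𝓘(ℝ, ℝ) s) :
    covDeriv 𝓘(ℝ, ℝ) h (fun r ↦ F (c r)) (fun r ↦ V (c r)) s v =
      covDeriv J h F V (c s) (mfderiv 𝓘(ℝ, ℝ) J c s v) := by
  have h1 : mfderiv 𝓘(ℝ, ℝ) I (fun r ↦ F (c r)) s v =
      mfderiv J I F (c s) (mfderiv 𝓘(ℝ, ℝ) J c s v) := mfderiv_comp_apply s hF hc v
  have h2 : mvfderiv 𝓘(ℝ, ℝ) (fun r ↦ toCoord I (F (c s)) (F (c r)) (V (c r))) s v =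
      mvfderiv J (fun y ↦ toCoord I (F (c s)) (F y) (V y)) (c s) (mfderiv 𝓘(ℝ, ℝ) J c s v) :=
    mfderiv_comp_apply s hV hc v
  rw [covDeriv, covDeriv, h1, h2]

end CovDeriv

/-! ### Leibniz rule and compatibility of the connection with the metric. -/

section Metric

variable {n : ℕ} {M : Type*} [TopologicalSpace M] [ChartedSpace (EuclideanSpace ℝ (Fin n)) M]
  [IsManifold (𝓡 n) ∞ M]
  (g : ContMDiffRiemannianMetric (𝓡 n) ∞ (EuclideanSpace ℝ (Fin n))
      (fun x : M ↦ TangentSpace (𝓡 n) x))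
  {E' : Type*} [NormedAddCommGroup E'] [NormedSpace ℝ E']
  {H' : Type*} [TopologicalSpace H'] {J : ModelWithCorners ℝ E' H'}
  {S : Type*} [TopologicalSpace S] [ChartedSpace H' S]

/-- The derivative of `G (σ r) (U r) (V r)`, where the bilinear form `G` depends on a point. -/
theorem _root_.HasDerivAt.bilinearForm_apply {E : Type*} [NormedAddCommGroup E] [NormedSpace ℝ E]
    {G : E → E →L[ℝ] E →L[ℝ] ℝ} {σ U V : ℝ → E} {s : ℝ} {σ' U' V' : E}
    (hG : DifferentiableAt ℝ G (σ s)) (hσ : HasDerivAt σ σ' s)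
    (hU : HasDerivAt U U' s) (hV : HasDerivAt V V' s) :
    HasDerivAt (fun r ↦ G (σ r) (U r) (V r))
      (fderiv ℝ G (σ s) σ' (U s) (V s) + G (σ s) U' (V s) + G (σ s) (U s) V') s := by
  have h1 : HasDerivAt (fun r ↦ G (σ r)) (fderiv ℝ G (σ s) σ') s :=
    HasFDerivAt.comp_hasDerivAt (E := E →L[ℝ] E →L[ℝ] ℝ) s hG.hasFDerivAt hσ
  have h2 := (HasDerivAt.clm_apply (F := E) (G := E →L[ℝ] ℝ) h1 hU).clm_apply hV
  simpa using h2

theorem metricCoord_ext {x₀ : M} {y : EuclideanSpace ℝ (Fin n)}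
    (hy : y ∈ (extChartAt (𝓡 n) x₀).target) {u v : EuclideanSpace ℝ (Fin n)}
    (h : ∀ w, metricCoord g x₀ y u w = metricCoord g x₀ y v w) : u = v := by
  by_contra hne
  have h1 := metricCoord_pos g hy (sub_ne_zero.2 hne)
  have h2 : metricCoord g x₀ y (u - v) (u - v) = 0 := by
    rw [map_sub (metricCoord g x₀ y), sub_apply, h, sub_self]
  exact h1.ne' h2

theorem christoffel_smul {x₀ x : M} (hx : x ∈ (chartAt (EuclideanSpace ℝ (Fin n)) x₀).source)
    (c : ℝ) (u v : EuclideanSpace ℝ (Fin n)) :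
    christoffel (metric g) x₀ (extChartAt (𝓡 n) x₀ x) u (c • v) =
      c • christoffel (metric g) x₀ (extChartAt (𝓡 n) x₀ x) u v := by
  refine metricCoord_ext g (extChartAt_mem_target x₀ hx) fun w ↦ ?_
  have h2 : ∀ (B : EuclideanSpace ℝ (Fin n) →L[ℝ] EuclideanSpace ℝ (Fin n) →L[ℝ] ℝ) (u w),
      B (c • u) w = c * B u w := fun B u w ↦ by rw [B.map_smul, smul_apply, smul_eq_mul]
  have h3 : ∀ (L : EuclideanSpace ℝ (Fin n) →L[ℝ] EuclideanSpace ℝ (Fin n) →L[ℝ]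
      EuclideanSpace ℝ (Fin n) →L[ℝ] ℝ) (v u w), L (c • v) u w = c * L v u w := fun L v u w ↦ by
    rw [L.map_smul]; rfl
  rw [h2, metricCoord_christoffel g hx, metricCoord_christoffel g hx, h2, h3,
    ContinuousLinearMap.map_smul, smul_eq_mul]
  ring

theorem covDeriv_smul {F : S → M} {V : ∀ x : S, TangentSpace (𝓡 n) (F x)} {ρ : S → ℝ} {x : S}
    (hρ : MDifferentiableAt J 𝓘(ℝ, ℝ) ρ x)
    (hV : MDifferentiableAt J 𝓘(ℝ, EuclideanSpace ℝ (Fin n))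
      (fun y ↦ toCoord (𝓡 n) (F x) (F y) (V y)) x) (v : TangentSpace J x) :
    covDeriv J (metric g) F (fun y ↦ ρ y • V y) x v =
      mvfderiv J ρ x v • V x + ρ x • covDeriv J (metric g) F V x v := by
  have hs : F x ∈ (chartAt (EuclideanSpace ℝ (Fin n)) (F x)).source := mem_chart_source _ _
  have h1 : (fun y ↦ toCoord (𝓡 n) (F x) (F y) (ρ y • V y)) =
      ρ • fun y ↦ toCoord (𝓡 n) (F x) (F y) (V y) := by
    funext y; simp
  rw [covDeriv, covDeriv, h1, mvfderiv_smul hρ hV, map_smul, christoffel_smul g hs, add_apply,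
    smul_apply, ContinuousLinearMap.smulRight_apply, map_add, map_add, map_smul, map_smul, map_smul,
    ofCoord_toCoord hs, map_add, smul_add]
  abel

theorem toCoord_velocity {γ : ℝ → M} {r : ℝ} (hγ : MDifferentiableAt 𝓘(ℝ, ℝ) (𝓡 n) γ r) {x₀ : M}
    (hr : γ r ∈ (chartAt (EuclideanSpace ℝ (Fin n)) x₀).source) :
    toCoord (𝓡 n) x₀ (γ r) (mfderiv 𝓘(ℝ, ℝ) (𝓡 n) γ r (1 : ℝ)) =
      deriv (fun r ↦ extChartAt (𝓡 n) x₀ (γ r)) r :=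
  (toCoord_mfderiv hγ hr _).trans mvfderiv_real_one

theorem toCoord_covDeriv_curve {γ : ℝ → M} {V : ∀ r, TangentSpace (𝓡 n) (γ r)} {s : ℝ}
    (hγ : MDifferentiableAt 𝓘(ℝ, ℝ) (𝓡 n) γ s) :
    toCoord (𝓡 n) (γ s) (γ s) (covDeriv 𝓘(ℝ, ℝ) (metric g) γ V s (1 : ℝ)) =
      deriv (fun r ↦ toCoord (𝓡 n) (γ s) (γ r) (V r)) s +
        christoffel (metric g) (γ s) (extChartAt (𝓡 n) (γ s) (γ s))
          (deriv (fun r ↦ extChartAt (𝓡 n) (γ s) (γ r)) s)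
          (toCoord (𝓡 n) (γ s) (γ s) (V s)) := by
  have hs : γ s ∈ (chartAt (EuclideanSpace ℝ (Fin n)) (γ s)).source := mem_chart_source _ _
  refine (toCoord_ofCoord hs _).trans ?_
  exact congrArg₂ _ mvfderiv_real_one
    (congrArg₂ _ (toCoord_velocity (hγ := hγ) hs) rfl)

/-- Compatibility of the Levi-Civita connection with the metric, along a curve. -/
theorem hasDerivAt_inner_self {γ : ℝ → M} {V : ∀ r, TangentSpace (𝓡 n) (γ r)} {s : ℝ}
    (hγ : MDifferentiableAt 𝓘(ℝ, ℝ) (𝓡 n) γ s)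
    (hV : DifferentiableAt ℝ (fun r ↦ toCoord (𝓡 n) (γ s) (γ r) (V r)) s) :
    HasDerivAt (fun r ↦ g.inner (γ r) (V r) (V r))
      (2 * g.inner (γ s) (covDeriv 𝓘(ℝ, ℝ) (metric g) γ V s (1 : ℝ)) (V s)) s := by
  have hs : γ s ∈ (chartAt (EuclideanSpace ℝ (Fin n)) (γ s)).source := mem_chart_source _ _
  have hσ : DifferentiableAt ℝ (fun r ↦ extChartAt (𝓡 n) (γ s) (γ r)) s :=
    ((mdifferentiableAt_extChartAt hs).comp s hγ).differentiableAt
  have h1 := HasDerivAt.bilinearForm_apply (differentiableAt_metricCoord g hs) hσ.hasDerivAt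
    hV.hasDerivAt hV.hasDerivAt
  have h2 : (fun r ↦ g.inner (γ r) (V r) (V r)) =ᶠ[𝓝 s] fun r ↦
      metricCoord g (γ s) (extChartAt (𝓡 n) (γ s) (γ r))
        (toCoord (𝓡 n) (γ s) (γ r) (V r)) (toCoord (𝓡 n) (γ s) (γ r) (V r)) := by
    filter_upwards [hγ.continuousAt.preimage_mem_nhds
      ((chartAt (EuclideanSpace ℝ (Fin n)) (γ s)).open_source.mem_nhds hs)] with r hr
    exact metric_eq_metricCoord g hr _ _
  refine (h1.congr_of_eventuallyEq h2).congr_deriv ?_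
  -- In the Koszul formula for ⟨Γ(γ', V), V⟩ the last two terms cancel, leaving half the derivative
  -- of the metric along γ', evaluated on (V, V).
  rw [metric_eq_metricCoord g hs, toCoord_covDeriv_curve g hγ, map_add, add_apply,
    metricCoord_christoffel g hs]
  rw [metricCoord_symm g _ _ (toCoord (𝓡 n) (γ s) (γ s) (V s))]
  ring

end Metric

/-! ### The Gauss lemma -/

section Gauss

variable {n : ℕ} {M : Type*} [TopologicalSpace M] [ChartedSpace (EuclideanSpace ℝ (Fin n)) M]
  [IsManifold (𝓡 n) ∞ M]
  (g : ContMDiffRiemannianMetric (𝓡 n) ∞ (EuclideanSpace ℝ (Fin n))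
      (fun x : M ↦ TangentSpace (𝓡 n) x))

theorem differentiableAt_toCoord_velocity {γ : ℝ → M} {s : ℝ}
    (hγ : ContMDiffAt 𝓘(ℝ, ℝ) (𝓡 n) ∞ γ s) :
    (fun r ↦ toCoord (𝓡 n) (γ s) (γ r) (mfderiv 𝓘(ℝ, ℝ) (𝓡 n) γ r (1 : ℝ))) =ᶠ[𝓝 s]
        deriv (fun r ↦ extChartAt (𝓡 n) (γ s) (γ r)) ∧
      ContDiffAt ℝ ∞ (fun r ↦ extChartAt (𝓡 n) (γ s) (γ r)) s := by
  have hs : γ s ∈ (chartAt (EuclideanSpace ℝ (Fin n)) (γ s)).source := mem_chart_source _ _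
  refine ⟨?_, ((contMDiffAt_extChartAt' hs).comp s hγ).contDiffAt⟩
  have hev := (contMDiffAt_iff_contMDiffAt_nhds (n := 1) (by simp)).1
    (hγ.of_le (by simp))
  filter_upwards [hev, hγ.continuousAt.preimage_mem_nhds
    ((chartAt (EuclideanSpace ℝ (Fin n)) (γ s)).open_source.mem_nhds hs)] with r hr hmem
  exact toCoord_velocity (hr.mdifferentiableAt one_ne_zero) hmem

/-- A geodesic has constant speed. -/
theorem IsGeodesicOn.hasDerivAt_speed {γ : ℝ → M} {T : Set ℝ} (hT : IsOpen T)
    (hγ : IsGeodesicOn (metric g) γ T) {s : ℝ} (hs : s ∈ T) :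
    HasDerivAt (fun r ↦ g.inner (γ r) (mfderiv 𝓘(ℝ, ℝ) (𝓡 n) γ r (1 : ℝ))
      (mfderiv 𝓘(ℝ, ℝ) (𝓡 n) γ r (1 : ℝ))) 0 s := by
  have hat : ContMDiffAt 𝓘(ℝ, ℝ) (𝓡 n) ∞ γ s := hγ.1.contMDiffAt (hT.mem_nhds hs)
  obtain ⟨h1, h2⟩ := differentiableAt_toCoord_velocity hat
  have h3 : DifferentiableAt ℝ (deriv (fun r ↦ extChartAt (𝓡 n) (γ s) (γ r))) s :=
    (h2.derivWithin (m := 1) (by norm_cast)).differentiableAt (by simp)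
  have h := hasDerivAt_inner_self g (hat.mdifferentiableAt (by simp))
    (h3.congr_of_eventuallyEq h1)
  rw [hγ.2 s hs] at h
  simpa using h

end Gauss

/-- The Gauss lemma in coordinates: `b (τ, r)` is a one-parameter family of curves of unit speed,
and the curve of parameter `t` satisfies the geodesic equation at `s`. -/
theorem hasDerivAt_gauss_coord {E : Type*} [NormedAddCommGroup E] [NormedSpace ℝ E]
    {G : E → E →L[ℝ] E →L[ℝ] ℝ} {b : ℝ × ℝ → E} {t s : ℝ}
    (hG : DifferentiableAt ℝ G (b (t, s))) (hsymm : ∀ y u v, G y u v = G y v u)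
    (hb : ContDiffAt ℝ 2 b (t, s))
    (hgeo : ∀ w, G (b (t, s)) (deriv (fun r ↦ fderiv ℝ b (t, r) (0, 1)) s) w =
      fderiv ℝ G (b (t, s)) w (fderiv ℝ b (t, s) (0, 1)) (fderiv ℝ b (t, s) (0, 1)) / 2
        - fderiv ℝ G (b (t, s)) (fderiv ℝ b (t, s) (0, 1)) (fderiv ℝ b (t, s) (0, 1)) w)
    (hspeed : ∀ᶠ τ in 𝓝 t,
      G (b (τ, s)) (fderiv ℝ b (τ, s) (0, 1)) (fderiv ℝ b (τ, s) (0, 1)) = 1) :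
    HasDerivAt (fun r ↦ G (b (t, r)) (fderiv ℝ b (t, r) (0, 1)) (fderiv ℝ b (t, r) (1, 0)))
      0 s := by
  have hd : HasFDerivAt (fderiv ℝ b) (fderiv ℝ (fderiv ℝ b) (t, s)) (t, s) :=
    ((hb.fderiv_right (m := 1) (by norm_num)).differentiableAt (by simp)).hasFDerivAt
  have hb1 : HasFDerivAt b (fderiv ℝ b (t, s)) (t, s) :=
    (hb.differentiableAt (by simp)).hasFDerivAt
  have hsnd : HasDerivAt (fun r : ℝ ↦ (t, r)) ((0 : ℝ), (1 : ℝ)) s :=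
    (hasDerivAt_const s t).prodMk (hasDerivAt_id s)
  have hfst : HasDerivAt (fun τ : ℝ ↦ (τ, s)) ((1 : ℝ), (0 : ℝ)) t :=
    (hasDerivAt_id t).prodMk (hasDerivAt_const t s)
  -- Equality of mixed derivatives plays the role of the torsion-free identity ∇_s ∂_t b = ∇_t ∂_s
  -- b.
  have hsym2 : fderiv ℝ (fderiv ℝ b) (t, s) (1, 0) (0, 1) =
      fderiv ℝ (fderiv ℝ b) (t, s) (0, 1) (1, 0) :=
    (hb.isSymmSndFDerivAt (by simp)) _ _
  have hs : ∀ v, HasDerivAt (fun r ↦ fderiv ℝ b (t, r) v)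
      (fderiv ℝ (fderiv ℝ b) (t, s) (0, 1) v) s := by
    intro v
    have h1 : HasDerivAt (fun r ↦ fderiv ℝ b (t, r)) (fderiv ℝ (fderiv ℝ b) (t, s) (0, 1)) s :=
      HasFDerivAt.comp_hasDerivAt (E := ℝ × ℝ →L[ℝ] E) s hd hsnd
    simpa using h1.clm_apply (hasDerivAt_const s v)
  have ht : HasDerivAt (fun τ ↦ fderiv ℝ b (τ, s) (0, 1))
      (fderiv ℝ (fderiv ℝ b) (t, s) (1, 0) (0, 1)) t := by
    have h1 : HasDerivAt (fun τ ↦ fderiv ℝ b (τ, s)) (fderiv ℝ (fderiv ℝ b) (t, s) (1, 0)) t :=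
      HasFDerivAt.comp_hasDerivAt (E := ℝ × ℝ →L[ℝ] E) t hd hfst
    simpa using h1.clm_apply (hasDerivAt_const t ((0 : ℝ), (1 : ℝ)))
  have h1 := HasDerivAt.bilinearForm_apply hG (hb1.comp_hasDerivAt s hsnd) (hs (0, 1)) (hs (1, 0))
  have h2 := HasDerivAt.bilinearForm_apply hG (hb1.comp_hasDerivAt t hfst) ht ht
  -- Unit speed, differentiated in the transverse parameter, cancels the terms that the geodesic
  -- equation leaves in the derivative of ⟨∂_s b, ∂_t b⟩.
  have h3 := (h2.congr_of_eventuallyEq (f₁ := fun _ ↦ (1 : ℝ))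
    (hspeed.mono fun τ hτ ↦ hτ.symm)).unique (hasDerivAt_const t (1 : ℝ))
  refine h1.congr_deriv ?_
  have h4 := hgeo (fderiv ℝ b (t, s) (1, 0))
  rw [(hs (0, 1)).deriv] at h4
  rw [hsymm _ _ (fderiv ℝ b (t, s) (0, 1)), hsym2] at h3
  simp only [Function.comp_apply] at h3 ⊢
  linarith

section Gauss

variable {n : ℕ} {M : Type*} [TopologicalSpace M] [ChartedSpace (EuclideanSpace ℝ (Fin n)) M]
  [IsManifold (𝓡 n) ∞ M]
  (g : ContMDiffRiemannianMetric (𝓡 n) ∞ (EuclideanSpace ℝ (Fin n))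
      (fun x : M ↦ TangentSpace (𝓡 n) x))

/-- The Gauss lemma for a one-parameter family of curves of unit speed. -/
theorem hasDerivAt_gauss_family {b : ℝ × ℝ → M} {t s : ℝ}
    (hb : ContMDiffAt 𝓘(ℝ, ℝ × ℝ) (𝓡 n) ∞ b (t, s))
    (hgeo : covDeriv 𝓘(ℝ, ℝ) (metric g) (fun r ↦ b (t, r))
      (fun r ↦ mfderiv 𝓘(ℝ, ℝ) (𝓡 n) (fun r ↦ b (t, r)) r (1 : ℝ)) s (1 : ℝ) = 0)
    (hspeed : ∀ᶠ τ in 𝓝 t,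
      g.inner (b (τ, s)) (mfderiv 𝓘(ℝ, ℝ) (𝓡 n) (fun r ↦ b (τ, r)) s (1 : ℝ))
        (mfderiv 𝓘(ℝ, ℝ) (𝓡 n) (fun r ↦ b (τ, r)) s (1 : ℝ)) = 1) :
    HasDerivAt (fun r ↦ g.inner (b (t, r)) (mfderiv 𝓘(ℝ, ℝ) (𝓡 n) (fun r ↦ b (t, r)) r (1 : ℝ))
      (mfderiv 𝓘(ℝ, ℝ) (𝓡 n) (fun τ ↦ b (τ, r)) t (1 : ℝ))) 0 s := by
  set x₀ := b (t, s) with hx₀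
  have hs : b (t, s) ∈ (chartAt (EuclideanSpace ℝ (Fin n)) x₀).source := mem_chart_source _ _
  set β : ℝ × ℝ → EuclideanSpace ℝ (Fin n) := fun q ↦ extChartAt (𝓡 n) x₀ (b q) with hβ
  have hβs : ContDiffAt ℝ ∞ β (t, s) := ((contMDiffAt_extChartAt' hs).comp _ hb).contDiffAt
  have hev : ∀ᶠ q in 𝓝 (t, s), MDifferentiableAt 𝓘(ℝ, ℝ × ℝ) (𝓡 n) b q ∧
      DifferentiableAt ℝ β q ∧ b q ∈ (chartAt (EuclideanSpace ℝ (Fin n)) x₀).source := by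
    have h1 := (contMDiffAt_iff_contMDiffAt_nhds (n := 1) (by simp)).1 (hb.of_le (by simp))
    have h2 := (hβs.of_le (m := 1) (by simp)).eventually (by simp)
    filter_upwards [h1, h2, hb.continuousAt.preimage_mem_nhds
      ((chartAt (EuclideanSpace ℝ (Fin n)) x₀).open_source.mem_nhds hs)] with q h1 h2 h3
    exact ⟨h1.mdifferentiableAt one_ne_zero, h2.differentiableAt one_ne_zero, h3⟩
  have hpart : ∀ τ r, MDifferentiableAt 𝓘(ℝ, ℝ × ℝ) (𝓡 n) b (τ, r) → DifferentiableAt ℝ β (τ, r) →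
      b (τ, r) ∈ (chartAt (EuclideanSpace ℝ (Fin n)) x₀).source →
      MDifferentiableAt 𝓘(ℝ, ℝ) (𝓡 n) (fun r ↦ b (τ, r)) r ∧
      toCoord (𝓡 n) x₀ (b (τ, r)) (mfderiv 𝓘(ℝ, ℝ) (𝓡 n) (fun r ↦ b (τ, r)) r (1 : ℝ)) =
        fderiv ℝ β (τ, r) (0, 1) ∧
      toCoord (𝓡 n) x₀ (b (τ, r)) (mfderiv 𝓘(ℝ, ℝ) (𝓡 n) (fun τ ↦ b (τ, r)) τ (1 : ℝ)) =
        fderiv ℝ β (τ, r) (1, 0) := by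
    intro τ r h1 h2 h3
    have hsnd : HasDerivAt (fun r : ℝ ↦ (τ, r)) ((0 : ℝ), (1 : ℝ)) r :=
      (hasDerivAt_const r τ).prodMk (hasDerivAt_id r)
    have hfst : HasDerivAt (fun τ : ℝ ↦ (τ, r)) ((1 : ℝ), (0 : ℝ)) τ :=
      (hasDerivAt_id τ).prodMk (hasDerivAt_const τ r)
    have h4 : MDifferentiableAt 𝓘(ℝ, ℝ) (𝓡 n) (fun r ↦ b (τ, r)) r :=
      h1.comp (f := fun r ↦ (τ, r)) r hsnd.differentiableAt.mdifferentiableAt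
    have h5 : MDifferentiableAt 𝓘(ℝ, ℝ) (𝓡 n) (fun τ ↦ b (τ, r)) τ :=
      h1.comp (f := fun τ ↦ (τ, r)) τ hfst.differentiableAt.mdifferentiableAt
    have h6 : HasDerivAt (fun r ↦ β (τ, r)) (fderiv ℝ β (τ, r) (0, 1)) r :=
      h2.hasFDerivAt.comp_hasDerivAt r hsnd
    have h7 : HasDerivAt (fun τ ↦ β (τ, r)) (fderiv ℝ β (τ, r) (1, 0)) τ :=
      HasFDerivAt.comp_hasDerivAt (f := fun τ ↦ (τ, r)) τ h2.hasFDerivAt hfst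
    exact ⟨h4, (toCoord_velocity h4 h3).trans h6.deriv,
      (toCoord_velocity (γ := fun τ ↦ b (τ, r)) h5 h3).trans h7.deriv⟩
  have hevs : ∀ᶠ r in 𝓝 s, MDifferentiableAt 𝓘(ℝ, ℝ × ℝ) (𝓡 n) b (t, r) ∧
      DifferentiableAt ℝ β (t, r) ∧ b (t, r) ∈ (chartAt (EuclideanSpace ℝ (Fin n)) x₀).source :=
    (Continuous.prodMk_right t).continuousAt.eventually hev
  have hevt : ∀ᶠ τ in 𝓝 t, MDifferentiableAt 𝓘(ℝ, ℝ × ℝ) (𝓡 n) b (τ, s) ∧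
      DifferentiableAt ℝ β (τ, s) ∧ b (τ, s) ∈ (chartAt (EuclideanSpace ℝ (Fin n)) x₀).source :=
    (Continuous.prodMk_left s).continuousAt.eventually hev
  obtain ⟨h1, h2, h3⟩ := hevs.self_of_nhds
  obtain ⟨h4, h5, h6⟩ := hpart t s h1 h2 h3
  have key := hasDerivAt_gauss_coord (G := metricCoord g x₀) (b := β) (t := t) (s := s)
    (differentiableAt_metricCoord g hs) (metricCoord_symm g x₀) (hβs.of_le (by norm_cast)) ?_ ?_
  · refine key.congr_of_eventuallyEq ?_
    filter_upwards [hevs] with r hr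
    obtain ⟨-, h8, h9⟩ := hpart t r hr.1 hr.2.1 hr.2.2
    rw [← h8, ← h9]
    exact metric_eq_metricCoord g hr.2.2 _ _
  · intro w
    have h7 := (toCoord_covDeriv_curve g (γ := fun r ↦ b (t, r))
      (V := fun r ↦ mfderiv 𝓘(ℝ, ℝ) (𝓡 n) (fun r ↦ b (t, r)) r (1 : ℝ)) h4).symm.trans
      ((congrArg _ hgeo).trans (map_zero _))
    have h8 : (fun r ↦ toCoord (𝓡 n) x₀ (b (t, r))
        (mfderiv 𝓘(ℝ, ℝ) (𝓡 n) (fun r ↦ b (t, r)) r (1 : ℝ))) =ᶠ[𝓝 s]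
        fun r ↦ fderiv ℝ β (t, r) (0, 1) := by
      filter_upwards [hevs] with r hr using (hpart t r hr.1 hr.2.1 hr.2.2).2.1
    have h9 : deriv (fun r ↦ extChartAt (𝓡 n) x₀ (b (t, r))) s = fderiv ℝ β (t, s) (0, 1) :=
      (toCoord_velocity (γ := fun r ↦ b (t, r)) h4 h3).symm.trans h5
    have h10 : deriv (fun r ↦ fderiv ℝ β (t, r) (0, 1)) s +
        christoffel (metric g) x₀ (β (t, s)) (fderiv ℝ β (t, s) (0, 1))
          (fderiv ℝ β (t, s) (0, 1)) = 0 := by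
      rw [← h8.deriv_eq]
      nth_rewrite 1 [← h9]
      rw [← h5]
      exact h7
    -- With equal arguments the first two Koszul terms coincide, which gives the geodesic equation
    -- in the form without Christoffel symbols.
    rw [eq_neg_of_add_eq_zero_left h10, map_neg, neg_apply, metricCoord_christoffel g hs]
    ring
  · filter_upwards [hevt, hspeed] with τ hτ hsp
    obtain ⟨-, h8, -⟩ := hpart τ s hτ.1 hτ.2.1 hτ.2.2
    rw [← h8]
    exact (metric_eq_metricCoord g hτ.2.2 _ _).symm.trans hsp

variable {k : ℕ} {P : Type*} [TopologicalSpace P] [ChartedSpace (EuclideanSpace ℝ (Fin k)) P]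
  [IsManifold (𝓡 k) ∞ P]

/-- Every tangent vector is the velocity of a smooth curve. -/
theorem exists_curve_velocity (p : P) (v : TangentSpace (𝓡 k) p) :
    ∃ c : ℝ → P, ContMDiffAt 𝓘(ℝ, ℝ) (𝓡 k) ∞ c 0 ∧
      (⟨c 0, mfderiv 𝓘(ℝ, ℝ) (𝓡 k) c 0 (1 : ℝ)⟩ : TangentBundle (𝓡 k) P) = ⟨p, v⟩ := by
  let w : EuclideanSpace ℝ (Fin k) := v
  let a : ℝ → EuclideanSpace ℝ (Fin k) := fun t ↦ extChartAt (𝓡 k) p p + t • w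
  have ha0 : a 0 = extChartAt (𝓡 k) p p := by simp [a]
  have ha : HasDerivAt a w 0 := by
    have h := ((hasDerivAt_id (0 : ℝ)).smul_const w).const_add (extChartAt (𝓡 k) p p)
    rwa [one_smul] at h
  have hsmooth : ContMDiffAt 𝓘(ℝ, EuclideanSpace ℝ (Fin k)) (𝓡 k) ∞ (extChartAt (𝓡 k) p).symm
      (extChartAt (𝓡 k) p p) :=
    (contMDiffOn_extChartAt_symm p).contMDiffAt (extChartAt_target_mem_nhds p)
  have hmf : mfderiv 𝓘(ℝ, EuclideanSpace ℝ (Fin k)) (𝓡 k) (extChartAt (𝓡 k) p).symm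
      (extChartAt (𝓡 k) p p) = ContinuousLinearMap.id ℝ (EuclideanSpace ℝ (Fin k)) := by
    have h := mfderivWithin_range_extChartAt_symm (I := 𝓡 k) (x := p)
    rwa [ModelWithCorners.range_eq_univ, mfderivWithin_univ] at h
  have hac : ContDiff ℝ ∞ a := contDiff_const.add (contDiff_id.smul contDiff_const)
  refine ⟨fun t ↦ (extChartAt (𝓡 k) p).symm (a t), ?_, ?_⟩
  · exact ContMDiffAt.comp_of_eq (g := (extChartAt (𝓡 k) p).symm) (f := a) hsmooth
      hac.contMDiff.contMDiffAt ha0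
  · have h0 : (extChartAt (𝓡 k) p).symm (a 0) = p := by rw [ha0, extChartAt_to_inv]
    have h1 := mfderiv_comp_apply_of_eq (I := 𝓘(ℝ, ℝ)) (I' := 𝓘(ℝ, EuclideanSpace ℝ (Fin k)))
      (I'' := 𝓡 k) (g := (extChartAt (𝓡 k) p).symm) (f := a) (x := 0)
      (hsmooth.mdifferentiableAt (by simp)) ha.differentiableAt.mdifferentiableAt ha0 (1 : ℝ)
    have h2 : (mfderiv 𝓘(ℝ, ℝ) 𝓘(ℝ, EuclideanSpace ℝ (Fin k)) a 0 (1 : ℝ) :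
        EuclideanSpace ℝ (Fin k)) = w := mvfderiv_real_one.trans ha.deriv
    refine Bundle.TotalSpace.ext h0 (heq_of_eq (?_ :
      (mfderiv 𝓘(ℝ, ℝ) (𝓡 k) (fun t ↦ (extChartAt (𝓡 k) p).symm (a t)) 0 (1 : ℝ) :
        EuclideanSpace ℝ (Fin k)) = w))
    refine h1.trans ?_
    rw [ha0, hmf]
    exact h2

/-- The Gauss lemma: along a smooth family of geodesics of unit speed `s ↦ f s p`, the inner product
of the velocity with the differential of `f s` does not depend on `s`. -/
theorem hasDerivAt_gauss {f : ℝ → P → M} {T : Set ℝ} (hT : IsOpen T)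
    (hf : ContMDiffOn ((𝓡 k).prod 𝓘(ℝ, ℝ)) (𝓡 n) ∞ (fun q : P × ℝ ↦ f q.2 q.1) (univ ×ˢ T))
    (hgeo : ∀ p, IsGeodesicOn (metric g) (fun s ↦ f s p) T)
    (hspeed : ∀ p, ∀ s ∈ T, g.inner (f s p) (mfderiv 𝓘(ℝ, ℝ) (𝓡 n) (fun s ↦ f s p) s (1 : ℝ))
      (mfderiv 𝓘(ℝ, ℝ) (𝓡 n) (fun s ↦ f s p) s (1 : ℝ)) = 1)
    (p : P) (v : TangentSpace (𝓡 k) p) {s : ℝ} (hs : s ∈ T) :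
    HasDerivAt (fun s ↦ g.inner (f s p) (mfderiv 𝓘(ℝ, ℝ) (𝓡 n) (fun s ↦ f s p) s (1 : ℝ))
      (mfderiv (𝓡 k) (𝓡 n) (f s) p v)) 0 s := by
  obtain ⟨c, hc, hcv⟩ := exists_curve_velocity p v
  suffices h : HasDerivAt (fun s ↦ g.inner (f s (c 0))
      (mfderiv 𝓘(ℝ, ℝ) (𝓡 n) (fun s ↦ f s (c 0)) s (1 : ℝ))
      (mfderiv (𝓡 k) (𝓡 n) (f s) (c 0) (mfderiv 𝓘(ℝ, ℝ) (𝓡 k) c 0 (1 : ℝ)))) 0 s by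
    -- The claim as a predicate on the tangent bundle, so that the equality of bundle points
    -- transports it from (c 0, c'(0)) to (p, v).
    let Q : TangentBundle (𝓡 k) P → Prop := fun q ↦ HasDerivAt (fun s ↦ g.inner (f s q.1)
      (mfderiv 𝓘(ℝ, ℝ) (𝓡 n) (fun s ↦ f s q.1) s (1 : ℝ)) (mfderiv (𝓡 k) (𝓡 n) (f s) q.1 q.2)) 0 s
    have h1 : Q ⟨c 0, mfderiv 𝓘(ℝ, ℝ) (𝓡 k) c 0 (1 : ℝ)⟩ := h
    rw [hcv] at h1
    exact h1
  have hopen : IsOpen (univ ×ˢ T : Set (P × ℝ)) := isOpen_univ.prod hT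
  have hfat : ∀ p, ∀ r ∈ T, ContMDiffAt ((𝓡 k).prod 𝓘(ℝ, ℝ)) (𝓡 n) ∞
      (fun q : P × ℝ ↦ f q.2 q.1) (p, r) :=
    fun p r hr ↦ hf.contMDiffAt (hopen.mem_nhds ⟨mem_univ _, hr⟩)
  have hc' : ContMDiffAt 𝓘(ℝ, ℝ × ℝ) ((𝓡 k).prod 𝓘(ℝ, ℝ)) ∞ (fun q : ℝ × ℝ ↦ (c q.1, q.2))
      (0, s) :=
    (ContMDiffAt.comp (x := ((0 : ℝ), s)) (g := c) (f := Prod.fst) hc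
      contDiff_fst.contMDiff.contMDiffAt).prodMk contDiff_snd.contMDiff.contMDiffAt
  have key := hasDerivAt_gauss_family g (b := fun q : ℝ × ℝ ↦ f q.2 (c q.1)) (t := 0) (s := s)
    (ContMDiffAt.comp (x := ((0 : ℝ), s)) (g := fun q : P × ℝ ↦ f q.2 q.1)
      (f := fun q : ℝ × ℝ ↦ (c q.1, q.2)) (hfat (c 0) s hs) hc')
    ((hgeo (c 0)).2 s hs) (Filter.Eventually.of_forall fun τ ↦ hspeed (c τ) s hs)
  refine key.congr_of_eventuallyEq ?_
  filter_upwards [hT.mem_nhds hs] with r hr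
  have hfr : MDifferentiableAt (𝓡 k) (𝓡 n) (f r) (c 0) :=
    (ContMDiffAt.comp (x := c 0) (g := fun q : P × ℝ ↦ f q.2 q.1) (f := fun p ↦ (p, r))
      (hfat (c 0) r hr) (contMDiffAt_id.prodMk contMDiffAt_const)).mdifferentiableAt (by simp)
  have h1 := mfderiv_comp_apply (0 : ℝ) hfr (hc.mdifferentiableAt (by simp)) (1 : ℝ)
  exact congrArg _ h1.symm

end Gauss

/-! ### Smoothness of vector fields along a map, in coordinates. -/

section Smooth

variable {E : Type*} [NormedAddCommGroup E] [NormedSpace ℝ E]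
  {H : Type*} [TopologicalSpace H] {I : ModelWithCorners ℝ E H}
  {X : Type*} [TopologicalSpace X] [ChartedSpace H X] [IsManifold I ∞ X]
  {E' : Type*} [NormedAddCommGroup E'] [NormedSpace ℝ E']
  {H' : Type*} [TopologicalSpace H'] {J : ModelWithCorners ℝ E' H'}
  {S : Type*} [TopologicalSpace S] [ChartedSpace H' S]

theorem contMDiffAt_base {F : S → X} {V : ∀ x : S, TangentSpace I (F x)} {x : S}
    (hV : ContMDiffAt J I.tangent ∞ (fun y ↦ (⟨F y, V y⟩ : TangentBundle I X)) x) :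
    ContMDiffAt J I ∞ F x :=
  (Bundle.contMDiff_proj (TangentSpace I : X → Type _)).contMDiffAt.comp x hV

theorem contMDiffAt_toCoord {F : S → X} {V : ∀ x : S, TangentSpace I (F x)} {x : S}
    (hV : ContMDiffAt J I.tangent ∞ (fun y ↦ (⟨F y, V y⟩ : TangentBundle I X)) x)
    {x₀ : X} (hx : F x ∈ (chartAt H x₀).source) :
    ContMDiffAt J 𝓘(ℝ, E) ∞ (fun y ↦ toCoord I x₀ (F y) (V y)) x := by
  set e := trivializationAt E (TangentSpace I : X → Type _) x₀ with he
  have hb : e.baseSet = (chartAt H x₀).source := TangentBundle.trivializationAt_baseSet x₀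
  have hmem : (⟨F x, V x⟩ : TangentBundle I X) ∈ e.source := by
    rw [e.mem_source, hb]; exact hx
  have h1 : ContMDiffAt I.tangent (I.prod 𝓘(ℝ, E)) ∞ e (⟨F x, V x⟩ : TangentBundle I X) :=
    (e.contMDiffOn (IB := I) (n := ∞)).contMDiffAt (e.open_source.mem_nhds hmem)
  have h2 : ContMDiffAt J 𝓘(ℝ, E) ∞ (fun y ↦ (e ⟨F y, V y⟩).2) x :=
    contMDiffAt_snd.comp x (h1.comp x hV)
  refine h2.congr_of_eventuallyEq ?_
  filter_upwards [(contMDiffAt_base hV).continuousAt.preimage_mem_nhds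
    ((chartAt H x₀).open_source.mem_nhds hx)] with y hy
  rw [he, trivializationAt_eq_toCoord hy]

end Smooth

/-! ### The product `M × ℝ` -/

section Product

variable {n : ℕ} {M : Type*} [TopologicalSpace M] [ChartedSpace (EuclideanSpace ℝ (Fin n)) M]

/-- The component along `M` of a tangent vector of `M × ℝ`. -/
def fstT (q : M × ℝ) : TangentSpace ((𝓡 n).prod 𝓘(ℝ, ℝ)) q →L[ℝ] TangentSpace (𝓡 n) q.1 :=
  mfderiv ((𝓡 n).prod 𝓘(ℝ, ℝ)) (𝓡 n) Prod.fst q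

/-- The vertical component of a tangent vector of `M × ℝ`. -/
def sndT (q : M × ℝ) : TangentSpace ((𝓡 n).prod 𝓘(ℝ, ℝ)) q →L[ℝ] ℝ :=
  mvfderiv ((𝓡 n).prod 𝓘(ℝ, ℝ)) (Prod.snd : M × ℝ → ℝ) q

/-- The tangent vector of `M × ℝ` with given components. -/
def pairT (q : M × ℝ) (u : TangentSpace (𝓡 n) q.1) (r : ℝ) :
    TangentSpace ((𝓡 n).prod 𝓘(ℝ, ℝ)) q :=
  ((u : EuclideanSpace ℝ (Fin n)), r)

@[simp] theorem fstT_pairT (q : M × ℝ) (u : TangentSpace (𝓡 n) q.1) (r : ℝ) :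
    fstT q (pairT q u r) = u := by
  rw [fstT, mfderiv_fst]; rfl

@[simp] theorem sndT_pairT (q : M × ℝ) (u : TangentSpace (𝓡 n) q.1) (r : ℝ) :
    sndT q (pairT q u r) = r := by
  rw [sndT, mvfderiv, mfderiv_snd]; rfl

theorem tangent_prod_ext {q : M × ℝ} {u v : TangentSpace ((𝓡 n).prod 𝓘(ℝ, ℝ)) q}
    (h1 : fstT q u = fstT q v) (h2 : sndT q u = sndT q v) : u = v := by
  rw [fstT, mfderiv_fst] at h1
  rw [sndT, mvfderiv, mfderiv_snd] at h2
  exact Prod.ext h1 h2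

variable {E' : Type*} [NormedAddCommGroup E'] [NormedSpace ℝ E']
  {H' : Type*} [TopologicalSpace H'] {J : ModelWithCorners ℝ E' H'}
  {S : Type*} [TopologicalSpace S] [ChartedSpace H' S]

theorem fstT_mfderiv {F : S → M × ℝ} {x : S}
    (hF : MDifferentiableAt J ((𝓡 n).prod 𝓘(ℝ, ℝ)) F x) (v : TangentSpace J x) :
    fstT (F x) (mfderiv J ((𝓡 n).prod 𝓘(ℝ, ℝ)) F x v) =
      mfderiv J (𝓡 n) (fun y ↦ (F y).1) x v :=
  (mfderiv_comp_apply x (mdifferentiableAt_fst) hF v).symm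

theorem sndT_mfderiv {F : S → M × ℝ} {x : S}
    (hF : MDifferentiableAt J ((𝓡 n).prod 𝓘(ℝ, ℝ)) F x) (v : TangentSpace J x) :
    sndT (F x) (mfderiv J ((𝓡 n).prod 𝓘(ℝ, ℝ)) F x v) = mvfderiv J (fun y ↦ (F y).2) x v :=
  (mfderiv_comp_apply x (mdifferentiableAt_snd) hF v).symm

theorem mvfderiv_fst_prod {G₁ G₂ : Type*} [NormedAddCommGroup G₁] [NormedSpace ℝ G₁]
    [NormedAddCommGroup G₂] [NormedSpace ℝ G₂] {A : S → G₁ × G₂} {x : S}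
    (hA : MDifferentiableAt J 𝓘(ℝ, G₁ × G₂) A x) (v : TangentSpace J x) :
    (mvfderiv J A x v).1 = mvfderiv J (fun y ↦ (A y).1) x v := by
  have h1 : mfderiv 𝓘(ℝ, G₁ × G₂) 𝓘(ℝ, G₁) Prod.fst (A x) = ContinuousLinearMap.fst ℝ G₁ G₂ :=
    mfderiv_eq_fderiv.trans fderiv_fst
  have h2 := mfderiv_comp_apply x (g := (Prod.fst : G₁ × G₂ → G₁)) (I' := 𝓘(ℝ, G₁ × G₂))
    (I'' := 𝓘(ℝ, G₁)) differentiableAt_fst.mdifferentiableAt hA v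
  rw [h1] at h2
  exact h2.symm

theorem mvfderiv_snd_prod {G₁ G₂ : Type*} [NormedAddCommGroup G₁] [NormedSpace ℝ G₁]
    [NormedAddCommGroup G₂] [NormedSpace ℝ G₂] {A : S → G₁ × G₂} {x : S}
    (hA : MDifferentiableAt J 𝓘(ℝ, G₁ × G₂) A x) (v : TangentSpace J x) :
    (mvfderiv J A x v).2 = mvfderiv J (fun y ↦ (A y).2) x v := by
  have h1 : mfderiv 𝓘(ℝ, G₁ × G₂) 𝓘(ℝ, G₂) Prod.snd (A x) = ContinuousLinearMap.snd ℝ G₁ G₂ :=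
    mfderiv_eq_fderiv.trans fderiv_snd
  have h2 := mfderiv_comp_apply x (g := (Prod.snd : G₁ × G₂ → G₂)) (I' := 𝓘(ℝ, G₁ × G₂))
    (I'' := 𝓘(ℝ, G₂)) differentiableAt_snd.mdifferentiableAt hA v
  rw [h1] at h2
  exact h2.symm

theorem prod_mem_chart_source {q₀ q : M × ℝ}
    (hq : q.1 ∈ (chartAt (EuclideanSpace ℝ (Fin n)) q₀.1).source) :
    q ∈ (chartAt (ModelProd (EuclideanSpace ℝ (Fin n)) ℝ) q₀).source := by
  rw [prodChartedSpace_chartAt, chartAt_self_eq]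
  exact ⟨hq, mem_univ _⟩

theorem extChartAt_prod_real (q₀ q : M × ℝ) :
    extChartAt ((𝓡 n).prod 𝓘(ℝ, ℝ)) q₀ q = (extChartAt (𝓡 n) q₀.1 q.1, q.2) := by
  rw [extChartAt_prod, extChartAt_model_space_eq_id]; rfl

variable [IsManifold (𝓡 n) ∞ M]

/-- The chart of the product is the chart of M times the identity of ℝ. All the splittings below
rest on this. -/
theorem toCoord_prod {q₀ q : M × ℝ} (hq : q.1 ∈ (chartAt (EuclideanSpace ℝ (Fin n)) q₀.1).source)
    (u : TangentSpace ((𝓡 n).prod 𝓘(ℝ, ℝ)) q) :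
    toCoord ((𝓡 n).prod 𝓘(ℝ, ℝ)) q₀ q u = (toCoord (𝓡 n) q₀.1 q.1 (fstT q u), sndT q u) := by
  have hd : MDifferentiableAt ((𝓡 n).prod 𝓘(ℝ, ℝ)) 𝓘(ℝ, EuclideanSpace ℝ (Fin n) × ℝ)
      (extChartAt ((𝓡 n).prod 𝓘(ℝ, ℝ)) q₀) q :=
    mdifferentiableAt_extChartAt (prod_mem_chart_source hq)
  refine Prod.ext ((mvfderiv_fst_prod hd u).trans ?_) ((mvfderiv_snd_prod hd u).trans ?_)
  · have h1 : (fun y : M × ℝ ↦ (extChartAt ((𝓡 n).prod 𝓘(ℝ, ℝ)) q₀ y).1) =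
        extChartAt (𝓡 n) q₀.1 ∘ Prod.fst := by
      funext y; rw [extChartAt_prod_real]; rfl
    rw [h1]
    exact mfderiv_comp_apply q (mdifferentiableAt_extChartAt hq) mdifferentiableAt_fst u
  · have h1 : (fun y : M × ℝ ↦ (extChartAt ((𝓡 n).prod 𝓘(ℝ, ℝ)) q₀ y).2) = Prod.snd := by
      funext y; rw [extChartAt_prod_real]
    rw [h1]
    rfl

theorem fstT_ofCoord {q₀ q : M × ℝ} (hq : q.1 ∈ (chartAt (EuclideanSpace ℝ (Fin n)) q₀.1).source)
    (w : EuclideanSpace ℝ (Fin n) × ℝ) :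
    fstT q (ofCoord ((𝓡 n).prod 𝓘(ℝ, ℝ)) q₀ q w) = ofCoord (𝓡 n) q₀.1 q.1 w.1 := by
  have h := (toCoord_prod hq _).symm.trans (toCoord_ofCoord (prod_mem_chart_source hq) w)
  exact (ofCoord_toCoord hq _).symm.trans (congrArg _ (congrArg Prod.fst h))

theorem sndT_ofCoord {q₀ q : M × ℝ} (hq : q.1 ∈ (chartAt (EuclideanSpace ℝ (Fin n)) q₀.1).source)
    (w : EuclideanSpace ℝ (Fin n) × ℝ) :
    sndT q (ofCoord ((𝓡 n).prod 𝓘(ℝ, ℝ)) q₀ q w) = w.2 := by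
  have h := (toCoord_prod hq _).symm.trans (toCoord_ofCoord (prod_mem_chart_source hq) w)
  exact congrArg Prod.snd h

variable (g : ContMDiffRiemannianMetric (𝓡 n) ∞ (EuclideanSpace ℝ (Fin n))
      (fun x : M ↦ TangentSpace (𝓡 n) x))

theorem prodMetric_eq (q : M × ℝ) (u v : TangentSpace ((𝓡 n).prod 𝓘(ℝ, ℝ)) q) :
    prodMetric g q u v = g.inner q.1 (fstT q u) (fstT q v) + sndT q u * sndT q v := rfl

/-- Definiteness applied to u − v. Testing against this single vector suffices, so that the argument
also applies to the induced metric, where only tangent vectors can be tested. -/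
theorem eq_of_prodMetric_sub {q : M × ℝ} {u v : TangentSpace ((𝓡 n).prod 𝓘(ℝ, ℝ)) q}
    (h1 : prodMetric g q u (u - v) = prodMetric g q v (u - v)) : u = v := by
  have h2 : prodMetric g q (u - v) (u - v) = 0 := by
    rw [prodMetric_eq, prodMetric_eq] at h1
    rw [prodMetric_eq]
    have h3 := congrArg (fun L ↦ L (fstT q (u - v)))
      ((g.inner q.1).map_sub (fstT q u) (fstT q v))
    rw [map_sub (fstT q) u v, map_sub (sndT q) u v] at *
    simp only [sub_apply] at h3
    rw [h3]
    linarith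
  rw [prodMetric_eq] at h2
  have h4 : 0 ≤ g.inner q.1 (fstT q (u - v)) (fstT q (u - v)) := by
    by_cases h : fstT q (u - v) = 0
    · rw [h]; simp
    · exact (g.pos _ _ h).le
  have h5 : sndT q (u - v) = 0 := by nlinarith [mul_self_nonneg (sndT q (u - v))]
  have h6 : fstT q (u - v) = 0 := by
    by_contra h
    have := g.pos _ _ h
    rw [h5] at h2
    linarith
  rw [map_sub, sub_eq_zero] at h5 h6
  exact tangent_prod_ext h6 h5

/-- Consequently the angle is the vertical component of N, the form in which it is handled from here
on. -/
theorem dt_eq (q : M × ℝ) : dt g q = pairT q 0 1 := by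
  refine sharp_eq (fun u v h ↦ eq_of_prodMetric_sub g (h _)) fun w ↦ ?_
  rw [prodMetric_eq, fstT_pairT, sndT_pairT, map_zero]
  simp [sndT]

theorem angle_eq {S : Type*} (F : S → M × ℝ)
    (N : ∀ x : S, TangentSpace ((𝓡 n).prod 𝓘(ℝ, ℝ)) (F x)) (x : S) :
    angle g F N x = sndT (F x) (N x) := by
  rw [angle, dt_eq, prodMetric_eq, fstT_pairT, sndT_pairT, map_zero]
  simp

theorem coordMetric_prod {q₀ : M × ℝ} {y : EuclideanSpace ℝ (Fin n) × ℝ}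
    (hy : y.1 ∈ (extChartAt (𝓡 n) q₀.1).target) (u v : EuclideanSpace ℝ (Fin n) × ℝ) :
    coordMetric (prodMetric g) q₀ y u v = metricCoord g q₀.1 y.1 u.1 v.1 + u.2 * v.2 := by
  have hsymm : (extChartAt ((𝓡 n).prod 𝓘(ℝ, ℝ)) q₀).symm y =
      ((extChartAt (𝓡 n) q₀.1).symm y.1, y.2) := by
    rw [extChartAt_prod, extChartAt_model_space_eq_id]; rfl
  have hq : ((extChartAt ((𝓡 n).prod 𝓘(ℝ, ℝ)) q₀).symm y).1 ∈
      (chartAt (EuclideanSpace ℝ (Fin n)) q₀.1).source := by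
    rw [hsymm, ← extChartAt_source (𝓡 n)]
    exact (extChartAt (𝓡 n) q₀.1).map_target hy
  rw [coordMetric, prodMetric_eq, fstT_ofCoord hq, fstT_ofCoord hq, sndT_ofCoord hq,
    sndT_ofCoord hq, hsymm]
  rfl

/-- In product charts the metric is the metric of M plus a constant form on ℝ, so only derivatives
of the first along M enter the Koszul formula. -/
theorem christoffel_prod (q₀ : M × ℝ) (u v : EuclideanSpace ℝ (Fin n) × ℝ) :
    christoffel (prodMetric g) q₀ (extChartAt ((𝓡 n).prod 𝓘(ℝ, ℝ)) q₀ q₀) u v =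
      (christoffel (metric g) q₀.1 (extChartAt (𝓡 n) q₀.1 q₀.1) u.1 v.1, 0) := by
  have hs : q₀.1 ∈ (chartAt (EuclideanSpace ℝ (Fin n)) q₀.1).source := mem_chart_source _ _
  have ht := extChartAt_mem_target (I := 𝓡 n) q₀.1 hs
  rw [extChartAt_prod_real]
  set y : EuclideanSpace ℝ (Fin n) × ℝ := (extChartAt (𝓡 n) q₀.1 q₀.1, q₀.2) with hy
  have hyt : y.1 ∈ (extChartAt (𝓡 n) q₀.1).target := ht
  have hd : ∀ a b c : EuclideanSpace ℝ (Fin n) × ℝ,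
      fderiv ℝ (fun z ↦ coordMetric (prodMetric g) q₀ z a b) y c =
        fderiv ℝ (metricCoord g q₀.1) y.1 c.1 a.1 b.1 := by
    intro a b c
    have h1 : (fun z ↦ coordMetric (prodMetric g) q₀ z a b) =ᶠ[𝓝 y]
        fun z ↦ metricCoord g q₀.1 z.1 a.1 b.1 + a.2 * b.2 := by
      filter_upwards [continuous_fst.continuousAt.preimage_mem_nhds
        ((isOpen_extChartAt_target q₀.1).mem_nhds hyt)] with z hz
      exact coordMetric_prod g hz a b
    have h2 : HasFDerivAt (fun z : EuclideanSpace ℝ (Fin n) × ℝ ↦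
        metricCoord g q₀.1 z.1 a.1 b.1 + a.2 * b.2)
        ((((fderiv ℝ (metricCoord g q₀.1) y.1).flip a.1).flip b.1).comp (.fst ℝ _ _)) y := by
      have h3 : HasFDerivAt (fun z ↦ metricCoord g q₀.1 z a.1 b.1)
          (((fderiv ℝ (metricCoord g q₀.1) y.1).flip a.1).flip b.1) y.1 := by
        have h2 := ((differentiableAt_metricCoord g hs).hasFDerivAt.clm_apply
          (hasFDerivAt_const a.1 y.1)).clm_apply (hasFDerivAt_const b.1 y.1)
        refine h2.congr_fderiv ?_
        ext z
        simp [hy]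
      exact (h3.comp y hasFDerivAt_fst).add_const _
    rw [h1.fderiv_eq, h2.fderiv]
    rfl
  refine sharp_eq (fun z z' h ↦ ?_) fun w ↦ ?_
  · have h1 : z.2 = z'.2 := by
      have := h (0, 1)
      rw [coordMetric_prod g hyt, coordMetric_prod g hyt] at this
      simpa using this
    refine Prod.ext (metricCoord_ext g hyt fun w ↦ ?_) h1
    have := h (w, 0)
    rw [coordMetric_prod g hyt, coordMetric_prod g hyt] at this
    simpa using this
  · rw [coordMetric_prod g hyt, hd, hd, hd, zero_mul, add_zero]
    exact metricCoord_christoffel g hs _ _ _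

section CovDeriv

variable {F : S → M × ℝ} {V : ∀ x : S, TangentSpace ((𝓡 n).prod 𝓘(ℝ, ℝ)) (F x)} {x : S}

theorem eventually_toCoord_prod (hF : ContinuousAt F x) :
    (fun y ↦ toCoord ((𝓡 n).prod 𝓘(ℝ, ℝ)) (F x) (F y) (V y)) =ᶠ[𝓝 x]
      fun y ↦ (toCoord (𝓡 n) (F x).1 (F y).1 (fstT (F y) (V y)), sndT (F y) (V y)) := by
  filter_upwards [(continuous_fst.continuousAt.comp hF).preimage_mem_nhds
    ((chartAt (EuclideanSpace ℝ (Fin n)) (F x).1).open_source.mem_nhds (mem_chart_source _ _))]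
    with y hy
  exact toCoord_prod hy _

theorem fstT_covDeriv (hF : MDifferentiableAt J ((𝓡 n).prod 𝓘(ℝ, ℝ)) F x)
    (hV : MDifferentiableAt J 𝓘(ℝ, EuclideanSpace ℝ (Fin n) × ℝ)
      (fun y ↦ toCoord ((𝓡 n).prod 𝓘(ℝ, ℝ)) (F x) (F y) (V y)) x) (v : TangentSpace J x) :
    fstT (F x) (covDeriv J (prodMetric g) F V x v) =
      covDeriv J (metric g) (fun y ↦ (F y).1) (fun y ↦ fstT (F y) (V y)) x v := by
  have hs : (F x).1 ∈ (chartAt (EuclideanSpace ℝ (Fin n)) (F x).1).source := mem_chart_source _ _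
  have h1 : (fun y ↦ (toCoord ((𝓡 n).prod 𝓘(ℝ, ℝ)) (F x) (F y) (V y)).1) =ᶠ[𝓝 x]
      fun y ↦ toCoord (𝓡 n) (F x).1 (F y).1 (fstT (F y) (V y)) :=
    (eventually_toCoord_prod hF.continuousAt).mono fun y hy ↦ congrArg Prod.fst hy
  have h2 : mvfderiv J (fun y ↦ (toCoord ((𝓡 n).prod 𝓘(ℝ, ℝ)) (F x) (F y) (V y)).1) x =
      mvfderiv J (fun y ↦ toCoord (𝓡 n) (F x).1 (F y).1 (fstT (F y) (V y))) x := h1.mfderiv_eq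
  rw [covDeriv, covDeriv]
  refine (fstT_ofCoord hs _).trans (congrArg _ ?_)
  rw [christoffel_prod, toCoord_prod hs, toCoord_prod hs, fstT_mfderiv hF, ← h2]
  exact congrArg (· + christoffel (metric g) (F x).1 (extChartAt (𝓡 n) (F x).1 (F x).1)
    (toCoord (𝓡 n) (F x).1 (F x).1 (mfderiv J (𝓡 n) (fun y ↦ (F y).1) x v))
    (toCoord (𝓡 n) (F x).1 (F x).1 (fstT (F x) (V x)))) (mvfderiv_fst_prod hV v)

theorem sndT_covDeriv (hF : MDifferentiableAt J ((𝓡 n).prod 𝓘(ℝ, ℝ)) F x)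
    (hV : MDifferentiableAt J 𝓘(ℝ, EuclideanSpace ℝ (Fin n) × ℝ)
      (fun y ↦ toCoord ((𝓡 n).prod 𝓘(ℝ, ℝ)) (F x) (F y) (V y)) x) (v : TangentSpace J x) :
    sndT (F x) (covDeriv J (prodMetric g) F V x v) =
      mvfderiv J (fun y ↦ sndT (F y) (V y)) x v := by
  have hs : (F x).1 ∈ (chartAt (EuclideanSpace ℝ (Fin n)) (F x).1).source := mem_chart_source _ _
  have h1 : (fun y ↦ (toCoord ((𝓡 n).prod 𝓘(ℝ, ℝ)) (F x) (F y) (V y)).2) =ᶠ[𝓝 x]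
      fun y ↦ sndT (F y) (V y) :=
    (eventually_toCoord_prod hF.continuousAt).mono fun y hy ↦ congrArg Prod.snd hy
  have h2 : mvfderiv J (fun y ↦ (toCoord ((𝓡 n).prod 𝓘(ℝ, ℝ)) (F x) (F y) (V y)).2) x =
      mvfderiv J (fun y ↦ sndT (F y) (V y)) x := h1.mfderiv_eq
  rw [covDeriv]
  refine (sndT_ofCoord hs _).trans ?_
  rw [christoffel_prod, ← h2]
  refine Eq.trans ?_ (mvfderiv_snd_prod hV v)
  exact add_zero _

end CovDeriv

end Product

/-! ### Hypersurfaces of `M × ℝ` -/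

section Direction

variable {n : ℕ} {M : Type*} [TopologicalSpace M] [ChartedSpace (EuclideanSpace ℝ (Fin n)) M]
  [IsManifold (𝓡 n) ∞ M]
  (g : ContMDiffRiemannianMetric (𝓡 n) ∞ (EuclideanSpace ℝ (Fin n))
      (fun x : M ↦ TangentSpace (𝓡 n) x))
  {E' : Type*} [NormedAddCommGroup E'] [NormedSpace ℝ E']
  {H' : Type*} [TopologicalSpace H'] {J : ModelWithCorners ℝ E' H'}
  {S : Type*} [TopologicalSpace S] [ChartedSpace H' S]

theorem christoffel_smul_left {x₀ x : M} (hx : x ∈ (chartAt (EuclideanSpace ℝ (Fin n)) x₀).source)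
    (c : ℝ) (u v : EuclideanSpace ℝ (Fin n)) :
    christoffel (metric g) x₀ (extChartAt (𝓡 n) x₀ x) (c • u) v =
      c • christoffel (metric g) x₀ (extChartAt (𝓡 n) x₀ x) u v := by
  refine metricCoord_ext g (extChartAt_mem_target x₀ hx) fun w ↦ ?_
  have h2 : ∀ (B : EuclideanSpace ℝ (Fin n) →L[ℝ] EuclideanSpace ℝ (Fin n) →L[ℝ] ℝ) (u w),
      B (c • u) w = c * B u w := fun B u w ↦ by rw [B.map_smul, smul_apply, smul_eq_mul]
  have h3 : ∀ (L : EuclideanSpace ℝ (Fin n) →L[ℝ] EuclideanSpace ℝ (Fin n) →L[ℝ]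
      EuclideanSpace ℝ (Fin n) →L[ℝ] ℝ) (v u w), L (c • v) u w = c * L v u w := fun L v u w ↦ by
    rw [L.map_smul]; rfl
  rw [h2, metricCoord_christoffel g hx, metricCoord_christoffel g hx, h2, h3, h2]
  ring

theorem covDeriv_smul_direction {F : S → M} {V : ∀ x : S, TangentSpace (𝓡 n) (F x)} {x : S}
    (c : ℝ) (v : TangentSpace J x) :
    covDeriv J (metric g) F V x (c • v) = c • covDeriv J (metric g) F V x v := by
  have hs : F x ∈ (chartAt (EuclideanSpace ℝ (Fin n)) (F x)).source := mem_chart_source _ _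
  rw [covDeriv, covDeriv, map_smul, map_smul, map_smul, christoffel_smul_left g hs, ← smul_add,
    map_smul]

end Direction

/-! ### Normal, height gradient and shape operator, split into parts along M and ℝ. -/

section Hypersurface

variable {n : ℕ} {M : Type*} [TopologicalSpace M] [ChartedSpace (EuclideanSpace ℝ (Fin n)) M]
  [IsManifold (𝓡 n) ∞ M]
  {g : ContMDiffRiemannianMetric (𝓡 n) ∞ (EuclideanSpace ℝ (Fin n))
      (fun x : M ↦ TangentSpace (𝓡 n) x)}
  {E' : Type*} [NormedAddCommGroup E'] [NormedSpace ℝ E']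
  {H' : Type*} [TopologicalSpace H'] {J : ModelWithCorners ℝ E' H'}
  {S : Type*} [TopologicalSpace S] [ChartedSpace H' S]
  {F : S → M × ℝ} {N : ∀ x : S, TangentSpace ((𝓡 n).prod 𝓘(ℝ, ℝ)) (F x)}

theorem IsUnitNormal.contMDiff_map (hN : IsUnitNormal J (prodMetric g) F N) :
    ContMDiff J ((𝓡 n).prod 𝓘(ℝ, ℝ)) ∞ F := fun x ↦ contMDiffAt_base (hN.smooth x)

theorem IsUnitNormal.contMDiff_fst (hN : IsUnitNormal J (prodMetric g) F N) :
    ContMDiff J (𝓡 n) ∞ (fun x ↦ (F x).1) :=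
  ContMDiff.comp _root_.contMDiff_fst hN.contMDiff_map

theorem IsUnitNormal.contMDiff_height (hN : IsUnitNormal J (prodMetric g) F N) :
    ContMDiff J 𝓘(ℝ, ℝ) ∞ (height F) := contMDiff_snd.comp hN.contMDiff_map

theorem IsUnitNormal.mdifferentiableAt (hN : IsUnitNormal J (prodMetric g) F N) (x : S) :
    MDifferentiableAt J ((𝓡 n).prod 𝓘(ℝ, ℝ)) F x := hN.contMDiff_map.mdifferentiableAt (by simp)

theorem IsUnitNormal.contMDiffAt_toCoord (hN : IsUnitNormal J (prodMetric g) F N) (x : S) :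
    ContMDiffAt J 𝓘(ℝ, EuclideanSpace ℝ (Fin n) × ℝ) ∞
      (fun y ↦ toCoord ((𝓡 n).prod 𝓘(ℝ, ℝ)) (F x) (F y) (N y)) x :=
  ParallelGraph.contMDiffAt_toCoord (hN.smooth x) (mem_chart_source _ _)

theorem IsUnitNormal.contMDiffAt_toCoord_fst (hN : IsUnitNormal J (prodMetric g) F N) {x : S}
    {x₀ : M} (hx : (F x).1 ∈ (chartAt (EuclideanSpace ℝ (Fin n)) x₀).source) :
    ContMDiffAt J 𝓘(ℝ, EuclideanSpace ℝ (Fin n)) ∞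
      (fun y ↦ toCoord (𝓡 n) x₀ (F y).1 (fstT (F y) (N y))) x := by
  have h : ContMDiffAt 𝓘(ℝ, EuclideanSpace ℝ (Fin n) × ℝ) 𝓘(ℝ, EuclideanSpace ℝ (Fin n)) ∞
      Prod.fst (toCoord ((𝓡 n).prod 𝓘(ℝ, ℝ)) (x₀, 0) (F x) (N x)) :=
    contDiff_fst.contMDiff.contMDiffAt
  refine (h.comp x (ParallelGraph.contMDiffAt_toCoord (hN.smooth x)
    (prod_mem_chart_source (q₀ := (x₀, 0)) hx))).congr_of_eventuallyEq ?_
  filter_upwards [hN.contMDiff_fst.continuous.continuousAt.preimage_mem_nhds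
    ((chartAt (EuclideanSpace ℝ (Fin n)) x₀).open_source.mem_nhds hx)] with y hy
  exact (congrArg Prod.fst (toCoord_prod (q₀ := (x₀, 0)) hy _)).symm

theorem IsUnitNormal.contMDiff_angle (hN : IsUnitNormal J (prodMetric g) F N) :
    ContMDiff J 𝓘(ℝ, ℝ) ∞ (fun y ↦ sndT (F y) (N y)) := by
  intro x
  have h : ContMDiffAt 𝓘(ℝ, EuclideanSpace ℝ (Fin n) × ℝ) 𝓘(ℝ, ℝ) ∞
      Prod.snd (toCoord ((𝓡 n).prod 𝓘(ℝ, ℝ)) (F x) (F x) (N x)) :=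
    contDiff_snd.contMDiff.contMDiffAt
  refine (h.comp x (hN.contMDiffAt_toCoord x)).congr_of_eventuallyEq ?_
  filter_upwards [eventually_toCoord_prod (V := N) (hN.mdifferentiableAt x).continuousAt] with y hy
  exact (congrArg Prod.snd hy).symm

theorem IsUnitNormal.normal_prod (hN : IsUnitNormal J (prodMetric g) F N) (x : S)
    (v : TangentSpace J x) :
    g.inner (F x).1 (fstT (F x) (N x)) (mfderiv J (𝓡 n) (fun y ↦ (F y).1) x v)
      + sndT (F x) (N x) * mvfderiv J (height F) x v = 0 := by
  have h := hN.normal x v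
  rwa [prodMetric_eq, fstT_mfderiv (hN.mdifferentiableAt x),
    sndT_mfderiv (hN.mdifferentiableAt x)] at h

theorem IsUnitNormal.unit_prod (hN : IsUnitNormal J (prodMetric g) F N) (x : S) :
    g.inner (F x).1 (fstT (F x) (N x)) (fstT (F x) (N x))
      + sndT (F x) (N x) * sndT (F x) (N x) = 1 := hN.unit x

theorem IsUnitNormal.injective_of_fst (hN : IsUnitNormal J (prodMetric g) F N) {x : S}
    (h : Function.Injective (mfderiv J (𝓡 n) (fun y ↦ (F y).1) x)) :
    Function.Injective (mfderiv J ((𝓡 n).prod 𝓘(ℝ, ℝ)) F x) := by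
  intro v w hvw
  apply h
  rw [← fstT_mfderiv (hN.mdifferentiableAt x), ← fstT_mfderiv (hN.mdifferentiableAt x), hvw]

/-- A tangent vector with zero projection to M is vertical, and orthogonality to N forces θ times
its height to vanish. -/
theorem IsUnitNormal.fst_injective (hN : IsUnitNormal J (prodMetric g) F N) {x : S}
    (h : Function.Injective (mfderiv J ((𝓡 n).prod 𝓘(ℝ, ℝ)) F x)) (hθ : sndT (F x) (N x) ≠ 0) :
    Function.Injective (mfderiv J (𝓡 n) (fun y ↦ (F y).1) x) := by
  rw [injective_iff_map_eq_zero]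
  intro v hv
  have h1 := hN.normal_prod x v
  rw [hv, map_zero, zero_add] at h1
  have h2 := (mul_eq_zero.1 h1).resolve_left hθ
  apply (injective_iff_map_eq_zero _).1 h
  refine tangent_prod_ext ?_ ?_
  · rw [fstT_mfderiv (hN.mdifferentiableAt x), hv, map_zero]
  · rw [sndT_mfderiv (hN.mdifferentiableAt x), map_zero]; exact h2

/-- Characterization of the gradient of the height. -/
theorem IsUnitNormal.gradHeight_eq (hN : IsUnitNormal J (prodMetric g) F N) {x : S}
    (hinj : Function.Injective (mfderiv J (𝓡 n) (fun y ↦ (F y).1) x))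
    (hθ : sndT (F x) (N x) ≠ 0) {z : TangentSpace J x}
    (hz : mfderiv J (𝓡 n) (fun y ↦ (F y).1) x z = -sndT (F x) (N x) • fstT (F x) (N x)) :
    gradHeight J g F x = z ∧ mvfderiv J (height F) x z = 1 - sndT (F x) (N x) ^ 2 := by
  have h1 : mvfderiv J (height F) x z = 1 - sndT (F x) (N x) ^ 2 := by
    have h2 := hN.normal_prod x z
    rw [hz, map_smul, smul_eq_mul] at h2
    have h3 := hN.unit_prod x
    -- Orthogonality of z to N, with |N₁|² = 1 − θ², determines the height of z after division by θ.
    have h4 : sndT (F x) (N x) * (mvfderiv J (height F) x z - (1 - sndT (F x) (N x) ^ 2)) = 0 := by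
      linear_combination h2 + sndT (F x) (N x) * h3
    linarith [(mul_eq_zero.1 h4).resolve_left hθ]
  refine ⟨sharp_eq (fun u v h ↦ ?_) fun w ↦ ?_, h1⟩
  · refine hN.injective_of_fst hinj ?_
    have h2 := h (u - v)
    rw [inducedMetric, inducedMetric] at h2
    rw [map_sub] at h2
    exact eq_of_prodMetric_sub g h2
  · rw [inducedMetric, prodMetric_eq, fstT_mfderiv (hN.mdifferentiableAt x),
      fstT_mfderiv (hN.mdifferentiableAt x), sndT_mfderiv (hN.mdifferentiableAt x),
      sndT_mfderiv (hN.mdifferentiableAt x), hz, map_smul, smul_apply, smul_eq_mul]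
    have h2 := hN.normal_prod x w
    change _ + mvfderiv J (height F) x z * mvfderiv J (height F) x w = _
    rw [h1]
    linear_combination -sndT (F x) (N x) * h2

theorem IsUnitNormal.fstT_shapeOperator (hN : IsUnitNormal J (prodMetric g) F N) (x : S)
    (v : TangentSpace J x) :
    fstT (F x) (shapeOperator J g F N x v) =
      -covDeriv J (metric g) (fun y ↦ (F y).1) (fun y ↦ fstT (F y) (N y)) x v := by
  rw [shapeOperator, map_neg, fstT_covDeriv g (hN.mdifferentiableAt x)
    ((hN.contMDiffAt_toCoord x).mdifferentiableAt (by simp))]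

theorem IsUnitNormal.sndT_shapeOperator (hN : IsUnitNormal J (prodMetric g) F N) (x : S)
    (v : TangentSpace J x) :
    sndT (F x) (shapeOperator J g F N x v) = -mvfderiv J (fun y ↦ sndT (F y) (N y)) x v := by
  rw [shapeOperator, map_neg, sndT_covDeriv g (hN.mdifferentiableAt x)
    ((hN.contMDiffAt_toCoord x).mdifferentiableAt (by simp))]

/-- The eigenvalue equation becomes an equation for N₁ along the projection to M together with a
scalar one for θ. -/
theorem IsUnitNormal.hasPrincipalCurvature_iff (hN : IsUnitNormal J (prodMetric g) F N) (x : S)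
    (v : TangentSpace J x) (κ : ℝ) :
    HasPrincipalCurvature g F N x v κ ↔ v ≠ 0 ∧
      -covDeriv J (metric g) (fun y ↦ (F y).1) (fun y ↦ fstT (F y) (N y)) x v =
        κ • mfderiv J (𝓡 n) (fun y ↦ (F y).1) x v ∧
      -mvfderiv J (fun y ↦ sndT (F y) (N y)) x v = κ * mvfderiv J (height F) x v := by
  rw [HasPrincipalCurvature, ← hN.fstT_shapeOperator, ← hN.sndT_shapeOperator,
    ← fstT_mfderiv (hN.mdifferentiableAt x)]
  have h2 : mvfderiv J (height F) x v =
      sndT (F x) (mfderiv J ((𝓡 n).prod 𝓘(ℝ, ℝ)) F x v) :=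
    (sndT_mfderiv (hN.mdifferentiableAt x) v).symm
  rw [h2]
  refine and_congr_right fun _ ↦ ⟨fun h ↦ ?_, fun h ↦ tangent_prod_ext ?_ ?_⟩
  · rw [h, map_smul, map_smul]
    exact ⟨rfl, rfl⟩
  · rw [map_smul]; exact h.1
  · rw [map_smul]; exact h.2

end Hypersurface

/-! ### Parallel families -/

section Parallel

variable {n : ℕ} {M : Type*} [TopologicalSpace M] [ChartedSpace (EuclideanSpace ℝ (Fin n)) M]
  [IsManifold (𝓡 n) ∞ M]
  {g : ContMDiffRiemannianMetric (𝓡 n) ∞ (EuclideanSpace ℝ (Fin n))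
      (fun x : M ↦ TangentSpace (𝓡 n) x)}
  {P : Type*} [TopologicalSpace P] [ChartedSpace (EuclideanSpace ℝ (Fin (n - 1))) P]
  {T : Set ℝ} {f : ℝ → P → M} {η : ∀ p : P, TangentSpace (𝓡 n) (f 0 p)}

theorem eqOn_of_hasDerivAt_zero {T : Set ℝ} (hT : IsOpen T) (hT' : T.OrdConnected) {φ : ℝ → ℝ}
    (hφ : ∀ s ∈ T, HasDerivAt φ 0 s) {s t : ℝ} (hs : s ∈ T) (ht : t ∈ T) : φ s = φ t :=
  hT.is_const_of_deriv_eq_zero hT'.isPreconnected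
    (fun r hr ↦ (hφ r hr).differentiableAt.differentiableWithinAt)
    (fun r hr ↦ (hφ r hr).deriv) hs ht

/-- The speed of a geodesic is constant on the interval, and at 0 the velocity is the unit vector η.
-/
theorem IsParallelFamily.speed (hP : IsParallelFamily g T f η) (p : P) {s : ℝ} (hs : s ∈ T) :
    g.inner (f s p) (mfderiv 𝓘(ℝ, ℝ) (𝓡 n) (fun s ↦ f s p) s (1 : ℝ))
      (mfderiv 𝓘(ℝ, ℝ) (𝓡 n) (fun s ↦ f s p) s (1 : ℝ)) = 1 := by
  refine (eqOn_of_hasDerivAt_zero hP.isOpen hP.ordConnected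
    (fun r hr ↦ (hP.geodesic p).hasDerivAt_speed g hP.isOpen hr) hs hP.zero_mem).trans ?_
  have h := hP.unitNormal.unit p
  rw [← hP.velocity p] at h
  exact h

/-- By the Gauss lemma the inner product does not depend on s, and at 0 it vanishes because η is
normal to f 0. -/
theorem IsParallelFamily.gauss [IsManifold (𝓡 (n - 1)) ∞ P] (hP : IsParallelFamily g T f η)
    (p : P) (v : TangentSpace (𝓡 (n - 1)) p) {s : ℝ} (hs : s ∈ T) :
    g.inner (f s p) (mfderiv 𝓘(ℝ, ℝ) (𝓡 n) (fun s ↦ f s p) s (1 : ℝ))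
      (mfderiv (𝓡 (n - 1)) (𝓡 n) (f s) p v) = 0 := by
  refine (eqOn_of_hasDerivAt_zero hP.isOpen hP.ordConnected
    (fun r hr ↦ hasDerivAt_gauss g hP.isOpen hP.smooth hP.geodesic (fun p s hs ↦ hP.speed p hs)
      p v hr) hs hP.zero_mem).trans ?_
  have h := hP.unitNormal.normal p v
  rw [← hP.velocity p] at h
  exact h

end Parallel

/-- An injective map whose image is a complement of a line. -/
theorem exists_eq_add_smul {E₁ E : Type*} [AddCommGroup E₁] [Module ℝ E₁] [FiniteDimensional ℝ E₁]
    [AddCommGroup E] [Module ℝ E] [FiniteDimensional ℝ E] (L : E₁ →ₗ[ℝ] E)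
    (hL : Function.Injective L) (hdim : Module.finrank ℝ E₁ + 1 = Module.finrank ℝ E)
    (ℓ : E →ₗ[ℝ] ℝ) (hℓ : ∀ v, ℓ (L v) = 0) {u : E} (hu : ℓ u = 1) (w : E) :
    ∃ v, w = L v + ℓ w • u := by
  let K : E₁ × ℝ →ₗ[ℝ] E := L.coprod (LinearMap.toSpanSingleton ℝ E u)
  have hK : ∀ q, K q = L q.1 + q.2 • u := fun q ↦ by simp [K]
  have hinj : Function.Injective K := by
    rw [injective_iff_map_eq_zero]
    intro q hq
    rw [hK] at hq
    have h1 := congrArg ℓ hq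
    rw [map_add, hℓ, map_smul, hu, map_zero, smul_eq_mul, mul_one, zero_add] at h1
    rw [h1, zero_smul, add_zero] at hq
    exact Prod.ext ((injective_iff_map_eq_zero L).1 hL _ hq) h1
  have hsurj : Function.Surjective K :=
    (LinearMap.injective_iff_surjective_of_finrank_eq_finrank (by simpa using hdim)).1 hinj
  obtain ⟨q, rfl⟩ := hsurj w
  refine ⟨q.1, ?_⟩
  rw [hK, map_add, hℓ, map_smul, hu]
  simp

/-! ### Transport along equalities of base points and of germs of curves. -/

section Congr

variable {E : Type*} [NormedAddCommGroup E] [NormedSpace ℝ E]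
  {H : Type*} [TopologicalSpace H] {I : ModelWithCorners ℝ E H}
  {X : Type*} [TopologicalSpace X] [ChartedSpace H X]

/-- All tangent spaces unfold to the model space, so vectors at propositionally equal points can be
compared there. -/
theorem metric_congr (h : ∀ x : X, TangentSpace I x → TangentSpace I x → ℝ) {y y' : X}
    (hy : y = y') {u v : TangentSpace I y} {u' v' : TangentSpace I y'}
    (hu : (u : E) = u') (hv : (v : E) = v') : h y u v = h y' u' v' := by
  subst hy
  exact congrArg₂ (h y) hu hv

/-- The acceleration depends only on the germ of the curve. This is used to replace f_s(p) by the
projection of F(Ψ(p, s)), with which it agrees only for s in the interval. -/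
theorem covDeriv_velocity_eq_zero_congr {h : ∀ x : X, TangentSpace I x → TangentSpace I x → ℝ}
    {γ γ' : ℝ → X} {s : ℝ} (hγ : γ =ᶠ[𝓝 s] γ')
    (h0 : covDeriv 𝓘(ℝ, ℝ) h γ (fun r ↦ mfderiv 𝓘(ℝ, ℝ) I γ r (1 : ℝ)) s (1 : ℝ) = 0) :
    covDeriv 𝓘(ℝ, ℝ) h γ' (fun r ↦ mfderiv 𝓘(ℝ, ℝ) I γ' r (1 : ℝ)) s (1 : ℝ) = 0 := by
  have hs : γ s = γ' s := hγ.self_of_nhds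
  have hd : ∀ᶠ r in 𝓝 s, (mfderiv 𝓘(ℝ, ℝ) I γ r (1 : ℝ) : E) = mfderiv 𝓘(ℝ, ℝ) I γ' r (1 : ℝ) := by
    filter_upwards [eventually_eventually_nhds.2 hγ] with r hr
    exact congrArg (fun L : ℝ →L[ℝ] E ↦ L 1) (Filter.EventuallyEq.mfderiv_eq hr)
  let Q : ∀ y : X, E → E → E := fun y D u ↦ ofCoord I y y (D +
    christoffel h y (extChartAt I y y) (toCoord I y y u) (toCoord I y y u))
  have hD : (fun r ↦ toCoord I (γ s) (γ r) (mfderiv 𝓘(ℝ, ℝ) I γ r (1 : ℝ))) =ᶠ[𝓝 s]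
      (fun r ↦ toCoord I (γ' s) (γ' r) (mfderiv 𝓘(ℝ, ℝ) I γ' r (1 : ℝ))) := by
    filter_upwards [hγ, hd] with r hr hr'
    let R : X → E → E := fun y u ↦ toCoord I (γ s) y u
    have h1 : R (γ r) (mfderiv 𝓘(ℝ, ℝ) I γ r (1 : ℝ)) =
      R (γ' r) (mfderiv 𝓘(ℝ, ℝ) I γ' r (1 : ℝ)) := congrArg₂ R hr hr'
    rw [← hs]
    exact h1
  have h1 : mvfderiv 𝓘(ℝ, ℝ) (fun r ↦ toCoord I (γ s) (γ r) (mfderiv 𝓘(ℝ, ℝ) I γ r (1 : ℝ))) s =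
      mvfderiv 𝓘(ℝ, ℝ) (fun r ↦ toCoord I (γ' s) (γ' r) (mfderiv 𝓘(ℝ, ℝ) I γ' r (1 : ℝ))) s :=
    hD.mfderiv_eq
  have h2 : Q (γ s) (mvfderiv 𝓘(ℝ, ℝ)
      (fun r ↦ toCoord I (γ s) (γ r) (mfderiv 𝓘(ℝ, ℝ) I γ r (1 : ℝ))) s (1 : ℝ))
      (mfderiv 𝓘(ℝ, ℝ) I γ s (1 : ℝ)) = (0 : E) := h0
  rw [h1] at h2
  have h3 : Q (γ s) = Q (γ' s) := congrArg Q hs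
  rw [h3] at h2
  have h4 := hd.self_of_nhds
  exact (congrArg (Q (γ' s) _) h4.symm).trans h2

end Congr

/-! ### Graphs over parallel families -/

section Graph

variable {n : ℕ} {M : Type*} [TopologicalSpace M] [ChartedSpace (EuclideanSpace ℝ (Fin n)) M]
  [IsManifold (𝓡 n) ∞ M]
  {g : ContMDiffRiemannianMetric (𝓡 n) ∞ (EuclideanSpace ℝ (Fin n))
      (fun x : M ↦ TangentSpace (𝓡 n) x)}
  {E' : Type*} [NormedAddCommGroup E'] [NormedSpace ℝ E']
  {H' : Type*} [TopologicalSpace H'] {J : ModelWithCorners ℝ E' H'}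
  {S : Type*} [TopologicalSpace S] [ChartedSpace H' S]
  {F : S → M × ℝ} {N : ∀ x : S, TangentSpace ((𝓡 n).prod 𝓘(ℝ, ℝ)) (F x)}
  {P : Type*} [TopologicalSpace P] [ChartedSpace (EuclideanSpace ℝ (Fin (n - 1))) P]
  {T : Set ℝ} {f : ℝ → P → M} {η : ∀ p : P, TangentSpace (𝓡 n) (f 0 p)} {a : ℝ → ℝ}
  {Ψ : PartialDiffeomorph ((𝓡 (n - 1)).prod 𝓘(ℝ, ℝ)) J (P × ℝ) S ∞}

theorem contMDiffAt_slice_right (hsrc : Ψ.source = univ ×ˢ T) (p : P) {s : ℝ} (hs : s ∈ T) :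
    ContMDiffAt 𝓘(ℝ, ℝ) J ∞ (fun r ↦ Ψ (p, r)) s := by
  have h1 : ContMDiffAt ((𝓡 (n - 1)).prod 𝓘(ℝ, ℝ)) J ∞ Ψ (p, s) :=
    Ψ.contMDiffOn_toFun.contMDiffAt (Ψ.open_source.mem_nhds (by rw [hsrc]; exact ⟨mem_univ _, hs⟩))
  exact h1.comp s (contMDiffAt_const.prodMk contMDiffAt_id)

theorem contMDiffAt_slice_left (hsrc : Ψ.source = univ ×ˢ T) (p : P) {s : ℝ} (hs : s ∈ T) :
    ContMDiffAt (𝓡 (n - 1)) J ∞ (fun p ↦ Ψ (p, s)) p := by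
  have h1 : ContMDiffAt ((𝓡 (n - 1)).prod 𝓘(ℝ, ℝ)) J ∞ Ψ (p, s) :=
    Ψ.contMDiffOn_toFun.contMDiffAt (Ψ.open_source.mem_nhds (by rw [hsrc]; exact ⟨mem_univ _, hs⟩))
  exact h1.comp p (contMDiffAt_id.prodMk contMDiffAt_const)

/-- The vector of `T S` tangent to the parameter curves `s ↦ Ψ (p, s)`. -/
def graphVelocity (J : ModelWithCorners ℝ E' H') (Ψ : P × ℝ → S) (p : P) (s : ℝ) :
    TangentSpace J (Ψ (p, s)) :=
  mfderiv 𝓘(ℝ, ℝ) J (fun r ↦ Ψ (p, r)) s (1 : ℝ)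

/-- The hypersurface `F`, with unit normal `N`, is parametrized by `Ψ` as an `(f_s, a)`-graph. -/
structure IsGraphParam (g : ContMDiffRiemannianMetric (𝓡 n) ∞ (EuclideanSpace ℝ (Fin n))
      (fun x : M ↦ TangentSpace (𝓡 n) x)) (T : Set ℝ) (f : ℝ → P → M)
    (η : ∀ p : P, TangentSpace (𝓡 n) (f 0 p)) (a : ℝ → ℝ) (F : S → M × ℝ)
    (N : ∀ x : S, TangentSpace ((𝓡 n).prod 𝓘(ℝ, ℝ)) (F x))
    (Ψ : PartialDiffeomorph ((𝓡 (n - 1)).prod 𝓘(ℝ, ℝ)) J (P × ℝ) S ∞) : Prop where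
  unitNormal : IsUnitNormal J (prodMetric g) F N
  parallel : IsParallelFamily g T f η
  smooth : ContDiffOn ℝ ∞ a T
  deriv_pos : ∀ s ∈ T, 0 < deriv a s
  source : Ψ.source = univ ×ˢ T
  map_eq : ∀ p, ∀ s ∈ T, F (Ψ (p, s)) = (f s p, a s)

namespace IsGraphParam

theorem velocity_eq (h : IsGraphParam g T f η a F N Ψ) (p : P) {s : ℝ} (hs : s ∈ T) :
    mfderiv J (𝓡 n) (fun y ↦ (F y).1) (Ψ (p, s)) (graphVelocity J Ψ p s) =
      mfderiv 𝓘(ℝ, ℝ) (𝓡 n) (fun r ↦ (F (Ψ (p, r))).1) s (1 : ℝ) :=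
  (mfderiv_comp_apply s (h.unitNormal.contMDiff_fst.mdifferentiableAt (by simp))
    ((contMDiffAt_slice_right h.source p hs).mdifferentiableAt (by simp)) (1 : ℝ)).symm

theorem eventuallyEq (h : IsGraphParam g T f η a F N Ψ) (p : P) {s : ℝ} (hs : s ∈ T) :
    (fun r ↦ f r p) =ᶠ[𝓝 s] fun r ↦ (F (Ψ (p, r))).1 := by
  filter_upwards [h.parallel.isOpen.mem_nhds hs] with r hr
  rw [h.map_eq p r hr]

theorem mfderiv_eq (h : IsGraphParam g T f η a F N Ψ) (p : P) {s : ℝ} (hs : s ∈ T) :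
    (mfderiv 𝓘(ℝ, ℝ) (𝓡 n) (fun r ↦ f r p) s (1 : ℝ) : EuclideanSpace ℝ (Fin n)) =
      mfderiv 𝓘(ℝ, ℝ) (𝓡 n) (fun r ↦ (F (Ψ (p, r))).1) s (1 : ℝ) :=
  congrArg (fun L : ℝ →L[ℝ] EuclideanSpace ℝ (Fin n) ↦ L 1)
    (Filter.EventuallyEq.mfderiv_eq (h.eventuallyEq p hs))

theorem speed (h : IsGraphParam g T f η a F N Ψ) (p : P) {s : ℝ} (hs : s ∈ T) :
    g.inner (F (Ψ (p, s))).1 (mfderiv 𝓘(ℝ, ℝ) (𝓡 n) (fun r ↦ (F (Ψ (p, r))).1) s (1 : ℝ))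
      (mfderiv 𝓘(ℝ, ℝ) (𝓡 n) (fun r ↦ (F (Ψ (p, r))).1) s (1 : ℝ)) = 1 :=
  (metric_congr (metric g) (h.eventuallyEq p hs).self_of_nhds.symm (h.mfderiv_eq p hs).symm
    (h.mfderiv_eq p hs).symm).trans (h.parallel.speed p hs)

theorem geodesic (h : IsGraphParam g T f η a F N Ψ) (p : P) {s : ℝ} (hs : s ∈ T) :
    covDeriv 𝓘(ℝ, ℝ) (metric g) (fun r ↦ (F (Ψ (p, r))).1)
      (fun r ↦ mfderiv 𝓘(ℝ, ℝ) (𝓡 n) (fun r ↦ (F (Ψ (p, r))).1) r (1 : ℝ)) s (1 : ℝ) = 0 :=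
  covDeriv_velocity_eq_zero_congr (h.eventuallyEq p hs) ((h.parallel.geodesic p).2 s hs)

theorem mfderiv_slice (h : IsGraphParam g T f η a F N Ψ) (p : P)
    (v : TangentSpace (𝓡 (n - 1)) p) {s : ℝ} (hs : s ∈ T) :
    (mfderiv J (𝓡 n) (fun y ↦ (F y).1) (Ψ (p, s))
      (mfderiv (𝓡 (n - 1)) J (fun p ↦ Ψ (p, s)) p v) : EuclideanSpace ℝ (Fin n)) =
      mfderiv (𝓡 (n - 1)) (𝓡 n) (f s) p v := by
  have h1 : (fun p ↦ (F (Ψ (p, s))).1) = f s := by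
    funext q; rw [h.map_eq q s hs]
  have h2 := (mfderiv_comp_apply p (f := fun p ↦ Ψ (p, s))
    (h.unitNormal.contMDiff_fst.mdifferentiableAt (by simp))
    ((contMDiffAt_slice_left h.source p hs).mdifferentiableAt (by simp)) v).symm
  refine h2.trans ?_
  change mfderiv (𝓡 (n - 1)) (𝓡 n) (fun p ↦ (F (Ψ (p, s))).1) p v = _
  rw [h1]
  rfl

theorem gauss [IsManifold (𝓡 (n - 1)) ∞ P] (h : IsGraphParam g T f η a F N Ψ) (p : P)
    (v : TangentSpace (𝓡 (n - 1)) p) {s : ℝ} (hs : s ∈ T) :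
    g.inner (F (Ψ (p, s))).1 (mfderiv 𝓘(ℝ, ℝ) (𝓡 n) (fun r ↦ (F (Ψ (p, r))).1) s (1 : ℝ))
      (mfderiv J (𝓡 n) (fun y ↦ (F y).1) (Ψ (p, s))
        (mfderiv (𝓡 (n - 1)) J (fun p ↦ Ψ (p, s)) p v)) = 0 :=
  (metric_congr (metric g) (h.eventuallyEq p hs).self_of_nhds.symm (h.mfderiv_eq p hs).symm
    (h.mfderiv_slice p v hs)).trans (h.parallel.gauss p v hs)

theorem height_slice (h : IsGraphParam g T f η a F N Ψ) (p : P)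
    (v : TangentSpace (𝓡 (n - 1)) p) {s : ℝ} (hs : s ∈ T) :
    mvfderiv J (height F) (Ψ (p, s)) (mfderiv (𝓡 (n - 1)) J (fun p ↦ Ψ (p, s)) p v) = 0 := by
  have h1 : (fun p ↦ height F (Ψ (p, s))) = fun _ ↦ a s := by
    funext q; rw [height, h.map_eq q s hs]
  have h2 := (mfderiv_comp_apply p (f := fun p ↦ Ψ (p, s))
    (h.unitNormal.contMDiff_height.mdifferentiableAt (by simp))
    ((contMDiffAt_slice_left h.source p hs).mdifferentiableAt (by simp)) v).symm
  refine h2.trans ?_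
  change mfderiv (𝓡 (n - 1)) 𝓘(ℝ, ℝ) (fun p ↦ height F (Ψ (p, s))) p v = _
  rw [h1, mfderiv_const]
  rfl

theorem height_velocity (h : IsGraphParam g T f η a F N Ψ) (p : P) {s : ℝ} (hs : s ∈ T) :
    mvfderiv J (height F) (Ψ (p, s)) (graphVelocity J Ψ p s) = deriv a s := by
  have h1 : (fun r ↦ height F (Ψ (p, r))) =ᶠ[𝓝 s] a := by
    filter_upwards [h.parallel.isOpen.mem_nhds hs] with r hr
    rw [height, h.map_eq p r hr]
  have h2 := (mfderiv_comp_apply s (f := fun r ↦ Ψ (p, r))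
    (h.unitNormal.contMDiff_height.mdifferentiableAt (by simp))
    ((contMDiffAt_slice_right h.source p hs).mdifferentiableAt (by simp)) (1 : ℝ)).symm
  exact h2.trans (mvfderiv_real_one.trans h1.deriv_eq)

variable [IsManifold (𝓡 (n - 1)) ∞ P]

/-- The image of d f_s has dimension n − 1 and is orthogonal to the unit vector γ', so the two span
the tangent space of M. -/
theorem decompose (hn : 1 ≤ n) (h : IsGraphParam g T f η a F N Ψ) (p : P) {s : ℝ} (hs : s ∈ T)
    (w : TangentSpace (𝓡 n) (F (Ψ (p, s))).1) :
    ∃ v : TangentSpace (𝓡 (n - 1)) p, w =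
      mfderiv J (𝓡 n) (fun y ↦ (F y).1) (Ψ (p, s))
        (mfderiv (𝓡 (n - 1)) J (fun p ↦ Ψ (p, s)) p v) +
      g.inner (F (Ψ (p, s))).1 (mfderiv 𝓘(ℝ, ℝ) (𝓡 n) (fun r ↦ (F (Ψ (p, r))).1) s (1 : ℝ)) w •
        mfderiv 𝓘(ℝ, ℝ) (𝓡 n) (fun r ↦ (F (Ψ (p, r))).1) s (1 : ℝ) := by
  let L : EuclideanSpace ℝ (Fin (n - 1)) →L[ℝ] EuclideanSpace ℝ (Fin n) :=
    (mfderiv J (𝓡 n) (fun y ↦ (F y).1) (Ψ (p, s))).comp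
      (mfderiv (𝓡 (n - 1)) J (fun p ↦ Ψ (p, s)) p)
  let ℓ : EuclideanSpace ℝ (Fin n) →L[ℝ] ℝ :=
    g.inner (F (Ψ (p, s))).1 (mfderiv 𝓘(ℝ, ℝ) (𝓡 n) (fun r ↦ (F (Ψ (p, r))).1) s (1 : ℝ))
  refine exists_eq_add_smul (L : EuclideanSpace ℝ (Fin (n - 1)) →ₗ[ℝ] EuclideanSpace ℝ (Fin n))
    (fun v w hvw ↦ ?_) ?_ (ℓ : EuclideanSpace ℝ (Fin n) →ₗ[ℝ] ℝ) (fun v ↦ h.gauss p v hs)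
    (h.speed p hs) w
  · refine (h.parallel.immersion s hs).injective p ?_
    exact ((h.mfderiv_slice p v hs).symm.trans hvw).trans (h.mfderiv_slice p w hs)
  · simp; omega

/-- The decomposition exhibits every vector of M as a projection; equality of dimensions does the
rest. A graph is thereby an immersion without assuming it. -/
theorem injective_fst [FiniteDimensional ℝ E'] (hdim : Module.finrank ℝ E' = n) (hn : 1 ≤ n)
    (h : IsGraphParam g T f η a F N Ψ) (p : P) {s : ℝ} (hs : s ∈ T) :
    Function.Injective (mfderiv J (𝓡 n) (fun y ↦ (F y).1) (Ψ (p, s))) := by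
  have hsurj : Function.Surjective (mfderiv J (𝓡 n) (fun y ↦ (F y).1) (Ψ (p, s))) := by
    intro w
    obtain ⟨v, hv⟩ := h.decompose hn p hs w
    rw [← h.velocity_eq p hs, ← map_smul, ← map_add] at hv
    exact ⟨_, hv.symm⟩
  have h1 : Module.finrank ℝ (TangentSpace J (Ψ (p, s))) =
      Module.finrank ℝ (TangentSpace (𝓡 n) (F (Ψ (p, s))).1) := by
    refine Eq.trans (b := n) hdim ?_
    exact (finrank_euclideanSpace_fin (𝕜 := ℝ) (n := n)).symm
  have _ : FiniteDimensional ℝ (TangentSpace J (Ψ (p, s))) :=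
    inferInstanceAs (FiniteDimensional ℝ E')
  have _ : FiniteDimensional ℝ (TangentSpace (𝓡 n) (F (Ψ (p, s))).1) :=
    inferInstanceAs (FiniteDimensional ℝ (EuclideanSpace ℝ (Fin n)))
  exact (LinearMap.injective_iff_surjective_of_finrank_eq_finrank
    (f := (mfderiv J (𝓡 n) (fun y ↦ (F y).1) (Ψ (p, s))).toLinearMap) h1).2 hsurj

/-- The horizontal part of the normal of a graph is a multiple of the velocity of the geodesics. -/
theorem normal_eq (hn : 1 ≤ n) (h : IsGraphParam g T f η a F N Ψ) (p : P) {s : ℝ} (hs : s ∈ T) :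
    fstT (F (Ψ (p, s))) (N (Ψ (p, s))) =
      (-deriv a s * sndT (F (Ψ (p, s))) (N (Ψ (p, s)))) •
        mfderiv 𝓘(ℝ, ℝ) (𝓡 n) (fun r ↦ (F (Ψ (p, r))).1) s (1 : ℝ) := by
  set N₁ := fstT (F (Ψ (p, s))) (N (Ψ (p, s))) with hN₁
  set γ' := mfderiv 𝓘(ℝ, ℝ) (𝓡 n) (fun r ↦ (F (Ψ (p, r))).1) s (1 : ℝ) with hγ'
  set θ := sndT (F (Ψ (p, s))) (N (Ψ (p, s))) with hθ
  have h1 : ∀ v : TangentSpace (𝓡 (n - 1)) p, g.inner (F (Ψ (p, s))).1 N₁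
      (mfderiv J (𝓡 n) (fun y ↦ (F y).1) (Ψ (p, s))
        (mfderiv (𝓡 (n - 1)) J (fun p ↦ Ψ (p, s)) p v)) = 0 := fun v ↦ by
    have := h.unitNormal.normal_prod (Ψ (p, s))
      (mfderiv (𝓡 (n - 1)) J (fun p ↦ Ψ (p, s)) p v)
    rwa [h.height_slice p v hs, mul_zero, add_zero] at this
  have h2 : g.inner (F (Ψ (p, s))).1 N₁ γ' = -deriv a s * θ := by
    have := h.unitNormal.normal_prod (Ψ (p, s)) (graphVelocity J Ψ p s)
    rw [h.height_velocity p hs, h.velocity_eq p hs] at this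
    linarith
  have hs1 := h.speed p hs
  rw [← h2]
  -- Let w be the difference of the two sides. It is orthogonal to γ', hence tangent to the slice by
  -- `decompose`, hence orthogonal to N₁ too; so ⟨w, w⟩ = 0.
  by_contra hne
  have h3 := g.pos (F (Ψ (p, s))).1 _ (sub_ne_zero.2 hne)
  obtain ⟨v, hv⟩ := h.decompose hn p hs (N₁ - g.inner (F (Ψ (p, s))).1 N₁ γ' • γ')
  have h4 : g.inner (F (Ψ (p, s))).1 γ' (N₁ - g.inner (F (Ψ (p, s))).1 N₁ γ' • γ') = 0 := by
    rw [map_sub, map_smul, smul_eq_mul, hs1, g.symm _ γ' N₁]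
    ring
  have h5 : g.inner (F (Ψ (p, s))).1 N₁ (N₁ - g.inner (F (Ψ (p, s))).1 N₁ γ' • γ') = 0 := by
    rw [hv, ← hγ', h4, zero_smul, add_zero, h1]
  rw [map_sub (g.inner (F (Ψ (p, s))).1), sub_apply, map_smul (g.inner (F (Ψ (p, s))).1),
    smul_apply, h4, h5] at h3
  simp at h3

/-- The unit length of N = (−a'θ γ', θ). The point p has disappeared, which is the source of
constancy along horizontal sections. -/
theorem angle_sq (hn : 1 ≤ n) (h : IsGraphParam g T f η a F N Ψ) (p : P) {s : ℝ} (hs : s ∈ T) :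
    sndT (F (Ψ (p, s))) (N (Ψ (p, s))) ^ 2 * (1 + deriv a s ^ 2) = 1 := by
  have h1 := h.unitNormal.unit_prod (Ψ (p, s))
  rw [h.normal_eq hn p hs, map_smul, map_smul, smul_apply, smul_eq_mul, smul_eq_mul,
    h.speed p hs] at h1
  linear_combination h1

theorem angle_ne_zero (hn : 1 ≤ n) (h : IsGraphParam g T f η a F N Ψ) (p : P) {s : ℝ}
    (hs : s ∈ T) : sndT (F (Ψ (p, s))) (N (Ψ (p, s))) ≠ 0 := by
  intro h0
  have := h.angle_sq hn p hs
  rw [h0] at this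
  norm_num at this

theorem gradHeight_eq [FiniteDimensional ℝ E'] (hdim : Module.finrank ℝ E' = n) (hn : 1 ≤ n)
    (h : IsGraphParam g T f η a F N Ψ) (p : P) {s : ℝ} (hs : s ∈ T) :
    gradHeight J g F (Ψ (p, s)) =
      (deriv a s * sndT (F (Ψ (p, s))) (N (Ψ (p, s))) ^ 2) • graphVelocity J Ψ p s := by
  refine (h.unitNormal.gradHeight_eq (h.injective_fst hdim hn p hs) (h.angle_ne_zero hn p hs) ?_).1
  rw [map_smul, h.velocity_eq p hs, h.normal_eq hn p hs, smul_smul]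
  congr 1
  ring

end IsGraphParam

end Graph

/-! ### The principal curvature of a graph along the height gradient. -/

section GraphCurvature

variable {n : ℕ} {M : Type*} [TopologicalSpace M] [ChartedSpace (EuclideanSpace ℝ (Fin n)) M]
  [IsManifold (𝓡 n) ∞ M]
  {g : ContMDiffRiemannianMetric (𝓡 n) ∞ (EuclideanSpace ℝ (Fin n))
      (fun x : M ↦ TangentSpace (𝓡 n) x)}
  {E' : Type*} [NormedAddCommGroup E'] [NormedSpace ℝ E']
  {H' : Type*} [TopologicalSpace H'] {J : ModelWithCorners ℝ E' H'}
  {S : Type*} [TopologicalSpace S] [ChartedSpace H' S]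
  {F : S → M × ℝ} {N : ∀ x : S, TangentSpace ((𝓡 n).prod 𝓘(ℝ, ℝ)) (F x)}
  {P : Type*} [TopologicalSpace P] [ChartedSpace (EuclideanSpace ℝ (Fin (n - 1))) P]
  {T : Set ℝ} {f : ℝ → P → M} {η : ∀ p : P, TangentSpace (𝓡 n) (f 0 p)} {a : ℝ → ℝ}
  {Ψ : PartialDiffeomorph ((𝓡 (n - 1)).prod 𝓘(ℝ, ℝ)) J (P × ℝ) S ∞}

namespace IsGraphParam

theorem hasDerivAt_angle (h : IsGraphParam g T f η a F N Ψ) (p : P) {s : ℝ} (hs : s ∈ T) :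
    HasDerivAt (fun r ↦ sndT (F (Ψ (p, r))) (N (Ψ (p, r))))
      (mvfderiv J (fun y ↦ sndT (F y) (N y)) (Ψ (p, s)) (graphVelocity J Ψ p s)) s := by
  have h1 := (h.unitNormal.contMDiff_angle (Ψ (p, s))).comp s
    (contMDiffAt_slice_right h.source p hs)
  have h2 := (mfderiv_comp_apply s (f := fun r ↦ Ψ (p, r))
    (h.unitNormal.contMDiff_angle.mdifferentiableAt (by simp))
    ((contMDiffAt_slice_right h.source p hs).mdifferentiableAt (by simp)) (1 : ℝ))
  have h3 : DifferentiableAt ℝ (fun r ↦ sndT (F (Ψ (p, r))) (N (Ψ (p, r)))) s :=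
    h1.contDiffAt.differentiableAt (by simp)
  refine h3.hasDerivAt.congr_deriv ?_
  exact mvfderiv_real_one.symm.trans h2

variable [IsManifold (𝓡 (n - 1)) ∞ P]

/-- Along the curve N₁ = ρ γ' with ρ = −a'θ and γ a geodesic, so ∇N₁ = ρ' γ'; the coefficient is
then simplified with the unit length of N. -/
theorem covDeriv_normal (hn : 1 ≤ n) (h : IsGraphParam g T f η a F N Ψ) (p : P) {s : ℝ}
    (hs : s ∈ T) :
    covDeriv J (metric g) (fun y ↦ (F y).1) (fun y ↦ fstT (F y) (N y)) (Ψ (p, s))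
        (graphVelocity J Ψ p s) =
      (mvfderiv J (fun y ↦ sndT (F y) (N y)) (Ψ (p, s)) (graphVelocity J Ψ p s) / deriv a s) •
        mfderiv 𝓘(ℝ, ℝ) (𝓡 n) (fun r ↦ (F (Ψ (p, r))).1) s (1 : ℝ) := by
  set θ : ℝ → ℝ := fun r ↦ sndT (F (Ψ (p, r))) (N (Ψ (p, r))) with hθ
  set θ' := mvfderiv J (fun y ↦ sndT (F y) (N y)) (Ψ (p, s)) (graphVelocity J Ψ p s) with hθ'
  have hd : HasDerivAt θ θ' s := h.hasDerivAt_angle p hs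
  have hT := h.parallel.isOpen.mem_nhds hs
  have ha : DifferentiableAt ℝ (deriv a) s :=
    (((h.smooth.contDiffAt hT).derivWithin (m := 1) (by norm_cast)).differentiableAt (by simp))
  set ρ : ℝ → ℝ := fun r ↦ -deriv a r * θ r with hρ
  have hdρ : HasDerivAt ρ (deriv ρ s) s :=
    (ha.neg.mul hd.differentiableAt).hasDerivAt
  -- Differentiating ρ² + θ² = 1 gives ρρ' = −θθ', that is a'θρ' = θθ', and θ cancels.
  have hρ' : deriv ρ s = θ' / deriv a s := by
    have h1 : HasDerivAt (fun r ↦ ρ r ^ 2 + θ r ^ 2) 0 s := by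
      refine (hasDerivAt_const s (1 : ℝ)).congr_of_eventuallyEq ?_
      filter_upwards [hT] with r hr
      have := h.angle_sq hn p hr
      simp only [hρ, hθ]
      linear_combination this
    have h2 := h1.unique ((hdρ.pow 2).add (hd.pow 2))
    simp only [hρ, Nat.cast_ofNat, Nat.add_one_sub_one, pow_one] at h2
    have h3 := h.angle_ne_zero hn p hs
    have h4 := (h.deriv_pos s hs).ne'
    rw [eq_div_iff h4]
    have h5 : θ s * (deriv ρ s * deriv a s - θ') = 0 := by
      linear_combination h2 / 2
    linarith [(mul_eq_zero.1 h5).resolve_left h3]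
  have hc := (contMDiffAt_slice_right h.source p hs).mdifferentiableAt (by simp)
  have hγ : ContMDiffAt 𝓘(ℝ, ℝ) (𝓡 n) ∞ (fun r ↦ (F (Ψ (p, r))).1) s :=
    ContMDiffAt.comp (g := fun y ↦ (F y).1) s (h.unitNormal.contMDiff_fst (Ψ (p, s)))
      (contMDiffAt_slice_right h.source p hs)
  obtain ⟨h5, h6⟩ := differentiableAt_toCoord_velocity hγ
  have h7 : DifferentiableAt ℝ
      (deriv (fun r ↦ extChartAt (𝓡 n) (F (Ψ (p, s))).1 (F (Ψ (p, r))).1)) s :=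
    (h6.derivWithin (m := 1) (by norm_cast)).differentiableAt (by simp)
  have h8 := covDeriv_smul g (J := 𝓘(ℝ, ℝ)) (F := fun r ↦ (F (Ψ (p, r))).1) (ρ := ρ)
    (V := fun r ↦ mfderiv 𝓘(ℝ, ℝ) (𝓡 n) (fun r ↦ (F (Ψ (p, r))).1) r (1 : ℝ))
    hdρ.differentiableAt.mdifferentiableAt
    (h7.congr_of_eventuallyEq h5).mdifferentiableAt (1 : ℝ)
  rw [h.geodesic p hs, smul_zero, add_zero] at h8
  have h9 := covDeriv_comp (h := metric g) hc
    (h.unitNormal.contMDiff_fst.mdifferentiableAt (by simp))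
    ((h.unitNormal.contMDiffAt_toCoord_fst (mem_chart_source _ _)).mdifferentiableAt (by simp))
    (1 : ℝ)
  refine h9.symm.trans ((covDeriv_congr ?_ _).trans (h8.trans ?_))
  · filter_upwards [hT] with r hr
    exact h.normal_eq hn p hr
  · rw [← hρ']
    exact congrArg (· • _) mvfderiv_real_one

/-- The derivative of N along ∂_s is (θ'/a')(γ', a'), and (γ', a') is the image of ∂_s, of which ∇ξ
is a nonzero multiple. -/
theorem hasPrincipalCurvature_iff [FiniteDimensional ℝ E'] (hdim : Module.finrank ℝ E' = n)
    (hn : 1 ≤ n) (h : IsGraphParam g T f η a F N Ψ) (p : P) {s : ℝ} (hs : s ∈ T) (κ : ℝ) :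
    HasPrincipalCurvature g F N (Ψ (p, s)) (gradHeight J g F (Ψ (p, s))) κ ↔
      κ = -(deriv (fun r ↦ sndT (F (Ψ (p, r))) (N (Ψ (p, r)))) s / deriv a s) := by
  have h4 := (h.deriv_pos s hs).ne'
  have h3 := h.angle_ne_zero hn p hs
  rw [h.unitNormal.hasPrincipalCurvature_iff, h.gradHeight_eq hdim hn p hs,
    (h.hasDerivAt_angle p hs).deriv, covDeriv_smul_direction, h.covDeriv_normal hn p hs, map_smul,
    map_smul, map_smul, h.velocity_eq p hs, h.height_velocity p hs]
  set c := deriv a s * sndT (F (Ψ (p, s))) (N (Ψ (p, s))) ^ 2 with hc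
  have hc0 : c ≠ 0 := mul_ne_zero h4 (pow_ne_zero 2 h3)
  constructor
  · rintro ⟨-, -, h5⟩
    simp only [smul_eq_mul] at h5
    field_simp
    have : c * (κ * deriv a s +
        mvfderiv J (fun y ↦ sndT (F y) (N y)) (Ψ (p, s)) (graphVelocity J Ψ p s)) = 0 := by
      linear_combination -h5
    linarith [(mul_eq_zero.1 this).resolve_left hc0]
  · rintro rfl
    refine ⟨smul_ne_zero hc0 fun h0 ↦ ?_, ?_, ?_⟩
    · have := h.height_velocity p hs
      rw [h0, map_zero] at this
      exact h4 this.symm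
    · rw [smul_smul, smul_smul, ← neg_smul]
      congr 1
      ring
    · simp only [smul_eq_mul]
      field_simp

theorem gradHeight_ne_zero [FiniteDimensional ℝ E'] (hdim : Module.finrank ℝ E' = n)
    (hn : 1 ≤ n) (h : IsGraphParam g T f η a F N Ψ) (p : P) {s : ℝ} (hs : s ∈ T) :
    gradHeight J g F (Ψ (p, s)) ≠ 0 :=
  ((h.hasPrincipalCurvature_iff hdim hn p hs _).2 rfl).1

end IsGraphParam

/-- A real function without zeros on a preconnected space has constant sign. -/
theorem mul_pos_of_ne_zero {X : Type*} [TopologicalSpace X] {φ : X → ℝ}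
    (hφ : Continuous φ) (h0 : ∀ x, φ x ≠ 0) (h : PreconnectedSpace X ∨ ∀ x, 0 < φ x) (x y : X) :
    0 < φ x * φ y := by
  rcases h with h | h
  · by_contra! hneg
    have hz : (0 : ℝ) ∈ range φ := by
      rcases mul_nonpos_iff.1 hneg with h1 | h1
      · exact mem_range_of_exists_le_of_exists_ge hφ ⟨y, h1.2⟩ ⟨x, h1.1⟩
      · exact mem_range_of_exists_le_of_exists_ge hφ ⟨x, h1.1⟩ ⟨y, h1.2⟩
    obtain ⟨z, hz⟩ := hz
    exact h0 z hz
  · exact mul_pos (h x) (h y)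

variable [IsManifold (𝓡 (n - 1)) ∞ P]

theorem IsGraphOn.conclusions [FiniteDimensional ℝ E'] (hdim : Module.finrank ℝ E' = n)
    (hn : 1 ≤ n) (hN : IsUnitNormal J (prodMetric g) F N)
    (hG : IsGraphOn J g T f η a F univ) :
    (∀ x, angle g F N x ≠ 0 ∧ gradHeight J g F x ≠ 0) ∧
    (∀ x, IsPrincipalDirection g F N x (gradHeight J g F x)) ∧
    ((PreconnectedSpace S ∨ ∀ x, 0 < angle g F N x) →
      ∀ x y, height F x = height F y →
        angle g F N x = angle g F N y ∧
        ∀ κ μ : ℝ,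
          HasPrincipalCurvature g F N x (gradHeight J g F x) κ →
          HasPrincipalCurvature g F N y (gradHeight J g F y) μ → κ = μ) := by
  obtain ⟨Ψ, hsrc, htgt, hF⟩ := hG.param
  have h : IsGraphParam g T f η a F N Ψ := ⟨hN, hG.parallel, hG.smooth, hG.deriv_pos, hsrc, hF⟩
  have hex : ∀ x, ∃ p, ∃ s ∈ T, Ψ (p, s) = x := by
    intro x
    have hx : x ∈ Ψ.target := by rw [htgt]; exact mem_univ x
    have h1 := Ψ.map_target hx
    rw [hsrc] at h1
    exact ⟨(Ψ.invFun x).1, (Ψ.invFun x).2, h1.2, Ψ.right_inv hx⟩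
  refine ⟨fun x ↦ ?_, fun x ↦ ?_, fun hsign x y hxy ↦ ?_⟩
  · obtain ⟨p, s, hs, rfl⟩ := hex x
    rw [angle_eq]
    exact ⟨h.angle_ne_zero hn p hs, h.gradHeight_ne_zero hdim hn p hs⟩
  · obtain ⟨p, s, hs, rfl⟩ := hex x
    exact ⟨_, (h.hasPrincipalCurvature_iff hdim hn p hs _).2 rfl⟩
  · obtain ⟨p, s, hs, rfl⟩ := hex x
    obtain ⟨q, t, ht, rfl⟩ := hex y
    -- Points of equal height have the same parameter s, since a is strictly increasing.
    have hmono : StrictMonoOn a T := by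
      refine strictMonoOn_of_deriv_pos hG.parallel.ordConnected.convex
        hG.smooth.continuousOn fun r hr ↦ ?_
      exact hG.deriv_pos r (interior_subset hr)
    rw [height, height, hF p s hs, hF q t ht] at hxy
    obtain rfl : s = t := hmono.injOn hs ht hxy
    simp only [angle_eq] at hsign
    have h0 : ∀ x, sndT (F x) (N x) ≠ 0 := fun x ↦ by
      obtain ⟨p, s, hs, rfl⟩ := hex x
      exact h.angle_ne_zero hn p hs
    -- The angles agree up to sign by `angle_sq`, and the sign is constant. Agreement is needed for
    -- all r, not only at s, because the curvature involves the derivative of θ in s.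
    have hθ : ∀ r ∈ T, sndT (F (Ψ (p, r))) (N (Ψ (p, r))) =
        sndT (F (Ψ (q, r))) (N (Ψ (q, r))) := by
      intro r hr
      have h1 := h.angle_sq hn p hr
      have h2 := h.angle_sq hn q hr
      have h3 := mul_pos_of_ne_zero hN.contMDiff_angle.continuous h0 hsign (Ψ (p, r)) (Ψ (q, r))
      have h4 : sndT (F (Ψ (p, r))) (N (Ψ (p, r))) ^ 2 =
          sndT (F (Ψ (q, r))) (N (Ψ (q, r))) ^ 2 := by
        have h5 : (1 + deriv a r ^ 2) ≠ 0 := by positivity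
        exact mul_right_cancel₀ h5 (h1.trans h2.symm)
      rcases sq_eq_sq_iff_eq_or_eq_neg.1 h4 with h5 | h5
      · exact h5
      · rw [h5] at h3
        nlinarith [mul_self_nonneg (sndT (F (Ψ (q, r))) (N (Ψ (q, r))))]
    refine ⟨by rw [angle_eq, angle_eq, hθ s hs], fun κ μ hκ hμ ↦ ?_⟩
    rw [h.hasPrincipalCurvature_iff hdim hn _ hs] at hκ hμ
    have h6 : (fun r ↦ sndT (F (Ψ (p, r))) (N (Ψ (p, r)))) =ᶠ[𝓝 s]
        fun r ↦ sndT (F (Ψ (q, r))) (N (Ψ (q, r))) := by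
      filter_upwards [hG.parallel.isOpen.mem_nhds hs] with r hr using hθ r hr
    rw [hκ, hμ, h6.deriv_eq]

end GraphCurvature

/-! ### Hypersurfaces with a principal height gradient -/

section Principal

variable {n : ℕ} {M : Type*} [TopologicalSpace M] [ChartedSpace (EuclideanSpace ℝ (Fin n)) M]
  [IsManifold (𝓡 n) ∞ M]
  {E' : Type*} [NormedAddCommGroup E'] [NormedSpace ℝ E']
  {H' : Type*} [TopologicalSpace H'] {J : ModelWithCorners ℝ E' H'}
  {S : Type*} [TopologicalSpace S] [ChartedSpace H' S]

/-- A hypersurface of `M × ℝ` whose angle function has no zeros, and such that the gradient of the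
height is a principal direction. -/
structure IsHeightPrincipal (J : ModelWithCorners ℝ E' H')
    (g : ContMDiffRiemannianMetric (𝓡 n) ∞ (EuclideanSpace ℝ (Fin n))
      (fun x : M ↦ TangentSpace (𝓡 n) x)) (F : S → M × ℝ)
    (N : ∀ x : S, TangentSpace ((𝓡 n).prod 𝓘(ℝ, ℝ)) (F x)) : Prop where
  finrank_eq : Module.finrank ℝ E' = n
  unitNormal : IsUnitNormal J (prodMetric g) F N
  injective : ∀ x, Function.Injective (mfderiv J ((𝓡 n).prod 𝓘(ℝ, ℝ)) F x)
  angle_ne_zero : ∀ x, sndT (F x) (N x) ≠ 0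
  principal : ∀ x, IsPrincipalDirection g F N x (gradHeight J g F x)

/-- The factor by which the gradient of the height is multiplied, in order that its projection to
`M` be of unit length. -/
def speedFactor (F : S → M × ℝ) (N : ∀ x : S, TangentSpace ((𝓡 n).prod 𝓘(ℝ, ℝ)) (F x))
    (x : S) : ℝ :=
  (√(sndT (F x) (N x) ^ 2 * (1 - sndT (F x) (N x) ^ 2)))⁻¹

namespace IsHeightPrincipal

variable {g : ContMDiffRiemannianMetric (𝓡 n) ∞ (EuclideanSpace ℝ (Fin n))
      (fun x : M ↦ TangentSpace (𝓡 n) x)}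
  {F : S → M × ℝ} {N : ∀ x : S, TangentSpace ((𝓡 n).prod 𝓘(ℝ, ℝ)) (F x)}

theorem injective_fst (h : IsHeightPrincipal J g F N) (x : S) :
    Function.Injective (mfderiv J (𝓡 n) (fun y ↦ (F y).1) x) :=
  h.unitNormal.fst_injective (h.injective x) (h.angle_ne_zero x)

variable [FiniteDimensional ℝ E']

theorem surjective_fst (h : IsHeightPrincipal J g F N) (x : S) :
    Function.Surjective (mfderiv J (𝓡 n) (fun y ↦ (F y).1) x) := by
  have h1 : Module.finrank ℝ (TangentSpace J x) =
      Module.finrank ℝ (TangentSpace (𝓡 n) (F x).1) := by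
    refine Eq.trans (b := n) h.finrank_eq ?_
    exact (finrank_euclideanSpace_fin (𝕜 := ℝ) (n := n)).symm
  have _ : FiniteDimensional ℝ (TangentSpace J x) := inferInstanceAs (FiniteDimensional ℝ E')
  have _ : FiniteDimensional ℝ (TangentSpace (𝓡 n) (F x).1) :=
    inferInstanceAs (FiniteDimensional ℝ (EuclideanSpace ℝ (Fin n)))
  exact (LinearMap.injective_iff_surjective_of_finrank_eq_finrank
    (f := (mfderiv J (𝓡 n) (fun y ↦ (F y).1) x).toLinearMap) h1).1 (h.injective_fst x)

/-- A vector with the required projection exists by surjectivity, and the characterization of the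
gradient identifies it with ∇ξ. -/
theorem gradHeight_spec (h : IsHeightPrincipal J g F N) (x : S) :
    mfderiv J (𝓡 n) (fun y ↦ (F y).1) x (gradHeight J g F x) =
        -sndT (F x) (N x) • fstT (F x) (N x) ∧
      mvfderiv J (height F) x (gradHeight J g F x) = 1 - sndT (F x) (N x) ^ 2 := by
  obtain ⟨z, hz⟩ := h.surjective_fst x (-sndT (F x) (N x) • fstT (F x) (N x))
  obtain ⟨h1, h2⟩ := h.unitNormal.gradHeight_eq (h.injective_fst x) (h.angle_ne_zero x) hz
  rw [h1]
  exact ⟨hz, h2⟩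

/-- The quantity is |N₁|². If N₁ vanished, ∇ξ would project to 0 and so be 0, but a principal
direction is nonzero. -/
theorem angle_sq_lt (h : IsHeightPrincipal J g F N) (x : S) : 0 < 1 - sndT (F x) (N x) ^ 2 := by
  obtain ⟨κ, hκ⟩ := h.principal x
  have hne : fstT (F x) (N x) ≠ 0 := by
    intro h0
    have h1 := (h.gradHeight_spec x).1
    rw [h0, smul_zero] at h1
    exact hκ.1 ((injective_iff_map_eq_zero _).1 (h.injective_fst x) _ h1)
  have h1 := g.pos _ _ hne
  have h2 := h.unitNormal.unit_prod x
  nlinarith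

theorem speedFactor_pos (h : IsHeightPrincipal J g F N) (x : S) : 0 < speedFactor F N x := by
  have := h.angle_sq_lt x
  have := h.angle_ne_zero x
  rw [speedFactor]
  positivity

theorem speedFactor_sq (h : IsHeightPrincipal J g F N) (x : S) :
    speedFactor F N x ^ 2 * (sndT (F x) (N x) ^ 2 * (1 - sndT (F x) (N x) ^ 2)) = 1 := by
  have := h.angle_sq_lt x
  have := h.angle_ne_zero x
  rw [speedFactor, inv_pow, Real.sq_sqrt (by positivity)]
  exact inv_mul_cancel₀ (by positivity)

theorem contMDiff_speedFactor (h : IsHeightPrincipal J g F N) :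
    ContMDiff J 𝓘(ℝ, ℝ) ∞ (speedFactor F N) := by
  intro x
  have hpos : 0 < sndT (F x) (N x) ^ 2 * (1 - sndT (F x) (N x) ^ 2) := by
    have := h.angle_sq_lt x
    have := h.angle_ne_zero x
    positivity
  have h1 : ContDiffAt ℝ ∞ (fun t : ℝ ↦ (√(t ^ 2 * (1 - t ^ 2)))⁻¹) (sndT (F x) (N x)) := by
    refine ContDiffAt.inv (ContDiffAt.sqrt (by fun_prop) hpos.ne') ?_
    exact (Real.sqrt_pos.2 hpos).ne'
  exact ContMDiffAt.comp (g := fun t : ℝ ↦ (√(t ^ 2 * (1 - t ^ 2)))⁻¹) x h1.contMDiffAt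
    (h.unitNormal.contMDiff_angle x)

section Curve

variable {c : ℝ → S} {T : Set ℝ}

theorem mfderiv_fst_curve (h : IsHeightPrincipal J g F N) {s : ℝ}
    (hc : MDifferentiableAt 𝓘(ℝ, ℝ) J c s)
    (hv : mfderiv 𝓘(ℝ, ℝ) J c s (1 : ℝ) = speedFactor F N (c s) • gradHeight J g F (c s)) :
    mfderiv 𝓘(ℝ, ℝ) (𝓡 n) (fun r ↦ (F (c r)).1) s (1 : ℝ) =
      (-speedFactor F N (c s) * sndT (F (c s)) (N (c s))) • fstT (F (c s)) (N (c s)) := by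
  have h1 := mfderiv_comp_apply (g := fun y ↦ (F y).1) s
    (h.unitNormal.contMDiff_fst.mdifferentiableAt (by simp)) hc (1 : ℝ)
  refine h1.trans ?_
  rw [hv, map_smul, (h.gradHeight_spec (c s)).1, smul_smul]
  congr 1
  ring

theorem hasDerivAt_height_curve (h : IsHeightPrincipal J g F N) {s : ℝ}
    (hc : ContMDiffAt 𝓘(ℝ, ℝ) J ∞ c s)
    (hv : mfderiv 𝓘(ℝ, ℝ) J c s (1 : ℝ) = speedFactor F N (c s) • gradHeight J g F (c s)) :
    HasDerivAt (fun r ↦ height F (c r))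
      (speedFactor F N (c s) * (1 - sndT (F (c s)) (N (c s)) ^ 2)) s := by
  have h1 := mfderiv_comp_apply (g := height F) s
    (h.unitNormal.contMDiff_height.mdifferentiableAt (by simp)) (hc.mdifferentiableAt (by simp))
    (1 : ℝ)
  have h2 : DifferentiableAt ℝ (fun r ↦ height F (c r)) s :=
    ((h.unitNormal.contMDiff_height (c s)).comp s hc).contDiffAt.differentiableAt (by simp)
  refine h2.hasDerivAt.congr_deriv (mvfderiv_real_one.symm.trans (h1.trans ?_))
  rw [hv, map_smul]
  exact congrArg (speedFactor F N (c s) * ·) (h.gradHeight_spec (c s)).2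

theorem speed_curve (h : IsHeightPrincipal J g F N) {s : ℝ}
    (hc : MDifferentiableAt 𝓘(ℝ, ℝ) J c s)
    (hv : mfderiv 𝓘(ℝ, ℝ) J c s (1 : ℝ) = speedFactor F N (c s) • gradHeight J g F (c s)) :
    g.inner (F (c s)).1 (mfderiv 𝓘(ℝ, ℝ) (𝓡 n) (fun r ↦ (F (c r)).1) s (1 : ℝ))
      (mfderiv 𝓘(ℝ, ℝ) (𝓡 n) (fun r ↦ (F (c r)).1) s (1 : ℝ)) = 1 := by
  rw [h.mfderiv_fst_curve hc hv, map_smul, map_smul, smul_apply, smul_eq_mul, smul_eq_mul]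
  have h1 := h.unitNormal.unit_prod (c s)
  have h2 := h.speedFactor_sq (c s)
  linear_combination h2 + speedFactor F N (c s) ^ 2 * sndT (F (c s)) (N (c s)) ^ 2 * h1

/-- The integral curves of the gradient of the height project to geodesics of `M`. -/
theorem isGeodesicOn (h : IsHeightPrincipal J g F N) (hT : IsOpen T)
    (hc : ∀ s ∈ T, ContMDiffAt 𝓘(ℝ, ℝ) J ∞ c s)
    (hv : ∀ s ∈ T,
      mfderiv 𝓘(ℝ, ℝ) J c s (1 : ℝ) = speedFactor F N (c s) • gradHeight J g F (c s)) :
    IsGeodesicOn (metric g) (fun s ↦ (F (c s)).1) T := by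
  have hγ : ∀ s ∈ T, ContMDiffAt 𝓘(ℝ, ℝ) (𝓡 n) ∞ (fun r ↦ (F (c r)).1) s := fun s hs ↦
    ContMDiffAt.comp (g := fun y ↦ (F y).1) s (h.unitNormal.contMDiff_fst (c s)) (hc s hs)
  refine ⟨fun s hs ↦ (hγ s hs).contMDiffWithinAt, fun s hs ↦ ?_⟩
  have hmd : MDifferentiableAt 𝓘(ℝ, ℝ) J c s := (hc s hs).mdifferentiableAt (by simp)
  set ρ : ℝ → ℝ := fun r ↦ -speedFactor F N (c r) * sndT (F (c r)) (N (c r)) with hρ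
  have hρd : MDifferentiableAt 𝓘(ℝ, ℝ) 𝓘(ℝ, ℝ) ρ s := by
    have h1 : ContMDiffAt J 𝓘(ℝ, ℝ) ∞ (fun x ↦ -speedFactor F N x * sndT (F x) (N x)) (c s) :=
      (h.contMDiff_speedFactor (c s)).neg.mul (h.unitNormal.contMDiff_angle (c s))
    exact (h1.comp s (hc s hs)).mdifferentiableAt (by simp)
  obtain ⟨κ, hκ⟩ := h.principal (c s)
  rw [h.unitNormal.hasPrincipalCurvature_iff, (h.gradHeight_spec (c s)).1] at hκ
  -- The only use of principality beyond ∇ξ ≠ 0: the derivative of N₁ along the curve is a multiple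
  -- of the projection of ∇ξ, hence of N₁.
  have hN1 : covDeriv J (metric g) (fun y ↦ (F y).1) (fun y ↦ fstT (F y) (N y)) (c s)
      (mfderiv 𝓘(ℝ, ℝ) J c s (1 : ℝ)) = (speedFactor F N (c s) * κ * sndT (F (c s)) (N (c s))) •
        fstT (F (c s)) (N (c s)) := by
    rw [hv s hs, covDeriv_smul_direction, neg_eq_iff_eq_neg.1 hκ.2.1, smul_smul, ← neg_smul,
      smul_smul]
    congr 1
    ring
  have hVd : MDifferentiableAt J 𝓘(ℝ, EuclideanSpace ℝ (Fin n))
      (fun y ↦ toCoord (𝓡 n) (F (c s)).1 (F y).1 (fstT (F y) (N y))) (c s) :=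
    (h.unitNormal.contMDiffAt_toCoord_fst (mem_chart_source _ _)).mdifferentiableAt (by simp)
  have h9 := covDeriv_comp (h := metric g) hmd
    (h.unitNormal.contMDiff_fst.mdifferentiableAt (by simp)) hVd (1 : ℝ)
  have h8 := covDeriv_smul g (J := 𝓘(ℝ, ℝ)) (F := fun r ↦ (F (c r)).1) (ρ := ρ)
    (V := fun r ↦ fstT (F (c r)) (N (c r))) hρd (hVd.comp s hmd) (1 : ℝ)
  have h10 : ∀ᶠ r in 𝓝 s, mfderiv 𝓘(ℝ, ℝ) (𝓡 n) (fun r ↦ (F (c r)).1) r (1 : ℝ) =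
      ρ r • fstT (F (c r)) (N (c r)) := by
    filter_upwards [hT.mem_nhds hs] with r hr
    exact h.mfderiv_fst_curve ((hc r hr).mdifferentiableAt (by simp)) (hv r hr)
  -- The velocity is ρN₁, so by the Leibniz rule the acceleration is a multiple τ of N₁. The value
  -- of τ is found from unit speed rather than by computation.
  have h11 : ∃ τ : ℝ, covDeriv 𝓘(ℝ, ℝ) (metric g) (fun r ↦ (F (c r)).1)
      (fun r ↦ mfderiv 𝓘(ℝ, ℝ) (𝓡 n) (fun r ↦ (F (c r)).1) r (1 : ℝ)) s (1 : ℝ) =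
        τ • fstT (F (c s)) (N (c s)) := by
    rw [h9, hN1, smul_smul, ← add_smul] at h8
    exact ⟨_, (covDeriv_congr h10 _).trans h8⟩
  obtain ⟨τ, hτ⟩ := h11
  obtain ⟨h5, h6⟩ := differentiableAt_toCoord_velocity (hγ s hs)
  have h7 : DifferentiableAt ℝ (deriv (fun r ↦ extChartAt (𝓡 n) (F (c s)).1 (F (c r)).1)) s :=
    (h6.derivWithin (m := 1) (by norm_cast)).differentiableAt (by simp)
  have h12 := hasDerivAt_inner_self g (γ := fun r ↦ (F (c r)).1)
    ((hγ s hs).mdifferentiableAt (by simp)) (h7.congr_of_eventuallyEq h5)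
  have h13 : HasDerivAt (fun r ↦ g.inner (F (c r)).1
      (mfderiv 𝓘(ℝ, ℝ) (𝓡 n) (fun r ↦ (F (c r)).1) r (1 : ℝ))
      (mfderiv 𝓘(ℝ, ℝ) (𝓡 n) (fun r ↦ (F (c r)).1) r (1 : ℝ))) 0 s := by
    refine (hasDerivAt_const s (1 : ℝ)).congr_of_eventuallyEq ?_
    filter_upwards [hT.mem_nhds hs] with r hr
    exact h.speed_curve ((hc r hr).mdifferentiableAt (by simp)) (hv r hr)
  -- Constant speed makes the acceleration τN₁ orthogonal to the velocity ρN₁; as ρ and |N₁|² are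
  -- nonzero, τ = 0.
  have h14 := h12.unique h13
  rw [hτ, h10.self_of_nhds, map_smul, map_smul, smul_apply, smul_eq_mul, smul_eq_mul] at h14
  have h15 : ρ s * g.inner (F (c s)).1 (fstT (F (c s)) (N (c s)))
      (fstT (F (c s)) (N (c s))) ≠ 0 := by
    have h16 := h.unitNormal.unit_prod (c s)
    have h17 := h.angle_sq_lt (c s)
    refine mul_ne_zero (mul_ne_zero (neg_ne_zero.2 (h.speedFactor_pos _).ne')
      (h.angle_ne_zero _)) ?_
    nlinarith
  have h16 : τ * (ρ s * g.inner (F (c s)).1 (fstT (F (c s)) (N (c s)))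
      (fstT (F (c s)) (N (c s)))) = 0 := by linear_combination h14 / 2
  rw [hτ, (mul_eq_zero.1 h16).resolve_right h15, zero_smul]

end Curve

end IsHeightPrincipal

end Principal

/-! ### The gradient of the height in a chart -/

theorem isInvertible_of_injective {E F : Type*} [NormedAddCommGroup E] [NormedSpace ℝ E]
    [FiniteDimensional ℝ E] [NormedAddCommGroup F] [NormedSpace ℝ F] [FiniteDimensional ℝ F]
    (hdim : Module.finrank ℝ E = Module.finrank ℝ F) (L : E →L[ℝ] F) (hL : Function.Injective L) :
    L.IsInvertible := by
  have hs : Function.Surjective (L : E →ₗ[ℝ] F) :=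
    (LinearMap.injective_iff_surjective_of_finrank_eq_finrank hdim).1 hL
  refine ⟨(LinearEquiv.ofBijective (L : E →ₗ[ℝ] F) ⟨hL, hs⟩).toContinuousLinearEquiv, ?_⟩
  ext v
  rfl

section ChartField

variable {E' : Type*} [NormedAddCommGroup E'] [NormedSpace ℝ E']
  {H' : Type*} [TopologicalSpace H'] {J : ModelWithCorners ℝ E' H'}
  {S : Type*} [TopologicalSpace S] [ChartedSpace H' S]

/-- The part of the chart around `x₀` which is mapped to the chart of `M` around `(F x₀).1`. -/
def chartDomain {M : Type*} [TopologicalSpace M] (n : ℕ)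
    [ChartedSpace (EuclideanSpace ℝ (Fin n)) M]
    (J : ModelWithCorners ℝ E' H') (F : S → M × ℝ) (x₀ : S) : Set E' :=
  (extChartAt J x₀).target ∩ (fun y ↦ (F ((extChartAt J x₀).symm y)).1) ⁻¹'
    (chartAt (EuclideanSpace ℝ (Fin n)) (F x₀).1).source

/-- The projection to `M` of the hypersurface, in charts. -/
def chartMap {M : Type*} [TopologicalSpace M] (n : ℕ)
    [ChartedSpace (EuclideanSpace ℝ (Fin n)) M]
    (J : ModelWithCorners ℝ E' H') (F : S → M × ℝ) (x₀ : S) (y : E') :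
    EuclideanSpace ℝ (Fin n) :=
  extChartAt (𝓡 n) (F x₀).1 (F ((extChartAt J x₀).symm y)).1

theorem mem_chartDomain {n : ℕ} {M : Type*} [TopologicalSpace M]
    [ChartedSpace (EuclideanSpace ℝ (Fin n)) M] (F : S → M × ℝ) (x₀ : S) :
    extChartAt J x₀ x₀ ∈ chartDomain n J F x₀ := by
  refine ⟨mem_extChartAt_target x₀, ?_⟩
  rw [mem_preimage, extChartAt_to_inv]
  exact mem_chart_source _ _

variable [J.Boundaryless]

theorem IsHeightPrincipal.isOpen_chartDomain {n : ℕ} {M : Type*} [TopologicalSpace M]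
    [ChartedSpace (EuclideanSpace ℝ (Fin n)) M] [IsManifold (𝓡 n) ∞ M]
    {g : ContMDiffRiemannianMetric (𝓡 n) ∞ (EuclideanSpace ℝ (Fin n))
      (fun x : M ↦ TangentSpace (𝓡 n) x)}
    {F : S → M × ℝ} {N : ∀ x : S, TangentSpace ((𝓡 n).prod 𝓘(ℝ, ℝ)) (F x)}
    (h : IsHeightPrincipal J g F N) (x₀ : S) :
    IsOpen (chartDomain n J F x₀) :=
  ContinuousOn.isOpen_inter_preimage
    (h.unitNormal.contMDiff_fst.continuous.comp_continuousOn (continuousOn_extChartAt_symm x₀))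
    (isOpen_extChartAt_target x₀) (chartAt _ _).open_source

variable [IsManifold J ∞ S]

theorem contMDiffAt_extChartAt_symm (x₀ : S) {y : E'} (hy : y ∈ (extChartAt J x₀).target) :
    ContMDiffAt 𝓘(ℝ, E') J ∞ (extChartAt J x₀).symm y :=
  (contMDiffOn_extChartAt_symm x₀).contMDiffAt ((isOpen_extChartAt_target x₀).mem_nhds hy)

theorem mfderiv_extChartAt_symm_injective (x₀ : S) {y : E'} (hy : y ∈ (extChartAt J x₀).target) :
    Function.Injective (mfderiv 𝓘(ℝ, E') J (extChartAt J x₀).symm y) := by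
  have hs : (extChartAt J x₀).symm y ∈ (chartAt H' x₀).source := by
    rw [← extChartAt_source J]; exact (extChartAt J x₀).map_target hy
  have h1 : (fun z ↦ extChartAt J x₀ ((extChartAt J x₀).symm z)) =ᶠ[𝓝 y] id := by
    filter_upwards [(isOpen_extChartAt_target x₀).mem_nhds hy] with z hz
    exact (extChartAt J x₀).right_inv hz
  have hd := (contMDiffAt_extChartAt_symm x₀ hy).mdifferentiableAt (by simp)
  have h2 : ∀ w : E', toCoord J x₀ ((extChartAt J x₀).symm y)
      (mfderiv 𝓘(ℝ, E') J (extChartAt J x₀).symm y w) = w := fun w ↦ by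
    refine (toCoord_mfderiv hd hs w).trans ?_
    exact congrArg (fun L : E' →L[ℝ] E' ↦ L w) (h1.mfderiv_eq.trans mfderiv_id)
  intro u v huv
  rw [← h2 u, ← h2 v, huv]

variable {n : ℕ} {M : Type*} [TopologicalSpace M] [ChartedSpace (EuclideanSpace ℝ (Fin n)) M]

variable [IsManifold (𝓡 n) ∞ M]
  {g : ContMDiffRiemannianMetric (𝓡 n) ∞ (EuclideanSpace ℝ (Fin n))
      (fun x : M ↦ TangentSpace (𝓡 n) x)}
  {F : S → M × ℝ} {N : ∀ x : S, TangentSpace ((𝓡 n).prod 𝓘(ℝ, ℝ)) (F x)}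

namespace IsHeightPrincipal

theorem contMDiffAt_fst_symm (h : IsHeightPrincipal J g F N) (x₀ : S) {y : E'}
    (hy : y ∈ (extChartAt J x₀).target) :
    ContMDiffAt 𝓘(ℝ, E') (𝓡 n) ∞ (fun y ↦ (F ((extChartAt J x₀).symm y)).1) y :=
  ContMDiffAt.comp (g := fun x ↦ (F x).1) y (h.unitNormal.contMDiff_fst _)
    (contMDiffAt_extChartAt_symm x₀ hy)

theorem contDiffOn_chartMap (h : IsHeightPrincipal J g F N) (x₀ : S) :
    ContDiffOn ℝ ∞ (chartMap n J F x₀) (chartDomain n J F x₀) := by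
  intro y hy
  have h1 : ContMDiffAt 𝓘(ℝ, E') 𝓘(ℝ, EuclideanSpace ℝ (Fin n)) ∞ (chartMap n J F x₀) y :=
    ContMDiffAt.comp (g := extChartAt (𝓡 n) (F x₀).1) y (contMDiffAt_extChartAt' hy.2)
      (h.contMDiffAt_fst_symm x₀ hy.1)
  exact h1.contDiffAt.contDiffWithinAt

theorem fderiv_chartMap (h : IsHeightPrincipal J g F N) (x₀ : S) {y : E'}
    (hy : y ∈ chartDomain n J F x₀) (w : E') :
    fderiv ℝ (chartMap n J F x₀) y w =
      toCoord (𝓡 n) (F x₀).1 (F ((extChartAt J x₀).symm y)).1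
        (mfderiv J (𝓡 n) (fun x ↦ (F x).1) ((extChartAt J x₀).symm y)
          (mfderiv 𝓘(ℝ, E') J (extChartAt J x₀).symm y w)) := by
  have h1 := mfderiv_comp_apply (g := fun x ↦ (F x).1) y
    (h.unitNormal.contMDiff_fst.mdifferentiableAt (by simp))
    ((contMDiffAt_extChartAt_symm x₀ hy.1).mdifferentiableAt (by simp)) w
  have h2 := toCoord_mfderiv (F := fun y ↦ (F ((extChartAt J x₀).symm y)).1)
    ((h.contMDiffAt_fst_symm x₀ hy.1).mdifferentiableAt (by simp)) hy.2 w
  have h3 : mvfderiv 𝓘(ℝ, E') (chartMap n J F x₀) y w = fderiv ℝ (chartMap n J F x₀) y w :=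
    congrArg (fun L : E' →L[ℝ] EuclideanSpace ℝ (Fin n) ↦ L w) mfderiv_eq_fderiv
  refine h3.symm.trans (h2.symm.trans ?_)
  exact congrArg _ h1

variable [FiniteDimensional ℝ E']

theorem isInvertible_fderiv_chartMap (h : IsHeightPrincipal J g F N) (x₀ : S) {y : E'}
    (hy : y ∈ chartDomain n J F x₀) : (fderiv ℝ (chartMap n J F x₀) y).IsInvertible := by
  refine isInvertible_of_injective (h.finrank_eq.trans finrank_euclideanSpace_fin.symm) _
    fun u v huv ↦ ?_
  rw [h.fderiv_chartMap x₀ hy, h.fderiv_chartMap x₀ hy] at huv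
  exact mfderiv_extChartAt_symm_injective x₀ hy.1 (h.injective_fst _
    ((isInvertible_toCoord hy.2).injective huv))

/-- The gradient is defined by choice, so its smoothness must come from a formula: it is the
preimage of −θN₁ under the differential of the projection to M, and inversion of operators is
smooth. -/
theorem exists_contDiffOn_field (h : IsHeightPrincipal J g F N) (x₀ : S) :
    ∃ v : E' → E', ContDiffOn ℝ ∞ v (chartDomain n J F x₀) ∧ ∀ y ∈ chartDomain n J F x₀,
      mfderiv 𝓘(ℝ, E') J (extChartAt J x₀).symm y (v y) =
        speedFactor F N ((extChartAt J x₀).symm y) •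
          gradHeight J g F ((extChartAt J x₀).symm y) := by
  let φ := extChartAt J x₀
  let θ : E' → ℝ := fun y ↦ sndT (F (φ.symm y)) (N (φ.symm y))
  let ν : E' → EuclideanSpace ℝ (Fin n) := fun y ↦
    toCoord (𝓡 n) (F x₀).1 (F (φ.symm y)).1 (fstT (F (φ.symm y)) (N (φ.symm y)))
  refine ⟨fun y ↦ speedFactor F N (φ.symm y) • (fderiv ℝ (chartMap n J F x₀) y).inverse
    (-θ y • ν y), fun y hy ↦ ?_, fun y hy ↦ ?_⟩
  · have hsymm := contMDiffAt_extChartAt_symm x₀ hy.1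
    have h1 : ContDiffAt ℝ ∞ (fun y ↦ speedFactor F N (φ.symm y)) y :=
      ((h.contMDiff_speedFactor (φ.symm y)).comp y hsymm).contDiffAt
    have h2 : ContDiffAt ℝ ∞ θ y :=
      ((h.unitNormal.contMDiff_angle (φ.symm y)).comp y hsymm).contDiffAt
    have h3 : ContDiffAt ℝ ∞ ν y :=
      ((h.unitNormal.contMDiffAt_toCoord_fst hy.2).comp y hsymm).contDiffAt
    have h4 : ContDiffAt ℝ ∞ (fderiv ℝ (chartMap n J F x₀)) y :=
      ((h.contDiffOn_chartMap x₀).contDiffAt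
        ((h.isOpen_chartDomain x₀).mem_nhds hy)).fderiv_right (m := ∞) (by simp)
    obtain ⟨e, he⟩ := h.isInvertible_fderiv_chartMap x₀ hy
    have h5 : ContDiffAt ℝ ∞ (fun y ↦ (fderiv ℝ (chartMap n J F x₀) y).inverse) y := by
      refine ContDiffAt.comp y (g := ContinuousLinearMap.inverse) ?_ h4
      rw [← he]
      exact contDiffAt_map_inverse e
    exact (h1.smul (h5.clm_apply (h2.neg.smul h3))).contDiffWithinAt
  · refine h.injective_fst _ ((isInvertible_toCoord hy.2).injective ?_)
    rw [← h.fderiv_chartMap x₀ hy, map_smul,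
      (h.isInvertible_fderiv_chartMap x₀ hy).self_apply_inverse, map_smul,
      (h.gradHeight_spec _).1, map_smul, map_smul]

end IsHeightPrincipal

end ChartField

/-! ### Flowing a level set along a transverse vector field -/

section Straighten

variable {k : ℕ} {E : Type*} [NormedAddCommGroup E] [NormedSpace ℝ E] [FiniteDimensional ℝ E]

/-- The space is the direct sum of the kernel of ℓ, of dimension k, and the line of u. -/
theorem exists_equiv_prod_of_apply_ne_zero (hk : Module.finrank ℝ E = k + 1) (ℓ : E →L[ℝ] ℝ) {u : E}
    (hu : ℓ u ≠ 0) :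
    ∃ A : (EuclideanSpace ℝ (Fin k) × ℝ) ≃L[ℝ] E, (∀ p, ℓ (A (p, 0)) = 0) ∧ A (0, 1) = u := by
  let ℓ' : E →ₗ[ℝ] ℝ := ℓ
  have hrange : LinearMap.range ℓ' = ⊤ := by
    refine LinearMap.range_eq_top.2 (LinearMap.surjective fun h ↦ hu ?_)
    exact congrArg (fun L : E →ₗ[ℝ] ℝ ↦ L u) h
  have hker : Module.finrank ℝ (LinearMap.ker ℓ') = k := by
    have h1 := ℓ'.finrank_range_add_finrank_ker
    rw [hrange, finrank_top, Module.finrank_self] at h1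
    omega
  let B : EuclideanSpace ℝ (Fin k) ≃ₗ[ℝ] LinearMap.ker ℓ' :=
    LinearEquiv.ofFinrankEq _ _ (finrank_euclideanSpace_fin.trans hker.symm)
  let L : EuclideanSpace ℝ (Fin k) →L[ℝ] E :=
    ((LinearMap.ker ℓ').subtype ∘ₗ B.toLinearMap).toContinuousLinearMap
  have hL : ∀ p, ℓ (L p) = 0 := fun p ↦ (B p).2
  have hLinj : Function.Injective L := fun p q h ↦ B.injective (Subtype.ext h)
  let K : EuclideanSpace ℝ (Fin k) × ℝ →L[ℝ] E :=
    L.coprod (ContinuousLinearMap.toSpanSingleton ℝ u)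
  have hK : ∀ p r, K (p, r) = L p + r • u := fun p r ↦ by simp [K]
  have hinj : Function.Injective K := by
    rw [injective_iff_map_eq_zero]
    rintro ⟨p, r⟩ hq
    rw [hK] at hq
    have h1 := congrArg ℓ hq
    rw [map_add, hL, map_smul, map_zero, smul_eq_mul, zero_add] at h1
    have hr := (mul_eq_zero.1 h1).resolve_right hu
    rw [hr, zero_smul, add_zero] at hq
    exact Prod.ext ((injective_iff_map_eq_zero L).1 hLinj _ hq) hr
  obtain ⟨A, hA⟩ := isInvertible_of_injective (by simp [hk]) K hinj
  have hA' : ∀ q, A q = K q := fun q ↦ congrArg (fun L : _ →L[ℝ] E ↦ L q) hA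
  refine ⟨A, fun p ↦ ?_, ?_⟩
  · rw [hA', hK, zero_smul, add_zero, hL]
  · rw [hA', hK, map_zero, one_smul, zero_add]

theorem hasFDerivAt_of_partial {E₁ E : Type*} [NormedAddCommGroup E₁] [NormedSpace ℝ E₁]
    [NormedAddCommGroup E] [NormedSpace ℝ E] {Ξ : E₁ × ℝ → E} {A : E₁ × ℝ →L[ℝ] E} {p : E₁} {s : ℝ}
    (hΞ : DifferentiableAt ℝ Ξ (p, s))
    (h₁ : HasFDerivAt (fun p ↦ Ξ (p, s)) (A.comp (.inl ℝ _ _)) p)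
    (h₂ : HasDerivAt (fun r ↦ Ξ (p, r)) (A (0, 1)) s) : HasFDerivAt Ξ A (p, s) := by
  have hD := hΞ.hasFDerivAt
  have h3 : HasFDerivAt (fun p ↦ Ξ (p, s)) ((fderiv ℝ Ξ (p, s)).comp (.inl ℝ _ _)) p :=
    HasFDerivAt.comp (g := Ξ) p hD (hasFDerivAt_prodMk_left p s)
  have h4 : HasDerivAt (fun r ↦ Ξ (p, r)) (fderiv ℝ Ξ (p, s) (0, 1)) s :=
    HasFDerivAt.comp_hasDerivAt (l := Ξ) s hD ((hasDerivAt_const s p).prodMk (hasDerivAt_id s))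
  refine hD.congr_fderiv (ContinuousLinearMap.prod_ext (h3.unique h₁) ?_)
  ext
  exact h4.unique h₂

/-- A level hypersurface of `ζ`, moved by the flow of a field `v` transverse to it. -/
theorem exists_flow_of_level (hk : Module.finrank ℝ E = k + 1) {U : Set E} (hU : IsOpen U)
    {v : E → E} (hv : ContDiffOn ℝ ∞ v U) {ζ : E → ℝ} (hζ : ContDiffOn ℝ ∞ ζ U) {y₀ : E}
    (hy₀ : y₀ ∈ U) (htr : fderiv ℝ ζ y₀ (v y₀) ≠ 0) :
    ∃ (Ξ : EuclideanSpace ℝ (Fin k) × ℝ → E) (A : (EuclideanSpace ℝ (Fin k) × ℝ) ≃L[ℝ] E),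
      ∃ ε > 0, ContDiffOn ℝ ∞ Ξ (Metric.ball 0 ε ×ˢ Ioo (-ε) ε) ∧ Ξ (0, 0) = y₀ ∧
        HasFDerivAt Ξ (A : EuclideanSpace ℝ (Fin k) × ℝ →L[ℝ] E) (0, 0) ∧
        (∀ p ∈ Metric.ball (0 : EuclideanSpace ℝ (Fin k)) ε, ∀ s ∈ Ioo (-ε) ε,
          Ξ (p, s) ∈ U ∧ HasDerivAt (fun r ↦ Ξ (p, r)) (v (Ξ (p, s))) s) ∧
        ∀ p ∈ Metric.ball (0 : EuclideanSpace ℝ (Fin k)) ε, ζ (Ξ (p, 0)) = ζ y₀ := by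
  obtain ⟨A, hA0, hA1⟩ := exists_equiv_prod_of_apply_ne_zero hk (fderiv ℝ ζ y₀) htr
  set ℓ := fderiv ℝ ζ y₀ with hℓ
  have hζd : HasFDerivAt ζ ℓ y₀ :=
    ((hζ.contDiffAt (hU.mem_nhds hy₀)).differentiableAt (by simp)).hasFDerivAt
  -- Coordinates in which the level of ζ is the slice of zero second coordinate. The factor (ℓ(v
  -- y₀))⁻¹ is chosen so that the differential at y₀ is exactly A⁻¹.
  let Θ : E → EuclideanSpace ℝ (Fin k) × ℝ := fun y ↦
    ((A.symm (y - y₀)).1, (ℓ (v y₀))⁻¹ * (ζ y - ζ y₀))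
  have hΘ : ContDiffOn ℝ ∞ Θ U := by
    refine ContDiffOn.prodMk ?_ (contDiffOn_const.mul (hζ.sub contDiffOn_const))
    exact ((contDiff_fst.comp A.symm.contDiff).comp
      (contDiff_id.sub contDiff_const)).contDiffOn
  have hΘd : HasFDerivAt Θ (A.symm : E →L[ℝ] EuclideanSpace ℝ (Fin k) × ℝ) y₀ := by
    have h1 : HasFDerivAt (fun y ↦ (A.symm (y - y₀)).1)
        ((ContinuousLinearMap.fst ℝ _ _).comp
          (A.symm : E →L[ℝ] EuclideanSpace ℝ (Fin k) × ℝ)) y₀ :=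
      ((ContinuousLinearMap.fst ℝ _ _).comp
          (A.symm : E →L[ℝ] EuclideanSpace ℝ (Fin k) × ℝ)).hasFDerivAt.comp y₀
        ((hasFDerivAt_id y₀).sub_const y₀)
    have h2 := h1.prodMk ((hζd.sub_const (ζ y₀)).const_mul (ℓ (v y₀))⁻¹)
    refine h2.congr_fderiv ?_
    ext w : 1
    obtain ⟨⟨p, r⟩, rfl⟩ := A.surjective w
    have h3 : A (p, r) = A (p, 0) + r • A (0, 1) := by
      rw [← map_smul, ← map_add]; simp
    refine Prod.ext rfl ?_
    have h4 : ℓ (A (p, r)) = r * ℓ (v y₀) := by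
      rw [h3, map_add, hA0, map_smul, hA1, zero_add, smul_eq_mul]
    simp only [ContinuousLinearMap.prod_apply, smul_apply, smul_eq_mul, h4,
      ContinuousLinearEquiv.coe_coe, ContinuousLinearEquiv.symm_apply_apply]
    field_simp
  obtain ⟨e, hye, heU, heq, hes⟩ :=
    exists_openPartialHomeomorph_contDiffOn_symm hU hΘ hy₀ A.symm hΘd
  have hey : e y₀ = (0, 0) := by rw [heq]; simp [Θ]
  have h0t : ((0, 0) : EuclideanSpace ℝ (Fin k) × ℝ) ∈ e.target := hey ▸ e.map_source hye
  have hs0 : e.symm (0, 0) = y₀ := by rw [← hey, e.left_inv hye]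
  have hed : HasFDerivAt e (A.symm : E →L[ℝ] EuclideanSpace ℝ (Fin k) × ℝ) (e.symm (0, 0)) := by
    rw [hs0]
    exact hΘd.congr_of_eventuallyEq (Filter.Eventually.of_forall heq)
  have hesd := e.hasFDerivAt_symm h0t hed
  obtain ⟨Φ, δ, hδ, hΦ, hΦ0, hΦd⟩ := exists_contDiffOn_flow_of_contDiffOn hU hv hy₀
  have hι : Continuous fun p : EuclideanSpace ℝ (Fin k) ↦ (p, (0 : ℝ)) := by fun_prop
  have hnear : ∀ᶠ p : EuclideanSpace ℝ (Fin k) in 𝓝 0, (p, (0 : ℝ)) ∈ e.target ∧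
      e.symm (p, 0) ∈ Metric.ball y₀ δ := by
    have h1 : ∀ᶠ q in 𝓝 ((0, 0) : EuclideanSpace ℝ (Fin k) × ℝ), q ∈ e.target ∧
        e.symm q ∈ Metric.ball y₀ δ :=
      Filter.Eventually.and (e.open_target.mem_nhds h0t) ((e.continuousAt_symm h0t).eventually
        (by rw [hs0]; exact Metric.ball_mem_nhds _ hδ))
    exact hι.continuousAt.eventually h1
  obtain ⟨ε', hε', hball⟩ := Metric.eventually_nhds_iff_ball.1 hnear
  set ε := min ε' δ with hε
  have hεpos : 0 < ε := lt_min hε' hδ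
  have hb : ∀ p ∈ Metric.ball (0 : EuclideanSpace ℝ (Fin k)) ε, (p, (0 : ℝ)) ∈ e.target ∧
      e.symm (p, 0) ∈ Metric.ball y₀ δ := fun p hp ↦
    hball p (Metric.ball_subset_ball (min_le_left _ _) hp)
  have hi : ∀ s ∈ Ioo (-ε) ε, s ∈ Ioo (-δ) δ := fun s hs ↦
    ⟨(neg_le_neg (min_le_right _ _)).trans_lt hs.1, hs.2.trans_le (min_le_right _ _)⟩
  -- Start on the level set and follow the flow. At the origin the partial derivatives are A on the
  -- kernel and v y₀ = A(0, 1), so the total derivative is A.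
  let Ξ : EuclideanSpace ℝ (Fin k) × ℝ → E := fun q ↦ Φ (q.2, e.symm (q.1, 0))
  have hΞ : ContDiffOn ℝ ∞ Ξ (Metric.ball 0 ε ×ˢ Ioo (-ε) ε) := by
    refine hΦ.comp (t := Ioo (-δ) δ ×ˢ Metric.ball y₀ δ) (ContDiffOn.prodMk contDiffOn_snd ?_)
      fun q hq ↦ ⟨hi _ hq.2, (hb _ hq.1).2⟩
    exact hes.comp (contDiffOn_fst.prodMk contDiffOn_const) fun q hq ↦ (hb _ hq.1).1
  have h0b : (0 : EuclideanSpace ℝ (Fin k)) ∈ Metric.ball (0 : EuclideanSpace ℝ (Fin k)) ε :=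
    Metric.mem_ball_self hεpos
  have h0i : (0 : ℝ) ∈ Ioo (-ε) ε := ⟨neg_lt_zero.2 hεpos, hεpos⟩
  have hΞ0 : ∀ p ∈ Metric.ball (0 : EuclideanSpace ℝ (Fin k)) ε, Ξ (p, 0) = e.symm (p, 0) :=
    fun p hp ↦ hΦ0 _ (hb p hp).2
  have hΞ00 : Ξ (0, 0) = y₀ := (hΞ0 0 h0b).trans hs0
  have hΞs : ∀ p ∈ Metric.ball (0 : EuclideanSpace ℝ (Fin k)) ε, ∀ s ∈ Ioo (-ε) ε,
      Ξ (p, s) ∈ U ∧ HasDerivAt (fun r ↦ Ξ (p, r)) (v (Ξ (p, s))) s := fun p hp s hs ↦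
    hΦd s (hi s hs) _ (hb p hp).2
  refine ⟨Ξ, A, ε, hεpos, hΞ, hΞ00, ?_, hΞs, fun p hp ↦ ?_⟩
  · have hmem : ((0, 0) : EuclideanSpace ℝ (Fin k) × ℝ) ∈ Metric.ball 0 ε ×ˢ Ioo (-ε) ε :=
      ⟨h0b, h0i⟩
    refine hasFDerivAt_of_partial ((hΞ.contDiffAt ((Metric.isOpen_ball.prod isOpen_Ioo).mem_nhds
      hmem)).differentiableAt (by simp)) ?_ ?_
    · have h3 : HasFDerivAt (fun p : EuclideanSpace ℝ (Fin k) ↦ e.symm (p, 0))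
          ((A : EuclideanSpace ℝ (Fin k) × ℝ →L[ℝ] E).comp (.inl ℝ _ _)) 0 :=
        HasFDerivAt.comp (g := e.symm) 0 hesd (hasFDerivAt_prodMk_left 0 0)
      refine h3.congr_of_eventuallyEq ?_
      filter_upwards [Metric.ball_mem_nhds 0 hεpos] with p hp using hΞ0 p hp
    · have h4 := (hΞs 0 h0b 0 h0i).2
      rw [hΞ00, ← hA1] at h4
      exact h4
  · have h1 : e (e.symm (p, 0)) = (p, 0) := e.right_inv (hb p hp).1
    rw [heq] at h1
    have h2 := congrArg Prod.snd h1
    have h3 := (mul_eq_zero.1 h2).resolve_left (inv_ne_zero htr)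
    rw [hΞ0 p hp]
    linarith

end Straighten

/-! ### Parametrizations by a product `ℝᵏ × (-ε, ε)` -/

section Box

variable {k : ℕ} {E : Type*} [NormedAddCommGroup E] [NormedSpace ℝ E]
  {H : Type*} [TopologicalSpace H] {J : ModelWithCorners ℝ E H}
  {S : Type*} [TopologicalSpace S] [ChartedSpace H S] [IsManifold J ∞ S]

/-- Reparametrizing the ball by all of ℝᵏ through `univBall` lets the parameter manifold be ℝᵏ
itself instead of an open subset. -/
theorem exists_partialDiffeomorph_of_box (x₀ : S)
    (e : OpenPartialHomeomorph (EuclideanSpace ℝ (Fin k) × ℝ) E)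
    {ε : ℝ} (hε : 0 < ε) (he : ContDiffOn ℝ ∞ e (Metric.ball 0 ε ×ˢ Ioo (-ε) ε))
    (hes : ContDiffOn ℝ ∞ e.symm e.target)
    (hbox : Metric.ball 0 ε ×ˢ Ioo (-ε) ε ⊆ e.source)
    (hmap : ∀ q ∈ Metric.ball (0 : EuclideanSpace ℝ (Fin k)) ε ×ˢ Ioo (-ε) ε,
      e q ∈ (extChartAt J x₀).target) :
    ∃ Ψ : PartialDiffeomorph ((𝓡 k).prod 𝓘(ℝ, ℝ)) J (EuclideanSpace ℝ (Fin k) × ℝ) S ∞,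
      Ψ.source = univ ×ˢ Ioo (-ε) ε ∧ ∀ q, Ψ q =
        (extChartAt J x₀).symm (e (OpenPartialHomeomorph.univBall 0 ε q.1, q.2)) := by
  set φ := extChartAt J x₀ with hφ
  set u := OpenPartialHomeomorph.univBall (0 : EuclideanSpace ℝ (Fin k)) ε with hu
  have husrc : u.source = univ := OpenPartialHomeomorph.univBall_source _ _
  have hutgt : u.target = Metric.ball 0 ε := OpenPartialHomeomorph.univBall_target _ hε
  have hum : ∀ p, u p ∈ Metric.ball 0 ε := fun p ↦ by
    rw [← hutgt]; exact u.map_source (by rw [husrc]; exact mem_univ p)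
  have hin : ∀ q ∈ (univ : Set (EuclideanSpace ℝ (Fin k))) ×ˢ Ioo (-ε) ε,
      (u q.1, q.2) ∈ Metric.ball 0 ε ×ˢ Ioo (-ε) ε := fun q hq ↦ ⟨hum _, hq.2⟩
  set W : Set E := e.target ∩ e.symm ⁻¹' (Metric.ball 0 ε ×ˢ Ioo (-ε) ε) with hW
  have hWo : IsOpen W := e.isOpen_inter_preimage_symm (Metric.isOpen_ball.prod isOpen_Ioo)
  let R : Set S := φ.source ∩ φ ⁻¹' W
  have hRo : IsOpen R :=
    (continuousOn_extChartAt x₀).isOpen_inter_preimage (isOpen_extChartAt_source x₀) hWo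
  refine ⟨{
    toFun := fun q ↦ φ.symm (e (u q.1, q.2))
    invFun := fun x ↦ (u.symm (e.symm (φ x)).1, (e.symm (φ x)).2)
    source := univ ×ˢ Ioo (-ε) ε
    target := R
    map_source' := fun q hq ↦ ?_
    map_target' := fun x hx ↦ ⟨mem_univ _, hx.2.2.2⟩
    left_inv' := fun q hq ↦ ?_
    right_inv' := fun x hx ↦ ?_
    open_source := isOpen_univ.prod isOpen_Ioo
    open_target := hRo
    contMDiffOn_toFun := ?_
    contMDiffOn_invFun := ?_ }, rfl, fun q ↦ rfl⟩
  · have h1 := hmap _ (hin q hq)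
    refine ⟨φ.map_target h1, ?_⟩
    rw [mem_preimage, φ.right_inv h1]
    refine ⟨e.map_source (hbox (hin q hq)), ?_⟩
    rw [mem_preimage, e.left_inv (hbox (hin q hq))]
    exact hin q hq
  · rw [φ.right_inv (hmap _ (hin q hq)), e.left_inv (hbox (hin q hq))]
    exact Prod.ext (u.left_inv (by rw [husrc]; exact mem_univ _)) rfl
  · have h1 : u (u.symm (e.symm (φ x)).1) = (e.symm (φ x)).1 :=
      u.right_inv (by rw [hutgt]; exact hx.2.2.1)
    change φ.symm (e (u (u.symm (e.symm (φ x)).1), (e.symm (φ x)).2)) = x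
    rw [h1, Prod.mk.eta, e.right_inv hx.2.1, φ.left_inv hx.1]
  · have h1 : ContMDiff ((𝓡 k).prod 𝓘(ℝ, ℝ)) 𝓘(ℝ, EuclideanSpace ℝ (Fin k) × ℝ) ∞
        (fun q : EuclideanSpace ℝ (Fin k) × ℝ ↦ (u q.1, q.2)) :=
      (OpenPartialHomeomorph.contDiff_univBall.contMDiff.comp contMDiff_fst).prodMk_space
        contMDiff_snd
    exact ((contMDiffOn_extChartAt_symm x₀).comp he.contMDiffOn hmap).comp h1.contMDiffOn hin
  · have h1 : ContMDiffOn J 𝓘(ℝ, EuclideanSpace ℝ (Fin k) × ℝ) ∞ (fun x ↦ e.symm (φ x)) R :=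
      hes.contMDiffOn.comp ((contMDiffOn_extChartAt (x := x₀)).mono fun x hx ↦ by
        rw [← extChartAt_source J]; exact hx.1) fun x hx ↦ hx.2.1
    have h2 : ContMDiffOn J (𝓡 k) ∞ (fun x ↦ u.symm (e.symm (φ x)).1) R :=
      OpenPartialHomeomorph.contDiffOn_univBall_symm.contMDiffOn.comp
        (contDiff_fst.contMDiff.comp_contMDiffOn h1) fun x hx ↦ hx.2.2.1
    exact h2.prodMk (contDiff_snd.contMDiff.comp_contMDiffOn h1)

end Box

/-! ### Hypersurfaces parametrized by the integral curves of the gradient of the height -/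

theorem contMDiffAt_of_toCoord {E : Type*} [NormedAddCommGroup E] [NormedSpace ℝ E]
    {H : Type*} [TopologicalSpace H] {I : ModelWithCorners ℝ E H}
    {X : Type*} [TopologicalSpace X] [ChartedSpace H X] [IsManifold I ∞ X]
    {E' : Type*} [NormedAddCommGroup E'] [NormedSpace ℝ E']
    {H' : Type*} [TopologicalSpace H'] {J : ModelWithCorners ℝ E' H'}
    {S : Type*} [TopologicalSpace S] [ChartedSpace H' S]
    {F : S → X} {V : ∀ x : S, TangentSpace I (F x)} {x : S} (hF : ContMDiffAt J I ∞ F x)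
    (hV : ContMDiffAt J 𝓘(ℝ, E) ∞ (fun y ↦ toCoord I (F x) (F y) (V y)) x) :
    ContMDiffAt J I.tangent ∞ (fun y ↦ (⟨F y, V y⟩ : TangentBundle I X)) x := by
  refine contMDiffAt_totalSpace.2 ⟨hF, hV.congr_of_eventuallyEq ?_⟩
  filter_upwards [hF.continuousAt.preimage_mem_nhds
    ((chartAt H (F x)).open_source.mem_nhds (mem_chart_source _ _))] with y hy
  exact congrArg Prod.snd (trivializationAt_eq_toCoord hy (V y))

section FlowParam

variable {n : ℕ} {M : Type*} [TopologicalSpace M] [ChartedSpace (EuclideanSpace ℝ (Fin n)) M]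
  [IsManifold (𝓡 n) ∞ M]
  {E' : Type*} [NormedAddCommGroup E'] [NormedSpace ℝ E']
  {H' : Type*} [TopologicalSpace H'] {J : ModelWithCorners ℝ E' H'}
  {S : Type*} [TopologicalSpace S] [ChartedSpace H' S]
  {g : ContMDiffRiemannianMetric (𝓡 n) ∞ (EuclideanSpace ℝ (Fin n))
      (fun x : M ↦ TangentSpace (𝓡 n) x)}
  {F : S → M × ℝ} {N : ∀ x : S, TangentSpace ((𝓡 n).prod 𝓘(ℝ, ℝ)) (F x)}
  {T : Set ℝ}
  {Ψ : PartialDiffeomorph ((𝓡 (n - 1)).prod 𝓘(ℝ, ℝ)) J (EuclideanSpace ℝ (Fin (n - 1)) × ℝ) S ∞}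

/-- `Ψ` parametrizes a part of the hypersurface by integral curves of the normalized gradient of
the height, starting at a level set of the height. -/
structure IsFlowParam (g : ContMDiffRiemannianMetric (𝓡 n) ∞ (EuclideanSpace ℝ (Fin n))
      (fun x : M ↦ TangentSpace (𝓡 n) x)) (F : S → M × ℝ)
    (N : ∀ x : S, TangentSpace ((𝓡 n).prod 𝓘(ℝ, ℝ)) (F x)) (T : Set ℝ)
    (Ψ : PartialDiffeomorph ((𝓡 (n - 1)).prod 𝓘(ℝ, ℝ)) J
      (EuclideanSpace ℝ (Fin (n - 1)) × ℝ) S ∞) : Prop where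
  principal : IsHeightPrincipal J g F N
  isOpen : IsOpen T
  ordConnected : T.OrdConnected
  zero_mem : (0 : ℝ) ∈ T
  source : Ψ.source = univ ×ˢ T
  velocity : ∀ p, ∀ s ∈ T, mfderiv 𝓘(ℝ, ℝ) J (fun r ↦ Ψ (p, r)) s (1 : ℝ) =
    speedFactor F N (Ψ (p, s)) • gradHeight J g F (Ψ (p, s))
  level : ∀ p, height F (Ψ (p, 0)) = height F (Ψ (0, 0))

namespace IsFlowParam

theorem contMDiffOn_map (h : IsFlowParam g F N T Ψ) :
    ContMDiffOn ((𝓡 (n - 1)).prod 𝓘(ℝ, ℝ)) (𝓡 n) ∞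
      (fun q : EuclideanSpace ℝ (Fin (n - 1)) × ℝ ↦ (F (Ψ (q.1, q.2))).1) (univ ×ˢ T) := by
  rw [← h.source]
  exact h.principal.unitNormal.contMDiff_fst.comp_contMDiffOn Ψ.contMDiffOn_toFun

theorem contMDiff_slice (h : IsFlowParam g F N T Ψ) {s : ℝ} (hs : s ∈ T) :
    ContMDiff (𝓡 (n - 1)) (𝓡 n) ∞ (fun p ↦ (F (Ψ (p, s))).1) := fun p ↦
  ContMDiffAt.comp (g := fun x ↦ (F x).1) p (h.principal.unitNormal.contMDiff_fst _)
    (contMDiffAt_slice_left h.source p hs)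

variable [FiniteDimensional ℝ E']

theorem isGeodesicOn (h : IsFlowParam g F N T Ψ) (p : EuclideanSpace ℝ (Fin (n - 1))) :
    IsGeodesicOn (metric g) (fun s ↦ (F (Ψ (p, s))).1) T :=
  h.principal.isGeodesicOn h.isOpen (fun _ hs ↦ contMDiffAt_slice_right h.source p hs)
    (h.velocity p)

theorem speed (h : IsFlowParam g F N T Ψ) (p : EuclideanSpace ℝ (Fin (n - 1))) {s : ℝ}
    (hs : s ∈ T) :
    g.inner (F (Ψ (p, s))).1 (mfderiv 𝓘(ℝ, ℝ) (𝓡 n) (fun s ↦ (F (Ψ (p, s))).1) s (1 : ℝ))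
      (mfderiv 𝓘(ℝ, ℝ) (𝓡 n) (fun s ↦ (F (Ψ (p, s))).1) s (1 : ℝ)) = 1 :=
  h.principal.speed_curve ((contMDiffAt_slice_right h.source p hs).mdifferentiableAt (by simp))
    (h.velocity p s hs)

theorem mfderiv_eq (h : IsFlowParam g F N T Ψ) (p : EuclideanSpace ℝ (Fin (n - 1))) {s : ℝ}
    (hs : s ∈ T) :
    mfderiv 𝓘(ℝ, ℝ) (𝓡 n) (fun s ↦ (F (Ψ (p, s))).1) s (1 : ℝ) =
      (-speedFactor F N (Ψ (p, s)) * sndT (F (Ψ (p, s))) (N (Ψ (p, s)))) •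
        fstT (F (Ψ (p, s))) (N (Ψ (p, s))) :=
  h.principal.mfderiv_fst_curve
    ((contMDiffAt_slice_right h.source p hs).mdifferentiableAt (by simp)) (h.velocity p s hs)

/-- Orthogonality of the geodesics to the slices is equivalent to the height being critical. -/
theorem inner_slice (h : IsFlowParam g F N T Ψ) (p : EuclideanSpace ℝ (Fin (n - 1)))
    (v : TangentSpace (𝓡 (n - 1)) p) {s : ℝ} (hs : s ∈ T) :
    g.inner (F (Ψ (p, s))).1 (mfderiv 𝓘(ℝ, ℝ) (𝓡 n) (fun s ↦ (F (Ψ (p, s))).1) s (1 : ℝ))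
      (mfderiv (𝓡 (n - 1)) (𝓡 n) (fun p ↦ (F (Ψ (p, s))).1) p v) =
    speedFactor F N (Ψ (p, s)) * sndT (F (Ψ (p, s))) (N (Ψ (p, s))) ^ 2 *
      mvfderiv (𝓡 (n - 1)) (fun p ↦ height F (Ψ (p, s))) p v := by
  have hd := (contMDiffAt_slice_left h.source p hs).mdifferentiableAt (by simp)
  have h1 : mfderiv (𝓡 (n - 1)) (𝓡 n) (fun p ↦ (F (Ψ (p, s))).1) p v = _ :=
    mfderiv_comp_apply (g := fun x ↦ (F x).1) (f := fun p ↦ Ψ (p, s)) p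
      (h.principal.unitNormal.contMDiff_fst.mdifferentiableAt (by simp)) hd v
  have h2 : mvfderiv (𝓡 (n - 1)) (fun p ↦ height F (Ψ (p, s))) p v =
      mvfderiv J (height F) (Ψ (p, s)) (mfderiv (𝓡 (n - 1)) J (fun p ↦ Ψ (p, s)) p v) :=
    mfderiv_comp_apply (g := height F) (f := fun p ↦ Ψ (p, s)) p
      (h.principal.unitNormal.contMDiff_height.mdifferentiableAt (by simp)) hd v
  have h3 := h.principal.unitNormal.normal_prod (Ψ (p, s))
    (mfderiv (𝓡 (n - 1)) J (fun p ↦ Ψ (p, s)) p v)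
  rw [h1, h2, h.mfderiv_eq p hs, map_smul, smul_apply, smul_eq_mul]
  linear_combination (-speedFactor F N (Ψ (p, s)) * sndT (F (Ψ (p, s))) (N (Ψ (p, s)))) * h3

theorem inner_slice_zero (h : IsFlowParam g F N T Ψ) (p : EuclideanSpace ℝ (Fin (n - 1)))
    (v : TangentSpace (𝓡 (n - 1)) p) :
    g.inner (F (Ψ (p, 0))).1 (mfderiv 𝓘(ℝ, ℝ) (𝓡 n) (fun s ↦ (F (Ψ (p, s))).1) 0 (1 : ℝ))
      (mfderiv (𝓡 (n - 1)) (𝓡 n) (fun p ↦ (F (Ψ (p, 0))).1) p v) = 0 := by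
  have h1 : (fun p ↦ height F (Ψ (p, 0))) = fun _ ↦ height F (Ψ (0, 0)) := funext h.level
  rw [h.inner_slice p v h.zero_mem, h1, mvfderiv_const]
  simp

/-- The initial slice is a level set, hence orthogonal to the geodesics; the Gauss lemma keeps all
slices orthogonal, and `inner_slice` translates this back into constancy of the height. -/
theorem mvfderiv_height_slice (h : IsFlowParam g F N T Ψ) (p : EuclideanSpace ℝ (Fin (n - 1)))
    (v : TangentSpace (𝓡 (n - 1)) p) {s : ℝ} (hs : s ∈ T) :
    mvfderiv (𝓡 (n - 1)) (fun p ↦ height F (Ψ (p, s))) p v = 0 := by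
  have h1 := eqOn_of_hasDerivAt_zero h.isOpen h.ordConnected (fun r hr ↦
    hasDerivAt_gauss g (f := fun s p ↦ (F (Ψ (p, s))).1) h.isOpen h.contMDiffOn_map h.isGeodesicOn
      (fun p s hs ↦ h.speed p hs) p v hr) hs h.zero_mem
  have h2 := (h.inner_slice p v hs).symm.trans (h1.trans (h.inner_slice_zero p v))
  refine (mul_eq_zero.1 h2).resolve_left (mul_ne_zero (h.principal.speedFactor_pos _).ne' ?_)
  exact pow_ne_zero 2 (h.principal.angle_ne_zero _)

theorem height_eq (h : IsFlowParam g F N T Ψ) (p : EuclideanSpace ℝ (Fin (n - 1))) {s : ℝ}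
    (hs : s ∈ T) : height F (Ψ (p, s)) = height F (Ψ (0, s)) := by
  have hc : ContMDiff (𝓡 (n - 1)) 𝓘(ℝ, ℝ) ∞ (fun p ↦ height F (Ψ (p, s))) := fun p ↦
    (h.principal.unitNormal.contMDiff_height _).comp p (contMDiffAt_slice_left h.source p hs)
  refine is_const_of_fderiv_eq_zero (𝕜 := ℝ) (f := fun p ↦ height F (Ψ (p, s)))
    (hc.contDiff.differentiable (by simp)) (fun q ↦ ?_) p 0
  ext v
  refine Eq.trans ?_ (h.mvfderiv_height_slice q v hs)
  exact congrArg (fun L : EuclideanSpace ℝ (Fin (n - 1)) →L[ℝ] ℝ ↦ L v) mfderiv_eq_fderiv.symm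

theorem isUnitNormal (h : IsFlowParam g F N T Ψ) :
    IsUnitNormal (𝓡 (n - 1)) (metric g) (fun p ↦ (F (Ψ (p, 0))).1)
      (fun p ↦ mfderiv 𝓘(ℝ, ℝ) (𝓡 n) (fun s ↦ (F (Ψ (p, s))).1) 0 (1 : ℝ)) where
  smooth := fun p ↦ by
    refine contMDiffAt_of_toCoord (h.contMDiff_slice h.zero_mem p) ?_
    have hΨ := contMDiffAt_slice_left h.source p h.zero_mem
    have h1 : ContMDiffAt J 𝓘(ℝ, EuclideanSpace ℝ (Fin n)) ∞
        (fun x ↦ (-speedFactor F N x * sndT (F x) (N x)) •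
          toCoord (𝓡 n) (F (Ψ (p, 0))).1 (F x).1 (fstT (F x) (N x))) (Ψ (p, 0)) :=
      ((h.principal.contMDiff_speedFactor _).neg.mul
        (h.principal.unitNormal.contMDiff_angle _)).smul
        (h.principal.unitNormal.contMDiffAt_toCoord_fst (mem_chart_source _ _))
    have h2 := h1.comp p hΨ
    refine h2.congr_of_eventuallyEq (Filter.Eventually.of_forall fun q ↦ ?_)
    exact (congrArg _ (h.mfderiv_eq q h.zero_mem)).trans (map_smul _ _ _)
  unit := fun p ↦ h.speed p h.zero_mem
  normal := fun p v ↦ h.inner_slice_zero p v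

/-- The family is the projection of the flow box to M. Since heights depend on s only, a may be read
along the curve of parameter 0, and a' > 0 because ξ increases along its gradient. -/
theorem isGraphOn (h : IsFlowParam g F N T Ψ)
    (Φ : PartialDiffeomorph ((𝓡 (n - 1)).prod 𝓘(ℝ, ℝ)) (𝓡 n)
      (EuclideanSpace ℝ (Fin (n - 1)) × ℝ) M ∞) (hΦ : Φ.source = univ ×ˢ T)
    (hΦΨ : ∀ p, ∀ s ∈ T, Φ (p, s) = (F (Ψ (p, s))).1) :
    IsGraphOn J g T (fun s p ↦ (F (Ψ (p, s))).1)
      (fun p ↦ mfderiv 𝓘(ℝ, ℝ) (𝓡 n) (fun s ↦ (F (Ψ (p, s))).1) 0 (1 : ℝ))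
      (fun s ↦ height F (Ψ (0, s))) F Ψ.target where
  parallel := {
    isOpen := h.isOpen
    ordConnected := h.ordConnected
    zero_mem := h.zero_mem
    smooth := h.contMDiffOn_map
    unitNormal := h.isUnitNormal
    geodesic := h.isGeodesicOn
    velocity := fun p ↦ rfl
    immersion := fun s hs ↦ ⟨h.contMDiff_slice hs, fun p ↦ by
      have hmem : (p, s) ∈ Φ.source := by rw [hΦ]; exact ⟨mem_univ _, hs⟩
      -- The first component of Φ⁻¹ is a smooth left inverse of f_s, so the differential of f_s is
      -- injective.
      have h1 : ContMDiffAt (𝓡 n) (𝓡 (n - 1)) ∞ (fun y ↦ (Φ.invFun y).1) (F (Ψ (p, s))).1 := by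
        rw [← hΦΨ p s hs]
        exact contMDiffAt_fst.comp _ (Φ.contMDiffOn_invFun.contMDiffAt
          (Φ.open_target.mem_nhds (Φ.map_source hmem)))
      have h2 : (fun q ↦ (Φ.invFun (F (Ψ (q, s))).1).1) = id := by
        funext q
        have hq : (q, s) ∈ Φ.source := by rw [hΦ]; exact ⟨mem_univ _, hs⟩
        rw [← hΦΨ q s hs]
        exact congrArg Prod.fst (Φ.left_inv hq)
      have h3 : ∀ v : EuclideanSpace ℝ (Fin (n - 1)),
          (mfderiv (𝓡 n) (𝓡 (n - 1)) (fun y ↦ (Φ.invFun y).1) (F (Ψ (p, s))).1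
            (mfderiv (𝓡 (n - 1)) (𝓡 n) (fun p ↦ (F (Ψ (p, s))).1) p v) :
              EuclideanSpace ℝ (Fin (n - 1))) = v := fun v ↦ by
        refine (mfderiv_comp_apply (f := fun p ↦ (F (Ψ (p, s))).1) p
          (h1.mdifferentiableAt (by simp))
          ((h.contMDiff_slice hs).mdifferentiableAt (by simp)) v).symm.trans ?_
        have h4 : mfderiv (𝓡 (n - 1)) (𝓡 (n - 1))
            (fun q ↦ (Φ.invFun (F (Ψ (q, s))).1).1) p =
            mfderiv (𝓡 (n - 1)) (𝓡 (n - 1)) id p := by rw [h2]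
        exact congrArg (fun L : EuclideanSpace ℝ (Fin (n - 1)) →L[ℝ]
          EuclideanSpace ℝ (Fin (n - 1)) ↦ L v) (h4.trans mfderiv_id)
      intro v w hvw
      rw [← h3 v, ← h3 w, hvw]⟩ }
  smooth := fun s hs ↦ (((h.principal.unitNormal.contMDiff_height _).comp s
    (contMDiffAt_slice_right h.source 0 hs)).contDiffAt).contDiffWithinAt
  deriv_pos := fun s hs ↦ by
    rw [(h.principal.hasDerivAt_height_curve (contMDiffAt_slice_right h.source 0 hs)
      (h.velocity 0 s hs)).deriv]
    exact mul_pos (h.principal.speedFactor_pos _) (h.principal.angle_sq_lt _)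
  param := ⟨Ψ, h.source, rfl, fun p s hs ↦ Prod.ext rfl (h.height_eq p hs)⟩

end IsFlowParam

end FlowParam

/-! ### Local existence of the parametrization -/

section Existence

variable {n : ℕ} {M : Type*} [TopologicalSpace M] [ChartedSpace (EuclideanSpace ℝ (Fin n)) M]
  [IsManifold (𝓡 n) ∞ M]
  {E' : Type*} [NormedAddCommGroup E'] [NormedSpace ℝ E'] [FiniteDimensional ℝ E']
  {H' : Type*} [TopologicalSpace H'] {J : ModelWithCorners ℝ E' H'} [J.Boundaryless]
  {S : Type*} [TopologicalSpace S] [ChartedSpace H' S] [IsManifold J ∞ S]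
  {g : ContMDiffRiemannianMetric (𝓡 n) ∞ (EuclideanSpace ℝ (Fin n))
      (fun x : M ↦ TangentSpace (𝓡 n) x)}
  {F : S → M × ℝ} {N : ∀ x : S, TangentSpace ((𝓡 n).prod 𝓘(ℝ, ℝ)) (F x)}

theorem exists_box_subset {E : Type*} [NormedAddCommGroup E] {W : Set (E × ℝ)}
    (hW : W ∈ 𝓝 ((0, 0) : E × ℝ)) :
    ∃ ε > 0, Metric.ball (0 : E) ε ×ˢ Ioo (-ε) ε ⊆ W := by
  obtain ⟨ε, hε, h⟩ := Metric.mem_nhds_iff.1 hW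
  refine ⟨ε, hε, ?_⟩
  rwa [← ball_prod_same, Real.ball_eq_Ioo, zero_sub, zero_add] at h

theorem IsHeightPrincipal.fderiv_height_field (h : IsHeightPrincipal J g F N) (x₀ : S) {y w : E'}
    (hy : y ∈ (extChartAt J x₀).target)
    (hw : mfderiv 𝓘(ℝ, E') J (extChartAt J x₀).symm y w =
        speedFactor F N ((extChartAt J x₀).symm y) •
          gradHeight J g F ((extChartAt J x₀).symm y)) :
    0 < fderiv ℝ (fun y ↦ height F ((extChartAt J x₀).symm y)) y w := by
  have h1 := mfderiv_comp_apply (g := height F) y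
    (h.unitNormal.contMDiff_height.mdifferentiableAt (by simp))
    ((contMDiffAt_extChartAt_symm x₀ hy).mdifferentiableAt (by simp)) w
  have h2 : fderiv ℝ (fun y ↦ height F ((extChartAt J x₀).symm y)) y w =
      mvfderiv J (height F) ((extChartAt J x₀).symm y)
        (mfderiv 𝓘(ℝ, E') J (extChartAt J x₀).symm y w) :=
    (congrArg (fun L : E' →L[ℝ] ℝ ↦ L w) mfderiv_eq_fderiv.symm).trans h1
  rw [h2, hw, map_smul, (h.gradHeight_spec _).2, smul_eq_mul]
  exact mul_pos (h.speedFactor_pos _) (h.angle_sq_lt _)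

/-- The inverse function theorem is applied twice to the same flow: to Ξ in the chart of the
hypersurface, giving Ψ, and to its projection in the chart of M, giving Φ. The projection is a local
diffeomorphism because θ ≠ 0. -/
theorem IsHeightPrincipal.exists_isFlowParam (h : IsHeightPrincipal J g F N) (hn : 1 ≤ n) (x₀ : S) :
    ∃ (T : Set ℝ) (Ψ : PartialDiffeomorph ((𝓡 (n - 1)).prod 𝓘(ℝ, ℝ)) J
        (EuclideanSpace ℝ (Fin (n - 1)) × ℝ) S ∞)
      (Φ : PartialDiffeomorph ((𝓡 (n - 1)).prod 𝓘(ℝ, ℝ)) (𝓡 n)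
        (EuclideanSpace ℝ (Fin (n - 1)) × ℝ) M ∞),
      IsFlowParam g F N T Ψ ∧ x₀ ∈ Ψ.target ∧ Φ.source = univ ×ˢ T ∧
        ∀ p, ∀ s ∈ T, Φ (p, s) = (F (Ψ (p, s))).1 := by
  set φ := extChartAt J x₀ with hφ
  set U := chartDomain n J F x₀ with hUdef
  have hU : IsOpen U := h.isOpen_chartDomain x₀
  have hy₀ : φ x₀ ∈ U := mem_chartDomain F x₀
  obtain ⟨v, hv, hvφ⟩ := h.exists_contDiffOn_field x₀
  have hζ : ContDiffOn ℝ ∞ (fun y ↦ height F (φ.symm y)) U := fun y hy ↦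
    ((h.unitNormal.contMDiff_height _).comp y
      (contMDiffAt_extChartAt_symm x₀ hy.1)).contDiffAt.contDiffWithinAt
  obtain ⟨Ξ, A, ε₀, hε₀, hΞ, hΞ0, hΞA, hΞv, hΞζ⟩ := exists_flow_of_level (k := n - 1)
    (by rw [h.finrank_eq]; omega) hU hv hζ hy₀
    (h.fderiv_height_field x₀ hy₀.1 (hvφ _ hy₀)).ne'
  have hbo : IsOpen (Metric.ball (0 : EuclideanSpace ℝ (Fin (n - 1))) ε₀ ×ˢ Ioo (-ε₀) ε₀) :=
    Metric.isOpen_ball.prod isOpen_Ioo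
  have h0b : ((0, 0) : EuclideanSpace ℝ (Fin (n - 1)) × ℝ) ∈ Metric.ball 0 ε₀ ×ˢ Ioo (-ε₀) ε₀ :=
    ⟨Metric.mem_ball_self hε₀, neg_lt_zero.2 hε₀, hε₀⟩
  obtain ⟨e₁, h0e₁, he₁s, he₁, he₁i⟩ :=
    exists_openPartialHomeomorph_contDiffOn_symm hbo hΞ h0b A hΞA
  obtain ⟨D, hD⟩ := h.isInvertible_fderiv_chartMap x₀ hy₀
  have hχ : ContDiffOn ℝ ∞ (fun q ↦ chartMap n J F x₀ (Ξ q))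
      (Metric.ball 0 ε₀ ×ˢ Ioo (-ε₀) ε₀) :=
    (h.contDiffOn_chartMap x₀).comp hΞ fun q hq ↦ (hΞv q.1 hq.1 q.2 hq.2).1
  have hχA : HasFDerivAt (fun q ↦ chartMap n J F x₀ (Ξ q))
      ((A.trans D : _ ≃L[ℝ] EuclideanSpace ℝ (Fin n)) :
        EuclideanSpace ℝ (Fin (n - 1)) × ℝ →L[ℝ] EuclideanSpace ℝ (Fin n)) (0, 0) := by
    have h1 : HasFDerivAt (chartMap n J F x₀) (D : E' →L[ℝ] EuclideanSpace ℝ (Fin n))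
        (Ξ (0, 0)) := by
      rw [hD, hΞ0]
      exact (((h.contDiffOn_chartMap x₀).contDiffAt (hU.mem_nhds hy₀)).differentiableAt
        (by simp)).hasFDerivAt
    exact HasFDerivAt.comp (g := chartMap n J F x₀) (0, 0) h1 hΞA
  obtain ⟨e₂, h0e₂, he₂s, he₂, he₂i⟩ :=
    exists_openPartialHomeomorph_contDiffOn_symm hbo hχ h0b (A.trans D) hχA
  -- A common box and the same reparametrization of the ball for both, so that Φ is exactly the
  -- projection of F ∘ Ψ.
  obtain ⟨ε, hε, hbox⟩ := exists_box_subset (Filter.inter_mem (e₁.open_source.mem_nhds h0e₁)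
    (e₂.open_source.mem_nhds h0e₂))
  have hsub : Metric.ball (0 : EuclideanSpace ℝ (Fin (n - 1))) ε ×ˢ Ioo (-ε) ε ⊆
      Metric.ball 0 ε₀ ×ˢ Ioo (-ε₀) ε₀ := fun q hq ↦ he₁s (hbox hq).1
  have hΞU : ∀ q ∈ Metric.ball (0 : EuclideanSpace ℝ (Fin (n - 1))) ε ×ˢ Ioo (-ε) ε, Ξ q ∈ U :=
    fun q hq ↦ (hΞv q.1 (hsub hq).1 q.2 (hsub hq).2).1
  obtain ⟨Ψ, hΨs, hΨ⟩ := exists_partialDiffeomorph_of_box x₀ e₁ hε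
    ((hΞ.mono hsub).congr fun q _ ↦ he₁ q) he₁i (fun q hq ↦ (hbox hq).1)
    (fun q hq ↦ by rw [he₁]; exact (hΞU q hq).1)
  have hmem : ∀ q ∈ Metric.ball (0 : EuclideanSpace ℝ (Fin (n - 1))) ε ×ˢ Ioo (-ε) ε,
      (F (φ.symm (Ξ q))).1 ∈ (extChartAt (𝓡 n) (F x₀).1).source := fun q hq ↦ by
    rw [extChartAt_source]; exact (hΞU q hq).2
  obtain ⟨Φ, hΦs, hΦ⟩ := exists_partialDiffeomorph_of_box (J := 𝓡 n) (F x₀).1 e₂ hε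
    ((hχ.mono hsub).congr fun q _ ↦ he₂ q) he₂i (fun q hq ↦ (hbox hq).2)
    (fun q hq ↦ by rw [he₂]; exact (extChartAt (𝓡 n) (F x₀).1).map_source (hmem q hq))
  set u := OpenPartialHomeomorph.univBall (0 : EuclideanSpace ℝ (Fin (n - 1))) ε with hu
  have hum : ∀ p, u p ∈ Metric.ball 0 ε := fun p ↦ by
    rw [← OpenPartialHomeomorph.univBall_target (0 : EuclideanSpace ℝ (Fin (n - 1))) hε]
    exact u.map_source (by rw [hu, OpenPartialHomeomorph.univBall_source]; exact mem_univ p)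
  have h0i : (0 : ℝ) ∈ Ioo (-ε) ε := ⟨neg_lt_zero.2 hε, hε⟩
  have hΨΞ : ∀ p s, Ψ (p, s) = φ.symm (Ξ (u p, s)) := fun p s ↦ by
    rw [hΨ, he₁]
  have hlevel : ∀ p, height F (Ψ (p, 0)) = height F (φ.symm (φ x₀)) := fun p ↦ by
    rw [hΨΞ]
    exact hΞζ (u p) (hsub ⟨hum p, h0i⟩ : (u p, (0 : ℝ)) ∈ _).1
  refine ⟨Ioo (-ε) ε, Ψ, Φ, ⟨h, isOpen_Ioo, ordConnected_Ioo, h0i, hΨs, fun p s hs ↦ ?_,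
    fun p ↦ ?_⟩, ?_, hΦs, fun p s hs ↦ ?_⟩
  · have hq : (u p, s) ∈ Metric.ball (0 : EuclideanSpace ℝ (Fin (n - 1))) ε ×ˢ Ioo (-ε) ε :=
      ⟨hum p, hs⟩
    have hd := (hΞv (u p) (hsub hq).1 s (hsub hq).2).2
    have h1 : (fun r ↦ Ψ (p, r)) = fun r ↦ φ.symm (Ξ (u p, r)) := funext (hΨΞ p)
    have h2 : mfderiv 𝓘(ℝ, ℝ) J (fun r ↦ φ.symm (Ξ (u p, r))) s (1 : ℝ) =
        mfderiv 𝓘(ℝ, E') J φ.symm (Ξ (u p, s)) (v (Ξ (u p, s))) := by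
      refine (mfderiv_comp_apply (g := φ.symm) (f := fun r ↦ Ξ (u p, r)) s
        ((contMDiffAt_extChartAt_symm x₀ (hΞU _ hq).1).mdifferentiableAt (by simp))
        hd.differentiableAt.mdifferentiableAt (1 : ℝ)).trans ?_
      have h4 : mvfderiv 𝓘(ℝ, ℝ) (fun r ↦ Ξ (u p, r)) s (1 : ℝ) = v (Ξ (u p, s)) :=
        mvfderiv_real_one.trans hd.deriv
      exact congrArg (mfderiv 𝓘(ℝ, E') J φ.symm (Ξ (u p, s))) h4
    have h3 := h2.trans (hvφ _ (hΞU _ hq))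
    rw [h1, hΨΞ]
    exact h3
  · rw [hlevel, hlevel]
  · have h1 : Ψ (0, 0) = x₀ := by
      rw [hΨΞ, hu, OpenPartialHomeomorph.univBall_apply_zero, hΞ0]
      exact extChartAt_to_inv x₀
    rw [← h1]
    exact Ψ.map_source (by rw [hΨs]; exact ⟨mem_univ _, h0i⟩)
  · have hq : (u p, s) ∈ Metric.ball (0 : EuclideanSpace ℝ (Fin (n - 1))) ε ×ˢ Ioo (-ε) ε :=
      ⟨hum p, hs⟩
    rw [hΦ, he₂, hΨΞ]
    exact (extChartAt (𝓡 n) (F x₀).1).left_inv (hmem _ hq)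

theorem IsHeightPrincipal.isLocallyGraph (h : IsHeightPrincipal J g F N) (hn : 1 ≤ n) :
    IsLocallyGraph J g F := by
  intro x₀
  obtain ⟨T, Ψ, Φ, hΨ, hx, hΦ, hΦΨ⟩ := h.exists_isFlowParam hn x₀
  exact ⟨Ψ.target, Ψ.open_target, hx, EuclideanSpace ℝ (Fin (n - 1)), inferInstance, inferInstance,
    inferInstance, inferInstance, inferInstance, T, _, _, _, hΨ.isGraphOn Φ hΦ hΦΨ, Φ, hΦ, hΦΨ⟩

end Existence

end ParallelGraph

end

theorem mainTheorem6 {n : ℕ} (hn : 2 ≤ n)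
    {M : Type*} [TopologicalSpace M] [T2Space M] [ChartedSpace (EuclideanSpace ℝ (Fin n)) M]
    [IsManifold (𝓡 n) ∞ M]
    (g : ContMDiffRiemannianMetric (𝓡 n) ∞ (EuclideanSpace ℝ (Fin n))
      (fun x : M ↦ TangentSpace (𝓡 n) x))
    {E' : Type*} [NormedAddCommGroup E'] [NormedSpace ℝ E'] [FiniteDimensional ℝ E']
    {H' : Type*} [TopologicalSpace H'] (J : ModelWithCorners ℝ E' H') [J.Boundaryless]
    {S : Type*} [TopologicalSpace S] [T2Space S] [ChartedSpace H' S] [IsManifold J ∞ S]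
    (hdim : Module.finrank ℝ E' = n)
    (F : S → M × ℝ) (N : ∀ x : S, TangentSpace ((𝓡 n).prod 𝓘(ℝ, ℝ)) (F x))
    (hN : ParallelGraph.IsUnitNormal J (ParallelGraph.prodMetric g) F N) :
    (∀ (P : Type*) [TopologicalSpace P] [T2Space P]
        [ChartedSpace (EuclideanSpace ℝ (Fin (n - 1))) P] [IsManifold (𝓡 (n - 1)) ∞ P]
        (T : Set ℝ) (f : ℝ → P → M) (η : ∀ p : P, TangentSpace (𝓡 n) (f 0 p)) (a : ℝ → ℝ),
        ParallelGraph.IsGraphOn J g T f η a F univ →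
        (∀ x, ParallelGraph.angle g F N x ≠ 0 ∧ ParallelGraph.gradHeight J g F x ≠ 0) ∧
        (∀ x, ParallelGraph.IsPrincipalDirection g F N x (ParallelGraph.gradHeight J g F x)) ∧
        ((PreconnectedSpace S ∨ ∀ x, 0 < ParallelGraph.angle g F N x) →
          ∀ x y, ParallelGraph.height F x = ParallelGraph.height F y →
            ParallelGraph.angle g F N x = ParallelGraph.angle g F N y ∧
            ∀ κ μ : ℝ,
              ParallelGraph.HasPrincipalCurvature g F N x (ParallelGraph.gradHeight J g F x) κ →
              ParallelGraph.HasPrincipalCurvature g F N y (ParallelGraph.gradHeight J g F y) μ →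
              κ = μ)) ∧
    (ParallelGraph.IsImmersed J ((𝓡 n).prod 𝓘(ℝ, ℝ)) F →
      (∀ x, ParallelGraph.angle g F N x ≠ 0) →
      (∀ x, ParallelGraph.IsPrincipalDirection g F N x (ParallelGraph.gradHeight J g F x)) →
      ParallelGraph.IsLocallyGraph J g F) := by
  refine ⟨fun P _ _ _ _ T f η a hG ↦ hG.conclusions hdim (by omega) hN, fun hF hθ hA ↦ ?_⟩
  refine ParallelGraph.IsHeightPrincipal.isLocallyGraph ⟨hdim, hN, hF.injective, fun x ↦ ?_, hA⟩
    (by omega)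
  rw [← ParallelGraph.angle_eq g]
  exact hθ x
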